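/- Let $X$ be a coherent (i.e. quasi-compact and quasi-separated) scheme with finitely many connected components. Let $\mathbf{\acute Et}_{/X}$ be the étale site of $X$ (étale $X$-schemes with the étale topology), and let $\mathbf{\acute Et}_{\mathrm f/X}$ be its full subcategory of finite étale $X$-schemes, endowed with the topology induced by that of $\mathbf{\acute Et}_{/X}$. Let $X_{\mathrm{\acute et}}$ and $X_{\mathrm{f\acute et}}$ be the topoi of sheaves of sets on these two sites, and let $\rho_X\colon X_{\mathrm{\acute et}}\to X_{\mathrm{f\acute et}}$ be the morphism defined by the inclusion $\mathbf{\acute Et}_{\mathrm f/X}\to\mathbf{\acute Et}_{/X}$: $\rho_{X*}$ is the restriction of sheaves (of sets, resp. of abelian groups) to finite étale $X$-schemes, and $\rho_X^*$ is its left adjoint. A sheaf of sets on $X_{\mathrm{\acute et}}$ is called locally constant and constructible if, locally for the étale topology on $X$, it is isomorphic to the constant sheaf associated with a finite set. An abelian sheaf on $X_{\mathrm{\acute et}}$ is called locally constant and constructible if, locally for the étale topology on $X$, it is isomorphic to the constant sheaf associated with a finitely generated abelian group. An abelian sheaf on a site is called torsion if each of its sections is, locally, killed by a positive integer. (1) Let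 $F$ be a sheaf of sets on $X_{\mathrm{\acute et}}$. The following conditions are equivalent: (i) there are a sheaf $G$ of $X_{\mathrm{f\acute et}}$ and an isomorphism $F\simeq\rho_X^*(G)$; (ii) $F$ is the colimit in $X_{\mathrm{\acute et}}$ of a (small) filtered system of locally constant constructible sheaves of sets. (2) Let $F$ be a torsion abelian sheaf on $X_{\mathrm{\acute et}}$. The following conditions are equivalent: (i) there are a torsion abelian sheaf $G$ of $X_{\mathrm{f\acute et}}$ and an isomorphism of abelian sheaves $F\simeq\rho_X^*(G)$; (ii) $F$ is the colimit, in the category of abelian sheaves on $X_{\mathrm{\acute et}}$, of a (small) filtered system of torsion abelian sheaves that are locally constant and constructible. -/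

import Mathlib

open CategoryTheory Limits Opposite AlgebraicGeometry

universe u

noncomputable section

namespace FiniteEtaleTopos

/-! ### The finite étale site and the morphism `ρ_X` -/

/-- Finite étale morphisms of schemes ("revêtements étales"; they need not be surjective). -/
abbrev finiteEtale : MorphismProperty Scheme.{u} := @IsFinite ⊓ @Etale

/-- The category of finite étale `X`-schemes, with all `X`-morphisms between them. -/
abbrev FEt (X : Scheme.{u}) : Type (u + 1) := (finiteEtale.{u}).Over ⊤ X

/-- The (fully faithful) inclusion of finite étale `X`-schemes into étale `X`-schemes. -/
abbrev FEt.toEtale (X : Scheme.{u}) : FEt X ⥤ X.Etale :=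
  MorphismProperty.Over.changeProp X (inf_le_right : finiteEtale.{u} ≤ @Etale) le_rfl

/-- The topology of the finite étale site of `X`: the topology induced by that of the étale site,
i.e. the finest topology for which the inclusion functor is continuous. -/
def FEt.topology (X : Scheme.{u}) : GrothendieckTopology (FEt X) :=
  (FEt.toEtale X).inducedTopology X.smallEtaleTopology

instance (X : Scheme.{u}) : (FEt.toEtale X).IsContinuous (FEt.topology X) X.smallEtaleTopology :=
  inferInstanceAs ((FEt.toEtale X).IsContinuous ((FEt.toEtale X).inducedTopology _) _)

/-- An `X`-scheme is the colimit, in the category of `X`-schemes, of the members of any locally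
directed open cover. -/
theorem colimitsOfShape_of_openCover {X : Scheme.{u}} (Y : Over X) (𝒱 : Y.left.OpenCover)
    [Category.{u} 𝒱.I₀] [𝒱.LocallyDirected] (Q : ObjectProperty (Over X))
    (hQ : ∀ i, Q (Over.mk (𝒱.f i ≫ Y.hom))) : Q.colimitsOfShape 𝒱.I₀ Y := by
  let D : 𝒱.I₀ ⥤ Over X :=
    { obj i := Over.mk (𝒱.f i ≫ Y.hom)
      map {i j} h := Over.homMk (𝒱.trans h) (by
        change 𝒱.trans h ≫ 𝒱.f j ≫ Y.hom = 𝒱.f i ≫ Y.hom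
        rw [← Category.assoc, 𝒱.trans_map])
      map_id i := by ext1; exact 𝒱.trans_id i
      map_comp f g := by ext1; exact 𝒱.trans_comp f g }
  let α : D ⟶ (Functor.const _).obj Y :=
    { app i := Over.homMk (𝒱.f i) rfl
      naturality i j h := by
        ext1
        exact (𝒱.trans_map h).trans (Category.comp_id _).symm }
  let g (s : Cocone D) (i : 𝒱.I₀) : 𝒱.X i ⟶ s.pt.left := (s.ι.app i).left
  have hg (s : Cocone D) {i j : 𝒱.I₀} (h : i ⟶ j) : 𝒱.trans h ≫ g s j = g s i :=
    congr($(s.w h).left)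
  have hc : IsColimit (Cocone.mk Y α) :=
    { desc s := 𝒱.glueMorphismsOverOfLocallyDirected (g s) (hg s) fun i ↦ Over.w (s.ι.app i)
      fac s i := by
        apply Over.OverMorphism.ext
        exact 𝒱.map_glueMorphismsOfLocallyDirected (g s) (hg s) i
      uniq s m hm := by
        apply Over.OverMorphism.ext
        refine 𝒱.hom_ext _ _ fun i ↦ ?_
        exact Eq.trans (congr($(hm i).left))
          (𝒱.map_glueMorphismsOfLocallyDirected (g s) (hg s) i).symm }
  exact ⟨{ diag := D, ι := α, isColimit := hc, prop_diag_obj := hQ }⟩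

/-- The category of finite étale `X`-schemes is essentially `u`-small. -/
instance FEt.essentiallySmall (X : Scheme.{u}) : EssentiallySmall.{u} (FEt X) := by
  let Q : ObjectProperty (Over X) :=
    ObjectProperty.ofObj (((equivSmallModel.{u} X.AffineEtale).inverse ⋙
      Scheme.AffineEtale.Spec X ⋙ Scheme.Etale.forget X).obj)
  have : ObjectProperty.Small.{u} Q := inferInstance
  let J := X.directedAffineCover.I₀
  have : Small.{u} J := inferInstanceAs (Small.{u} X.affineOpens)
  have : ObjectProperty.EssentiallySmall.{u} (Q.colimitsOfShape J) := by
    rw [← ObjectProperty.isoClosure_strictColimitsOfShape]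
    infer_instance
  let G : FEt X ⥤ Over X := MorphismProperty.Over.forget _ ⊤ X
  have hQ (Y : FEt X) : Q.colimitsOfShape J (G.obj Y) := by
    let f : (G.obj Y).left ⟶ X := (G.obj Y).hom
    have : IsFinite f := Y.prop.1
    have : Etale f := Y.prop.2
    let 𝒱 : (G.obj Y).left.OpenCover := X.directedAffineCover.pullback₁ f
    let : Category.{u} 𝒱.I₀ := inferInstanceAs (Category.{u} X.directedAffineCover.I₀)
    let : 𝒱.LocallyDirected := Scheme.Cover.locallyDirectedPullbackCover X.directedAffineCover f
    rw [← ObjectProperty.colimitsOfShape_isoClosure]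
    refine colimitsOfShape_of_openCover (G.obj Y) 𝒱 _ fun U ↦ ?_
    have : IsAffine (𝒱.X U) := by
      have : IsAffine (X.directedAffineCover.X U) := U.2
      let p : 𝒱.X U ⟶ X.directedAffineCover.X U := pullback.snd f (X.directedAffineCover.f U)
      have : IsAffineHom p :=
        haveI : IsAffineHom f := inferInstance
        inferInstanceAs (IsAffineHom (pullback.snd f (X.directedAffineCover.f U)))
      exact isAffine_of_isAffineHom p
    let g : Spec Γ(𝒱.X U, ⊤) ⟶ X := (𝒱.X U).isoSpec.inv ≫ 𝒱.f U ≫ f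
    have : Etale g := inferInstance
    refine ⟨_, ⟨(equivSmallModel.{u} X.AffineEtale).functor.obj (.mk g)⟩, ⟨?_ ≪≫
      (Scheme.AffineEtale.Spec X ⋙ Scheme.Etale.forget X).mapIso
        ((equivSmallModel.{u} X.AffineEtale).unitIso.app (.mk g))⟩⟩
    refine Over.isoMk (𝒱.X U).isoSpec ?_
    change (𝒱.X U).isoSpec.hom ≫ (𝒱.X U).isoSpec.inv ≫ 𝒱.f U ≫ f = 𝒱.f U ≫ f
    rw [Iso.hom_inv_id_assoc]
  have : G.Full := inferInstanceAs (MorphismProperty.Over.forget _ ⊤ X).Full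
  have : G.Faithful := inferInstanceAs (MorphismProperty.Over.forget _ ⊤ X).Faithful
  exact essentiallySmall_of_fully_faithful (ObjectProperty.lift _ G hQ)

/-- Presheaves on the finite étale site extend (by left Kan extension) to the étale site, so that the
inverse image functor `rhoPullback` below exists. -/
instance {A : Type*} [Category.{u} A] [HasColimitsOfSize.{u, u} A] (X : Scheme.{u})
    (F : (FEt X)ᵒᵖ ⥤ A) : (FEt.toEtale X).op.HasLeftKanExtension F := by
  have : LocallySmall.{u} X.Etale := inferInstance
  have (Y : X.Etaleᵒᵖ) : HasColimitsOfShape (CostructuredArrow (FEt.toEtale X).op Y) A :=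
    hasColimitsOfShape_of_essentiallySmall.{u} _ _
  infer_instance

/-- The direct image functor `ρ_{X*}` from sheaves on the étale site of `X` to sheaves on the finite
étale site of `X`: restriction along the inclusion of sites. -/
abbrev rhoPushforward (X : Scheme.{u}) (A : Type (u + 1)) [Category.{u} A] :
    Sheaf X.smallEtaleTopology A ⥤ Sheaf (FEt.topology X) A :=
  (FEt.toEtale X).sheafPushforwardContinuous A (FEt.topology X) X.smallEtaleTopology

/-- The inverse image functor `ρ_X^*`, left adjoint to `ρ_{X*}`. It is used for sheaves of sets and
for sheaves of abelian groups. -/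
abbrev rhoPullback (X : Scheme.{u}) (A : Type (u + 1)) [Category.{u} A]
    [(rhoPushforward X A).IsRightAdjoint] :
    Sheaf (FEt.topology X) A ⥤ Sheaf X.smallEtaleTopology A :=
  (FEt.toEtale X).sheafPullback A (FEt.topology X) X.smallEtaleTopology

/-! ### Restriction of étale sheaves along étale morphisms -/

/-- The functor `U_ét ⥤ X_ét` given by composition with an étale morphism `f : U ⟶ X`. -/
def etaleMap {U X : Scheme.{u}} (f : U ⟶ X) [Etale f] : U.Etale ⥤ X.Etale where
  obj V := .mk (V.hom ≫ f)
  map g := MorphismProperty.Over.homMk g.left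
    (by
      have := MorphismProperty.Over.w g
      change g.left ≫ _ ≫ f = _ ≫ f
      rw [← this, Category.assoc]) trivial
  map_id _ := MorphismProperty.Over.Hom.ext rfl
  map_comp _ _ := MorphismProperty.Over.Hom.ext rfl

theorem etaleMap_compatiblePreserving {U X : Scheme.{u}} (f : U ⟶ X) [Etale f] :
    CompatiblePreserving.{u + 1} X.smallEtaleTopology (etaleMap f) where
  compatible ℱ {Z} T x hx Y₁ Y₂ W f₁ f₂ g₁ g₂ hg₁ hg₂ heq := by
    let a₁ : W.left ⟶ Y₁.left := f₁.left
    let a₂ : W.left ⟶ Y₂.left := f₂.left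
    have h₁ : a₁ ≫ Y₁.hom ≫ f = W.hom := MorphismProperty.Over.w f₁
    have h₃ : a₁ ≫ g₁.left = a₂ ≫ g₂.left := congr($(heq).left)
    have w₁ : g₁.left ≫ Z.hom = Y₁.hom := MorphismProperty.Over.w g₁
    have w₂ : g₂.left ≫ Z.hom = Y₂.hom := MorphismProperty.Over.w g₂
    have h₄ : a₂ ≫ Y₂.hom = a₁ ≫ Y₁.hom := by
      rw [← w₁, ← w₂, ← Category.assoc, ← h₃, Category.assoc]
    have : Etale ((a₁ ≫ Y₁.hom) ≫ f) := by
      rw [Category.assoc, h₁]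
      exact W.prop
    have : Etale (a₁ ≫ Y₁.hom) := Etale.of_comp _ f
    let V : U.Etale := .mk (a₁ ≫ Y₁.hom)
    let f₁' : V ⟶ Y₁ := MorphismProperty.Over.homMk a₁ rfl trivial
    let f₂' : V ⟶ Y₂ := MorphismProperty.Over.homMk a₂ h₄ trivial
    let e : W ⟶ (etaleMap f).obj V := MorphismProperty.Over.homMk (𝟙 W.left)
      ((Category.id_comp _).trans ((Category.assoc _ _ _).trans h₁)) trivial
    have e₁ : f₁ = e ≫ (etaleMap f).map f₁' :=
      MorphismProperty.Over.Hom.ext (Category.id_comp a₁).symm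
    have e₂ : f₂ = e ≫ (etaleMap f).map f₂' :=
      MorphismProperty.Over.Hom.ext (Category.id_comp a₂).symm
    have key := hx f₁' f₂' hg₁ hg₂ (MorphismProperty.Over.Hom.ext h₃)
    rw [e₁, e₂]
    simp only [op_comp, Functor.map_comp, types_comp_apply]
    exact congrArg _ key

theorem etaleMap_coverPreserving {U X : Scheme.{u}} (f : U ⟶ X) [Etale f] :
    CoverPreserving U.smallEtaleTopology X.smallEtaleTopology (etaleMap f) where
  cover_preserve {V S} hS := by
    obtain ⟨ι, Z, g, rfl⟩ := S.exists_eq_ofArrows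
    rw [Scheme.ofArrows_mem_smallEtaleTopology_iff] at hS
    rw [Sieve.functorPushforward_ofArrows, Scheme.ofArrows_mem_smallEtaleTopology_iff]
    exact hS

instance {U X : Scheme.{u}} (f : U ⟶ X) [Etale f] :
    (etaleMap f).IsContinuous U.smallEtaleTopology X.smallEtaleTopology :=
  Functor.isContinuous_of_coverPreserving (etaleMap_compatiblePreserving f)
    (etaleMap_coverPreserving f)

/-- The restriction `F ↦ F|U` of sheaves on the étale site of `X` along an étale morphism `U ⟶ X`:
its sections on an étale `U`-scheme `V` are the sections of `F` on `V ⟶ U ⟶ X`. -/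
abbrev etaleRestrict {U X : Scheme.{u}} (f : U ⟶ X) [Etale f] (A : Type (u + 1)) [Category.{u} A] :
    Sheaf X.smallEtaleTopology A ⥤ Sheaf U.smallEtaleTopology A :=
  (etaleMap f).sheafPushforwardContinuous A U.smallEtaleTopology X.smallEtaleTopology

/-! ### Locally constant constructible sheaves and torsion sheaves -/

/-- A sheaf `F` on the étale site of `X` is locally constant with values satisfying `P` if there is
an étale covering `(Uᵢ ⟶ X)` (a jointly surjective family of étale morphisms) such that every
`F|Uᵢ` is isomorphic to the constant sheaf on the étale site of `Uᵢ` associated with some `E`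
satisfying `P`. -/
def IsLocallyConstantWithValues {X : Scheme.{u}} {A : Type (u + 1)} [Category.{u} A]
    [∀ U : Scheme.{u}, HasWeakSheafify U.smallEtaleTopology A] (P : ObjectProperty A) :
    ObjectProperty (Sheaf X.smallEtaleTopology A) := fun F ↦
  ∃ (ι : Type u) (U : ι → Scheme.{u}) (f : ∀ i, U i ⟶ X) (_ : ∀ i, Etale (f i)),
    (⋃ i, Set.range (f i)) = Set.univ ∧
    ∀ i, ∃ E : A, P E ∧
      Nonempty ((etaleRestrict (f i) A).obj F ≅ (constantSheaf (U i).smallEtaleTopology A).obj E)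

/-- Locally constant constructible étale sheaves of sets: locally constant with finite values. -/
def IsLCC (X : Scheme.{u}) : ObjectProperty (Sheaf X.smallEtaleTopology (Type u)) :=
  IsLocallyConstantWithValues fun E ↦ Finite E

/-- Locally constant constructible étale sheaves of abelian groups (`ℤ`-modules): locally constant
with finitely generated values. -/
def IsLCCAb (X : Scheme.{u}) : ObjectProperty (Sheaf X.smallEtaleTopology Ab.{u}) :=
  IsLocallyConstantWithValues fun E ↦ AddGroup.FG E

/-- A sheaf of abelian groups is a torsion sheaf if each of its sections is, locally for the
topology, killed by a positive integer. -/
def IsTorsionSheaf {C : Type*} [Category* C] (J : GrothendieckTopology C) :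
    ObjectProperty (Sheaf J Ab.{u}) := fun F ↦
  ∀ (U : C) (s : F.obj.obj (op U)), ∃ S ∈ J U, ∀ ⦃V : C⦄ (f : V ⟶ U), S f →
    ∃ n : ℕ, 0 < n ∧ n • F.obj.map f.op s = 0

end FiniteEtaleTopos

end

noncomputable section

namespace FiniteEtaleTopos

/-! ### Equality loci of sections on the étale site -/

section EtaleSite

variable {X : Scheme.{u}}

/-! Both conditions are compared with two intrinsic properties of `F`: the open locus where two
sections agree is also closed (`HasClopenEquality`), and every section comes étale locally from a
section over a finite étale `X`-scheme (`IsLocallyFiniteEtale`). The abelian case runs in parallel,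
since filtered colimits of abelian groups are computed on underlying sets.

Inverse images. `ρ^* G` is the sheaf associated with the left Kan extension of `G`, whose value at
`U` is a filtered colimit of the `G(Y)` over maps `U ⟶ Y` with `Y` finite étale. So sections come
locally from some `G(Y)`, and two sections over `Y` agree exactly on the union of the images of
those finite étale `Y' ⟶ Y` that equalize them. Each image is clopen, and since `X` has finitely
many components any union of clopens of `Y` is closed (`isClosed_iUnion_of_isClopen`); this gives
`clopen_and_finiteEtale_of_W`. Conversely, if `F` has both properties, then `ρ^* ρ_* F ⟶ F` is an
isomorphism (`W_of_clopen_of_finiteEtale`): surjectivity is the second property, and for injectivity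
a map `U ⟶ Y` equalizing two sections factors through their equality locus, which is clopen in `Y`
and hence itself finite étale over `X`.

Filtered colimits. A locally constant sheaf with finite values is represented by a finite étale
`X`-scheme, by étale descent of finite étale algebras followed by Zariski gluing
(`IsLocallyTrivial.exists_finiteEtale`), so it has both properties. They pass to filtered colimits,
again because unions of clopens are closed (`hasClopenEquality_of_isColimit`). Conversely, `F` with
both properties is the directed union of the subsheaves generated by finitely many sections over
finite étale schemes. Étale locally these schemes split, so finitely many sections exhaust the
subsheaf, and clopen equality makes it locally constant
(`IsLocallyExhaustive.exists_isTrivialization`).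

For torsion abelian sheaves, finitely generated stalk groups become finite. Quasi-compactness of `X`
bounds the order of each section over a finite étale scheme, which makes the generated subgroups
finite and `ρ_* F` torsion. -/

instance etale_left {U V : X.Etale} (f : V ⟶ U) : Etale f.left := by
  have h : f.left ≫ U.hom = V.hom := MorphismProperty.Over.w f
  have : Etale U.hom := U.prop
  have : Etale (f.left ≫ U.hom) := h ▸ V.prop
  exact Etale.of_comp f.left U.hom

@[simp]
theorem comp_left_apply {U V W : X.Etale} (f : V ⟶ U) (g : W ⟶ V) (w : W.left) :
    (g ≫ f).left w = f.left (g.left w) := rfl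

theorem mem_smallEtaleTopology_iff {U : X.Etale} (S : Sieve U) :
    S ∈ X.smallEtaleTopology U ↔
      ∀ x : U.left, ∃ (V : X.Etale) (f : V ⟶ U), S f ∧ x ∈ Set.range f.left := by
  obtain ⟨ι, Z, g, rfl⟩ := S.exists_eq_ofArrows
  rw [Scheme.ofArrows_mem_smallEtaleTopology_iff, Set.eq_univ_iff_forall]
  refine forall_congr' fun x ↦ ?_
  rw [Set.mem_iUnion]
  constructor
  · rintro ⟨i, hi⟩
    exact ⟨_, g i, Sieve.ofArrows_mk _ _ i, hi⟩
  · rintro ⟨V, f, ⟨W, a, _, ⟨i⟩, rfl⟩, v, rfl⟩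
    exact ⟨i, a.left v, by simp⟩

theorem exists_pullback_point {U V W : X.Etale} (f : V ⟶ U) (g : W ⟶ U) (v : V.left) (w : W.left)
    (h : f.left v = g.left w) :
    ∃ z : (pullback f g).left, (pullback.fst f g).left z = v ∧ (pullback.snd f g).left z = w := by
  let G := Scheme.Etale.forget X ⋙ Over.forget X
  have hp : IsPullback (pullback.fst f g).left (pullback.snd f g).left f.left g.left :=
    (IsPullback.of_hasPullback f g).map G
  exact Scheme.exists_preimage_of_isPullback hp v w h

/-- An open subscheme of an étale `X`-scheme, as an étale `X`-scheme. -/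
def openSub (U : X.Etale) (W : U.left.Opens) : X.Etale :=
  let f : U.left ⟶ X := U.hom
  haveI : Etale f := U.prop
  .mk (W.ι ≫ f)

/-- The inclusion of an open subscheme. -/
def openSubι (U : X.Etale) (W : U.left.Opens) : openSub U W ⟶ U :=
  MorphismProperty.Over.homMk W.ι rfl trivial

theorem range_openSubι (U : X.Etale) (W : U.left.Opens) :
    Set.range (openSubι U W).left = W := Scheme.Opens.range_ι W

theorem exists_lift_openSub {U V : X.Etale} (W : U.left.Opens) (f : V ⟶ U)
    (h : ∀ v, f.left v ∈ W) : ∃ g : V ⟶ openSub U W, g ≫ openSubι U W = f := by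
  have h' : Set.range f.left ⊆ Set.range W.ι := by
    rw [Scheme.Opens.range_ι]; rintro _ ⟨v, rfl⟩; exact h v
  let j : (W : Scheme.{u}) ⟶ U.left := W.ι
  have : IsOpenImmersion j := inferInstanceAs (IsOpenImmersion (Scheme.Opens.ι W))
  let k : V.left ⟶ W := IsOpenImmersion.lift j f.left h'
  have hk : k ≫ j = f.left := IsOpenImmersion.lift_fac _ _ _
  refine ⟨MorphismProperty.Over.homMk k ?_ trivial, MorphismProperty.Over.Hom.ext hk⟩
  change k ≫ j ≫ U.hom = _
  rw [← Category.assoc, hk]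
  exact MorphismProperty.Over.w f

variable (P : X.Etaleᵒᵖ ⥤ Type u)

/-- The locus where two sections of a presheaf on the étale site agree étale locally. -/
def eqLocus {P : X.Etaleᵒᵖ ⥤ Type u} {U : X.Etale} (x y : P.obj (op U)) : U.left.Opens where
  carrier := {a | ∃ (V : X.Etale) (f : V ⟶ U), a ∈ Set.range f.left ∧
    P.map f.op x = P.map f.op y}
  is_open' := by
    have : {a : U.left | ∃ (V : X.Etale) (f : V ⟶ U), a ∈ Set.range f.left ∧
        P.map f.op x = P.map f.op y} = ⋃ (V : X.Etale), ⋃ (f : V ⟶ U),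
          ⋃ (_ : P.map f.op x = P.map f.op y), Set.range f.left := by
      ext a; simp only [Set.mem_ofPred_eq, Set.mem_iUnion]; grind
    rw [this]
    exact isOpen_iUnion fun V ↦ isOpen_iUnion fun f ↦ isOpen_iUnion fun _ ↦
      f.left.isOpenMap.isOpen_range

variable {P}

theorem eqLocus_map {U V : X.Etale} (f : V ⟶ U) (x y : P.obj (op U)) :
    eqLocus (P.map f.op x) (P.map f.op y) = f.left ⁻¹ᵁ eqLocus x y := by
  ext a
  constructor
  · rintro ⟨W, g, ⟨w, rfl⟩, h⟩
    refine ⟨W, g ≫ f, ⟨w, by simp⟩, ?_⟩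
    simpa using h
  · rintro ⟨W, g, ⟨w, hw⟩, h⟩
    obtain ⟨z, hz₁, hz₂⟩ := exists_pullback_point f g a w hw.symm
    refine ⟨_, pullback.fst f g, ⟨z, hz₁⟩, ?_⟩
    simp only [← Functor.map_comp_apply, ← op_comp, pullback.condition]
    simp only [op_comp, Functor.map_comp_apply, h]

/-- For a separated presheaf the equality locus is thus the largest subobject on which the two
sections agree; this lets set-theoretic conditions on points stand in for equalizers. -/
theorem map_eq_iff (hP : Presieve.IsSeparated X.smallEtaleTopology P) {U V : X.Etale}
    (f : V ⟶ U) (x y : P.obj (op U)) :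
    P.map f.op x = P.map f.op y ↔ ∀ v, f.left v ∈ eqLocus x y := by
  constructor
  · exact fun h v ↦ ⟨V, f, ⟨v, rfl⟩, h⟩
  · intro h
    let S : Sieve V :=
      { arrows W g := P.map g.op (P.map f.op x) = P.map g.op (P.map f.op y)
        downward_closed := by
          intro Y Z a ha b
          simp only [op_comp, Functor.map_comp_apply, ha] }
    have hS : S ∈ X.smallEtaleTopology V := by
      rw [mem_smallEtaleTopology_iff]
      intro v
      have hv : v ∈ eqLocus (P.map f.op x) (P.map f.op y) := by
        rw [eqLocus_map]; exact h v
      obtain ⟨W, g, hg, e⟩ := hv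
      exact ⟨W, g, e, hg⟩
    exact (hP S hS).ext fun W g hg ↦ hg

theorem eq_of_eqLocus (hP : Presieve.IsSeparated X.smallEtaleTopology P) {U : X.Etale}
    {x y : P.obj (op U)} (h : ∀ v, v ∈ eqLocus x y) : x = y := by
  have := (map_eq_iff hP (𝟙 U) x y).2 (fun v ↦ by simpa using! h v)
  simpa using this

/-- Equality of sections of `P` is an open and closed condition. -/
def HasClopenEquality (P : X.Etaleᵒᵖ ⥤ Type u) : Prop :=
  ∀ ⦃U : X.Etale⦄ (x y : P.obj (op U)), IsClosed (eqLocus x y : Set U.left)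

/-- Sections of `P` are étale locally induced by sections over finite étale `X`-schemes. -/
def IsLocallyFiniteEtale (P : X.Etaleᵒᵖ ⥤ Type u) : Prop :=
  ∀ ⦃U : X.Etale⦄ (x : P.obj (op U)) (a : U.left), ∃ (V : X.Etale) (f : V ⟶ U),
    a ∈ Set.range f.left ∧ ∃ (Y : FEt X) (h : V ⟶ (FEt.toEtale X).obj Y)
      (s : P.obj (op ((FEt.toEtale X).obj Y))), P.map h.op s = P.map f.op x

/-- Étale maps are open, so the complement of `Z` is a union of images of open sets. -/
theorem isClosed_of_locally {U : X.Etale} (Z : Set U.left)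
    (h : ∀ a : U.left, ∃ (V : X.Etale) (f : V ⟶ U), a ∈ Set.range f.left ∧
      IsClosed (f.left ⁻¹' Z)) : IsClosed Z := by
  rw [← isOpen_compl_iff, isOpen_iff_forall_mem_open]
  intro a ha
  obtain ⟨V, f, ⟨v, rfl⟩, hZ⟩ := h a
  refine ⟨f.left '' (f.left ⁻¹' Z)ᶜ, ?_, f.left.isOpenMap _ hZ.isOpen_compl, v, ha, rfl⟩
  rintro _ ⟨w, hw, rfl⟩
  exact hw

theorem isClosed_eqLocus_of_locally {U : X.Etale} (x y : P.obj (op U))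
    (h : ∀ a : U.left, ∃ (V : X.Etale) (f : V ⟶ U), a ∈ Set.range f.left ∧
      IsClosed (eqLocus (P.map f.op x) (P.map f.op y) : Set V.left)) :
    IsClosed (eqLocus x y : Set U.left) := by
  refine isClosed_of_locally _ fun a ↦ ?_
  obtain ⟨V, f, ha, hc⟩ := h a
  refine ⟨V, f, ha, ?_⟩
  rw [eqLocus_map] at hc
  exact hc

end EtaleSite

/-! ### Unions of clopen subsets of a finite étale scheme -/

section Clopen

variable {X : Scheme.{u}} [Finite (_root_.ConnectedComponents X)]

/-- If `X` has finitely many connected components and `Y` is finite étale over `X`, then any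
union of open and closed subsets of `Y` is closed. -/
theorem isClosed_iUnion_of_isClopen (Y : FEt X) {ι : Type*} (Z : ι → Set Y.left)
    (hZ : ∀ i, IsClopen (Z i)) : IsClosed (⋃ i, Z i) := by
  have : IsFinite Y.hom := Y.prop.1
  have : Etale Y.hom := Y.prop.2
  -- One point is chosen in each component of `X`. A nonempty clopen of `Y` has clopen image in `X`,
  -- so it meets the fibre over one of these points; the fibres are finite, so finitely many `Z i`
  -- already cover everything.
  let pt (c : _root_.ConnectedComponents X) : X := c.exists_rep.choose
  have hpt (c) : (pt c : _root_.ConnectedComponents X) = c := c.exists_rep.choose_spec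
  let Fib : Set Y.left := ⋃ c, Y.hom ⁻¹' {pt c}
  have hFib : Fib.Finite := Set.finite_iUnion fun c ↦ Y.hom.finite_preimage_singleton (pt c)
  have key : ∀ y : (Fib ∩ ⋃ i, Z i : Set Y.left), ∃ i, y.1 ∈ Z i := fun y ↦ by simpa using y.2.2
  choose k hk using key
  have : Finite (Fib ∩ ⋃ i, Z i : Set Y.left) := hFib.inter_of_left _
  have hcl : IsClopen (⋃ y, Z (k y)) := isClopen_iUnion_of_finite fun y ↦ hZ _
  suffices (⋃ i, Z i) = ⋃ y, Z (k y) by rw [this]; exact hcl.1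
  apply subset_antisymm _ (Set.iUnion_subset fun y ↦ Set.subset_iUnion Z _)
  refine Set.iUnion_subset fun i ↦ ?_
  by_contra hne
  obtain ⟨y, hy, hy'⟩ := Set.not_subset.1 hne
  -- What the finite subunion misses is clopen and contains `y`; its image contains `pt c` for the
  -- component of the image of `y`, but any point over `pt c` in the union is covered by the choice
  -- of `k`.
  have hD : IsClopen (Z i \ ⋃ y, Z (k y)) := (hZ i).diff hcl
  have hI : IsClopen (Y.hom '' (Z i \ ⋃ y, Z (k y))) :=
    ⟨Y.hom.isClosedMap _ hD.1, Y.hom.isOpenMap _ hD.2⟩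
  let c : _root_.ConnectedComponents X := ConnectedComponents.mk (Y.hom y)
  have hmem : pt c ∈ Y.hom '' (Z i \ ⋃ y, Z (k y)) := by
    apply hI.connectedComponent_subset (x := Y.hom y) ⟨y, ⟨hy, hy'⟩, rfl⟩
    rw [ConnectedComponents.coe_eq_coe.1 ((hpt c).symm : ConnectedComponents.mk (Y.hom y) = _)]
    exact mem_connectedComponent
  obtain ⟨z, ⟨hz, hz'⟩, hzc⟩ := hmem
  refine hz' (Set.mem_iUnion.2 ⟨⟨z, Set.mem_iUnion.2 ⟨c, hzc⟩, Set.mem_iUnion.2 ⟨i, hz⟩⟩, hk _⟩)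

end Clopen

/-! ### Finite limits of finite étale schemes and filteredness -/

section FiniteLimits

instance : (finiteEtale.{u}).IsStableUnderBaseChange :=
  MorphismProperty.IsStableUnderBaseChange.inf (P := @IsFinite.{u}) (Q := @Etale.{u})

instance : (finiteEtale.{u}).IsMultiplicative where
  id_mem X := ⟨inferInstanceAs (IsFinite (𝟙 X)), inferInstanceAs (Etale (𝟙 X))⟩
  comp_mem f g hf hg := by
    have := hf.1; have := hf.2; have := hg.1; have := hg.2
    exact ⟨inferInstanceAs (IsFinite (f ≫ g)), inferInstanceAs (Etale (f ≫ g))⟩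

instance : (finiteEtale.{u}).HasOfPostcompProperty finiteEtale.{u} where
  of_postcomp f g hg hfg := by
    have : IsFinite g := hg.1
    have : Etale g := hg.2
    have : IsFinite (f ≫ g) := hfg.1
    have : Etale (f ≫ g) := hfg.2
    exact ⟨MorphismProperty.of_postcomp @IsFinite (W' := @IsSeparated) f g inferInstance hfg.1,
      Etale.of_comp f g⟩

instance (X : Scheme.{u}) : PreservesFiniteLimits (FEt.toEtale X) where
  preservesFiniteLimits J _ _ := by
    have : PreservesLimitsOfShape J (FEt.toEtale X ⋙ Scheme.Etale.forget X) :=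
      inferInstanceAs (PreservesLimitsOfShape J
        (MorphismProperty.Over.forget finiteEtale.{u} ⊤ X))
    exact preservesLimitsOfShape_of_reflects_of_preserves _ (Scheme.Etale.forget X)

instance (X : Scheme.{u}) : RepresentablyFlat (FEt.toEtale X) := flat_of_preservesFiniteLimits _

/-- Filteredness of these index categories makes the left Kan extension along the inclusion of sites
computable on elements. -/
instance (X : Scheme.{u}) (U : X.Etaleᵒᵖ) :
    IsFiltered (CostructuredArrow (FEt.toEtale X).op U) :=
  have : IsCofiltered (StructuredArrow U.unop (FEt.toEtale X)) := inferInstance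
  IsFiltered.of_equivalence (structuredArrowOpEquivalence (FEt.toEtale X) U.unop)

end FiniteLimits

/-! ### Recognizing inverse images through local isomorphisms -/

section Pullback

variable {C D : Type*} [Category* C] [Category* D] (L : C ⥤ D) (J : GrothendieckTopology C)
  (K : GrothendieckTopology D) {A : Type*} [Category* A] [L.IsContinuous J K]
  [∀ F : Cᵒᵖ ⥤ A, L.op.HasLeftKanExtension F]
  [(L.sheafPushforwardContinuous A J K).IsRightAdjoint]

/-- A morphism `G ⟶ L_* F` corresponds to an isomorphism `L^* G ≅ F` if and only if the
corresponding morphism from the left Kan extension of `G` is a local isomorphism. -/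
theorem isIso_homEquiv_symm_iff {G : Sheaf J A} {F : Sheaf K A}
    (φ : G ⟶ (L.sheafPushforwardContinuous A J K).obj F) (ψ : L.op.lan.obj G.obj ⟶ F.obj)
    (hψ : (L.op.lanAdjunction A).homEquiv G.obj F.obj ψ = φ.hom) :
    IsIso (((L.sheafAdjunctionContinuous A J K).homEquiv G F).symm φ) ↔ K.W ψ := by
  -- Both sides are tested on maps into an arbitrary sheaf `H`: the two adjunctions identify maps
  -- `L^* G ⟶ H` with maps from the Kan extension of `G` to `H`.
  rw [isIso_iff_coyoneda_map_bijective]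
  have h (H : Sheaf K A) : (Function.Bijective fun x : F ⟶ H ↦
      ((L.sheafAdjunctionContinuous A J K).homEquiv G F).symm φ ≫ x) ↔
      Function.Bijective fun x : F.obj ⟶ H.obj ↦ ψ ≫ x := by
    let e₁ : (F ⟶ H) ≃ (F.obj ⟶ H.obj) := (fullyFaithfulSheafToPresheaf K A).homEquiv
    let e₂ : (G ⟶ (L.sheafPushforwardContinuous A J K).obj H) ≃ (G.obj ⟶ L.op ⋙ H.obj) :=
      (fullyFaithfulSheafToPresheaf J A).homEquiv
    let e₃ : (L.op.lan.obj G.obj ⟶ H.obj) ≃ (G.obj ⟶ L.op ⋙ H.obj) :=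
      (L.op.lanAdjunction A).homEquiv G.obj H.obj
    let e : (F ⟶ H) → ((L.sheafPullback A J K).obj G ⟶ H) := fun x ↦
      ((L.sheafAdjunctionContinuous A J K).homEquiv G F).symm φ ≫ x
    let e' : (F.obj ⟶ H.obj) → (L.op.lan.obj G.obj ⟶ H.obj) := fun x ↦ ψ ≫ x
    let e₄ : ((L.sheafPullback A J K).obj G ⟶ H) ≃ (G.obj ⟶ L.op ⋙ H.obj) :=
      ((L.sheafAdjunctionContinuous A J K).homEquiv G H).trans e₂
    have key (x : F ⟶ H) : e₃ (e' (e₁ x)) = e₄ (e x) := by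
      have h₁ : e₃ (e' (e₁ x)) = φ.hom ≫ L.op.whiskerLeft (e₁ x) := by
        refine ((L.op.lanAdjunction A).homEquiv_naturality_right ψ (e₁ x)).trans ?_
        rw [hψ]; rfl
      have h₂ : (L.sheafAdjunctionContinuous A J K).homEquiv G H (e x) =
          φ ≫ (L.sheafPushforwardContinuous A J K).map x := by
        refine ((L.sheafAdjunctionContinuous A J K).homEquiv_naturality_right _ x).trans ?_
        rw [Equiv.apply_symm_apply]
      rw [h₁]
      exact (congrArg e₂ h₂).symm
    have key' : e₃ ∘ e' ∘ e₁ = e₄ ∘ e := funext key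
    change Function.Bijective e ↔ Function.Bijective e'
    rw [← Equiv.comp_bijective e e₄, ← key', Equiv.comp_bijective, Equiv.bijective_comp]
  simp only [h]
  exact ⟨fun H Z hZ ↦ H ⟨Z, hZ⟩, fun H T ↦ H T.obj T.property⟩

end Pullback

/-! ### Elements of the left Kan extension -/

section Lan

variable {X : Scheme.{u}} {A : Type (u + 1)} [Category.{u} A] {FA : A → A → Type*}
  {CA : A → Type u} [∀ V W, FunLike (FA V W) (CA V) (CA W)] [ConcreteCategory.{u} A FA]
  [HasColimits A] [PreservesFilteredColimitsOfSize.{u, u} (forget A)]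

instance (U : X.Etaleᵒᵖ) : EssentiallySmall.{u} (CostructuredArrow (FEt.toEtale X).op U) := by
  have : LocallySmall.{u} X.Etale := inferInstance
  infer_instance

instance (U : X.Etaleᵒᵖ) :
    PreservesColimitsOfShape (CostructuredArrow (FEt.toEtale X).op U) (forget A) := by
  let e := equivSmallModel.{u} (CostructuredArrow (FEt.toEtale X).op U)
  have : IsFiltered (SmallModel.{u} (CostructuredArrow (FEt.toEtale X).op U)) :=
    IsFiltered.of_equivalence e
  exact preservesColimitsOfShape_of_equiv e.symm _

variable (G : (FEt X)ᵒᵖ ⥤ A)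

instance : (FEt.toEtale X).op.HasPointwiseLeftKanExtension G := fun U ↦ by
  have : HasColimitsOfShape (CostructuredArrow (FEt.toEtale X).op U) A :=
    hasColimitsOfShape_of_essentiallySmall.{u} _ _
  infer_instance

/-- The canonical map from a presheaf on finite étale `X`-schemes to its left Kan extension. -/
abbrev lanUnitApp (Y : FEt X) : G.obj (op Y) ⟶
    ((FEt.toEtale X).op.lan.obj G).obj (op ((FEt.toEtale X).obj Y)) :=
  ((FEt.toEtale X).op.lanUnit.app G).app (op Y)

theorem lanUnitApp_comp_map {U : X.Etale} {Y : FEt X} (h : U ⟶ (FEt.toEtale X).obj Y) :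
    lanUnitApp G Y ≫ ((FEt.toEtale X).op.lan.obj G).map h.op =
    ((Functor.LeftExtension.mk ((FEt.toEtale X).op.leftKanExtension G)
      ((FEt.toEtale X).op.leftKanExtensionUnit G)).coconeAt (op U)).ι.app
        (CostructuredArrow.mk (Y := op Y) h.op) := rfl

theorem lan_exists_rep {U : X.Etale} (x : ToType (((FEt.toEtale X).op.lan.obj G).obj (op U))) :
    ∃ (Y : FEt X) (h : U ⟶ (FEt.toEtale X).obj Y) (s : ToType (G.obj (op Y))),
      ((FEt.toEtale X).op.lan.obj G).map h.op (lanUnitApp G Y s) = x := by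
  let hc := Functor.isPointwiseLeftKanExtensionLeftKanExtensionUnit (FEt.toEtale X).op G (op U)
  obtain ⟨j, s, hs⟩ := Concrete.isColimit_exists_rep _ hc x
  refine ⟨j.left.unop, j.hom.unop, s, ?_⟩
  have e := ConcreteCategory.congr_hom (lanUnitApp_comp_map G j.hom.unop) s
  exact (ConcreteCategory.comp_apply (lanUnitApp G j.left.unop) _ _).symm.trans (e.trans hs)

theorem lan_exists_of_eq {U : X.Etale} {Y : FEt X} (h : U ⟶ (FEt.toEtale X).obj Y)
    {s t : ToType (G.obj (op Y))}
    (e : ((FEt.toEtale X).op.lan.obj G).map h.op (lanUnitApp G Y s) =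
      ((FEt.toEtale X).op.lan.obj G).map h.op (lanUnitApp G Y t)) :
    ∃ (Y' : FEt X) (p : Y' ⟶ Y) (h' : U ⟶ (FEt.toEtale X).obj Y'),
      h' ≫ (FEt.toEtale X).map p = h ∧ G.map p.op s = G.map p.op t := by
  let hc := Functor.isPointwiseLeftKanExtensionLeftKanExtensionUnit (FEt.toEtale X).op G (op U)
  let j : CostructuredArrow (FEt.toEtale X).op (op U) := CostructuredArrow.mk (Y := op Y) h.op
  rw [← ConcreteCategory.comp_apply, ← ConcreteCategory.comp_apply, lanUnitApp_comp_map] at e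
  obtain ⟨k, f, g, hfg⟩ := (Concrete.isColimit_rep_eq_iff_exists (i := j) (j := j) _ hc s t).1 e
  -- The filtered colimit only equates `s` and `t` along two possibly different maps `f`, `g`;
  -- coequalizing them gives a single refinement `Y' ⟶ Y`.
  let l := IsFiltered.coeq f g
  let c := IsFiltered.coeqHom f g
  refine ⟨l.left.unop, (f ≫ c).left.unop, l.hom.unop, ?_, ?_⟩
  · exact congrArg Quiver.Hom.unop (CostructuredArrow.w (f ≫ c))
  · have hs := (CostructuredArrow.proj _ _ ⋙ G).map_comp_apply f c s
    have ht := (CostructuredArrow.proj _ _ ⋙ G).map_comp_apply g c t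
    have hc : f ≫ c = g ≫ c := IsFiltered.coeq_condition f g
    rw [← hc] at ht
    exact hs.trans (Eq.trans (congrArg _ hfg) ht.symm)

end Lan

/-! ### Inverse images characterized by clopen equality and finite étale generation -/

section Characterization

variable {X : Scheme.{u}}

theorem exists_common_finiteEtale {U : X.Etale} {Y₁ Y₂ : FEt X} (h₁ : U ⟶ (FEt.toEtale X).obj Y₁)
    (h₂ : U ⟶ (FEt.toEtale X).obj Y₂) :
    ∃ (Y : FEt X) (p₁ : Y ⟶ Y₁) (p₂ : Y ⟶ Y₂) (h : U ⟶ (FEt.toEtale X).obj Y),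
      h ≫ (FEt.toEtale X).map p₁ = h₁ ∧ h ≫ (FEt.toEtale X).map p₂ = h₂ := by
  let a₁ : StructuredArrow U (FEt.toEtale X) := StructuredArrow.mk h₁
  let a₂ : StructuredArrow U (FEt.toEtale X) := StructuredArrow.mk h₂
  exact ⟨(IsCofiltered.min a₁ a₂).right, (IsCofiltered.minToLeft a₁ a₂).right,
    (IsCofiltered.minToRight a₁ a₂).right, (IsCofiltered.min a₁ a₂).hom,
    StructuredArrow.w (IsCofiltered.minToLeft a₁ a₂),
    StructuredArrow.w (IsCofiltered.minToRight a₁ a₂)⟩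

theorem isClopen_range_of_finiteEtale {Y Y' : FEt X} (p : Y' ⟶ Y) :
    IsClopen (Set.range ((FEt.toEtale X).map p).left) := by
  let q : Y'.left ⟶ Y.left := p.left
  have hq : finiteEtale.{u} q := by
    have h : q ≫ Y.hom = Y'.hom := MorphismProperty.Over.w p
    exact MorphismProperty.of_postcomp finiteEtale.{u} (W' := finiteEtale.{u}) q Y.hom Y.prop
      (h ▸ Y'.prop)
  have : IsFinite q := hq.1
  have : Etale q := hq.2
  exact ⟨q.isClosedMap.isClosed_range, q.isOpenMap.isOpen_range⟩

/-- An open and closed subscheme of a finite étale `X`-scheme. -/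
theorem exists_finiteEtale_of_isClosed {Y : FEt X} (Z : ((FEt.toEtale X).obj Y).left.Opens)
    (hZ : IsClosed (Z : Set ((FEt.toEtale X).obj Y).left)) :
    ∃ (Y' : FEt X) (p : Y' ⟶ Y), (∀ y, ((FEt.toEtale X).map p).left y ∈ Z) ∧
      ∀ (U : X.Etale) (h : U ⟶ (FEt.toEtale X).obj Y), (∀ v, h.left v ∈ Z) →
        ∃ h' : U ⟶ (FEt.toEtale X).obj Y', h' ≫ (FEt.toEtale X).map p = h := by
  let Z' : Y.left.Opens := Z
  let q : Y.left ⟶ X := Y.hom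
  have : IsFinite q := Y.prop.1
  have : Etale q := Y.prop.2
  have hr : IsClosed (Set.range Z'.ι) := by rw [Scheme.Opens.range_ι]; exact hZ
  have : IsClosedImmersion Z'.ι := .of_isPreimmersion _ hr
  let Y' : FEt X := MorphismProperty.Over.mk ⊤ (Z'.ι ≫ q)
    ⟨inferInstanceAs (IsFinite (Z'.ι ≫ q)), inferInstanceAs (Etale (Z'.ι ≫ q))⟩
  let p : Y' ⟶ Y := MorphismProperty.Over.homMk Z'.ι rfl trivial
  refine ⟨Y', p, fun y ↦ ?_, fun U h hh ↦ exists_lift_openSub Z h hh⟩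
  have : Z'.ι y ∈ Set.range Z'.ι := ⟨y, rfl⟩
  rw [Scheme.Opens.range_ι] at this
  exact this

variable {A : Type (u + 1)} [Category.{u} A] {FA : A → A → Type*}
  {CA : A → Type u} [∀ V W, FunLike (FA V W) (CA V) (CA W)] [ConcreteCategory.{u} A FA]

theorem isSheaf_forget [X.smallEtaleTopology.HasSheafCompose (forget A)]
    (F : Sheaf X.smallEtaleTopology A) :
    Presieve.IsSheaf X.smallEtaleTopology (F.obj ⋙ forget A) :=
  (isSheaf_iff_isSheaf_of_type _ _).1 ((sheafCompose X.smallEtaleTopology (forget A)).obj F).property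

theorem isSeparated_forget [X.smallEtaleTopology.HasSheafCompose (forget A)]
    (F : Sheaf X.smallEtaleTopology A) :
    Presieve.IsSeparated X.smallEtaleTopology (F.obj ⋙ forget A) :=
  (isSheaf_forget F).isSeparated

section

variable [HasColimits A]

theorem lan_map_lanUnitApp (G : (FEt X)ᵒᵖ ⥤ A) {Y Y' : FEt X} (p : Y' ⟶ Y)
    (s : ToType (G.obj (op Y))) :
    ((FEt.toEtale X).op.lan.obj G).map ((FEt.toEtale X).map p).op (lanUnitApp G Y s) =
      lanUnitApp G Y' (G.map p.op s) := by
  have h : lanUnitApp G Y ≫ ((FEt.toEtale X).op.lan.obj G).map ((FEt.toEtale X).map p).op =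
      G.map p.op ≫ lanUnitApp G Y' :=
    (((FEt.toEtale X).op.lanUnit.app G).naturality p.op).symm
  rw [← ConcreteCategory.comp_apply, h, ConcreteCategory.comp_apply]

theorem app_lanUnitApp {G : (FEt X)ᵒᵖ ⥤ A} {P : X.Etaleᵒᵖ ⥤ A}
    (ψ : (FEt.toEtale X).op.lan.obj G ⟶ P) (φ : G ⟶ (FEt.toEtale X).op ⋙ P)
    (hψ : ((FEt.toEtale X).op.lanAdjunction A).homEquiv G P ψ = φ) (Y : FEt X)
    (s : ToType (G.obj (op Y))) :
    ψ.app (op ((FEt.toEtale X).obj Y)) (lanUnitApp G Y s) = φ.app (op Y) s := by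
  have h : lanUnitApp G Y ≫ ψ.app (op ((FEt.toEtale X).obj Y)) = φ.app (op Y) := by
    rw [← hψ, Adjunction.homEquiv_unit, Functor.lanAdjunction_unit]
    rfl
  rw [← ConcreteCategory.comp_apply, h]

end

variable [PreservesLimits (forget A)] [HasColimits A] [HasLimits A]
  [(forget A).ReflectsIsomorphisms] [PreservesFilteredColimitsOfSize.{u, u} (forget A)]
  [X.smallEtaleTopology.HasSheafCompose (forget A)]

omit [X.smallEtaleTopology.HasSheafCompose (forget A)] in
-- Local surjectivity of `ψ` gives finite étale generation. By local injectivity, sections from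
-- `G(Y)` agree at a point only if they already agree on some finite étale `Y' ⟶ Y` through that
-- point, so their equality locus is a union of clopens.
theorem clopen_and_finiteEtale_of_W [Finite (_root_.ConnectedComponents X)] {G : (FEt X)ᵒᵖ ⥤ A} {F : Sheaf X.smallEtaleTopology A}
    (ψ : (FEt.toEtale X).op.lan.obj G ⟶ F.obj) (φ : G ⟶ (FEt.toEtale X).op ⋙ F.obj)
    (hψ : ((FEt.toEtale X).op.lanAdjunction A).homEquiv G F.obj ψ = φ)
    (hW : X.smallEtaleTopology.W ψ) :
    HasClopenEquality (F.obj ⋙ forget A) ∧ IsLocallyFiniteEtale (F.obj ⋙ forget A) := by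
  have hinj := hW.isLocallyInjective
  have hsurj := hW.isLocallySurjective
  have h2 {U : X.Etale} (x : ToType (F.obj.obj (op U))) (a : U.left) :
      ∃ (V : X.Etale) (f : V ⟶ U), a ∈ Set.range f.left ∧
      ∃ (Y : FEt X) (h : V ⟶ (FEt.toEtale X).obj Y) (s : ToType (G.obj (op Y))),
        F.obj.map h.op (φ.app (op Y) s) = F.obj.map f.op x := by
    obtain ⟨V, f, ⟨t, ht⟩, ha⟩ := (mem_smallEtaleTopology_iff _).1 (hsurj.imageSieve_mem x) a
    obtain ⟨Y, h, s, rfl⟩ := lan_exists_rep G t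
    refine ⟨V, f, ha, Y, h, s, ?_⟩
    rw [← app_lanUnitApp ψ φ hψ, ← ht, ← NatTrans.naturality_apply]
  have h1 (Y : FEt X) (s t : ToType (G.obj (op Y))) :
      IsClosed (eqLocus (P := F.obj ⋙ forget A) (U := (FEt.toEtale X).obj Y)
        (φ.app (op Y) s) (φ.app (op Y) t) : Set ((FEt.toEtale X).obj Y).left) := by
    have : (eqLocus (P := F.obj ⋙ forget A) (U := (FEt.toEtale X).obj Y)
        (φ.app (op Y) s) (φ.app (op Y) t) : Set ((FEt.toEtale X).obj Y).left) =
        ⋃ (i : {i : Σ Y' : FEt X, Y' ⟶ Y // G.map i.2.op s = G.map i.2.op t}),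
          Set.range ((FEt.toEtale X).map i.1.2).left := by
      ext a
      rw [Set.mem_iUnion]
      constructor
      · rintro ⟨V, f, ⟨v, rfl⟩, e⟩
        replace e : F.obj.map f.op (φ.app (op Y) s) = F.obj.map f.op (φ.app (op Y) t) := e
        rw [← app_lanUnitApp ψ φ hψ, ← app_lanUnitApp ψ φ hψ, ← NatTrans.naturality_apply,
          ← NatTrans.naturality_apply] at e
        obtain ⟨W, g, hg, ⟨w, rfl⟩⟩ :=
          (mem_smallEtaleTopology_iff _).1 (hinj.equalizerSieve_mem _ _ e) v
        replace hg : ((FEt.toEtale X).op.lan.obj G).map (g ≫ f).op (lanUnitApp G Y s) =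
            ((FEt.toEtale X).op.lan.obj G).map (g ≫ f).op (lanUnitApp G Y t) := by
          rw [op_comp, Functor.map_comp_apply, Functor.map_comp_apply]
          exact hg
        obtain ⟨Y', p, h', w', e'⟩ := lan_exists_of_eq G _ hg
        refine ⟨⟨⟨Y', p⟩, e'⟩, h'.left w, ?_⟩
        change (h' ≫ (FEt.toEtale X).map p).left w = _
        rw [w']
        rfl
      · rintro ⟨⟨⟨Y', p⟩, e⟩, y, rfl⟩
        refine ⟨_, (FEt.toEtale X).map p, ⟨y, rfl⟩, ?_⟩
        have hs := NatTrans.naturality_apply φ p.op s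
        have ht := NatTrans.naturality_apply φ p.op t
        exact hs.symm.trans (Eq.trans (congrArg _ e) ht)
    rw [this]
    exact isClosed_iUnion_of_isClopen Y _ fun i ↦ isClopen_range_of_finiteEtale i.1.2
  refine ⟨fun U x y ↦ ?_, fun U x a ↦ ?_⟩
  -- Two arbitrary sections come, near `a`, from sections over one common finite étale `Y`, where
  -- `h1` applies; closedness then pulls back along `h`.
  · refine isClosed_eqLocus_of_locally _ _ fun a ↦ ?_
    obtain ⟨V, f, ⟨v, rfl⟩, Y₁, h₁, s, hs⟩ := h2 x a
    obtain ⟨W, g, ⟨w, rfl⟩, Y₂, h₂, t, ht⟩ := h2 (F.obj.map f.op y) v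
    obtain ⟨Y, p₁, p₂, h, e₁, e₂⟩ := exists_common_finiteEtale (g ≫ h₁) h₂
    refine ⟨W, g ≫ f, ⟨w, rfl⟩, ?_⟩
    have hx : (F.obj ⋙ forget A).map (g ≫ f).op x =
        (F.obj ⋙ forget A).map h.op (φ.app (op Y) (G.map p₁.op s)) := by
      change F.obj.map (g ≫ f).op x = F.obj.map h.op (φ.app (op Y) (G.map p₁.op s))
      rw [op_comp, Functor.map_comp_apply, ← hs, ← Functor.map_comp_apply, ← op_comp, ← e₁,
        NatTrans.naturality_apply, op_comp, Functor.map_comp_apply]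
      rfl
    have hy : (F.obj ⋙ forget A).map (g ≫ f).op y =
        (F.obj ⋙ forget A).map h.op (φ.app (op Y) (G.map p₂.op t)) := by
      change F.obj.map (g ≫ f).op y = F.obj.map h.op (φ.app (op Y) (G.map p₂.op t))
      rw [op_comp, Functor.map_comp_apply, ← ht, ← e₂,
        NatTrans.naturality_apply, op_comp, Functor.map_comp_apply]
      rfl
    rw [hx, hy, eqLocus_map]
    exact (h1 Y _ _).preimage h.left.continuous
  · obtain ⟨V, f, ha, Y, h, s, e⟩ := h2 x a
    exact ⟨V, f, ha, Y, h, φ.app (op Y) s, e⟩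

/-- Here `ψ` is the counit of the Kan extension adjunction. It is injective on sections because the
equality locus of two sections over `Y` is clopen, hence an object of the finite étale site through
which any equalizing `U ⟶ Y` factors. -/
theorem W_of_clopen_of_finiteEtale {F : Sheaf X.smallEtaleTopology A}
    (ψ : (FEt.toEtale X).op.lan.obj ((FEt.toEtale X).op ⋙ F.obj) ⟶ F.obj)
    (hψ : ((FEt.toEtale X).op.lanAdjunction A).homEquiv _ F.obj ψ = 𝟙 _)
    (h1 : HasClopenEquality (F.obj ⋙ forget A)) (h2 : IsLocallyFiniteEtale (F.obj ⋙ forget A)) :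
    X.smallEtaleTopology.W ψ := by
  let G := (FEt.toEtale X).op ⋙ F.obj
  have hs (Y : FEt X) (s : ToType (G.obj (op Y))) :
      ψ.app (op ((FEt.toEtale X).obj Y)) (lanUnitApp G Y s) = s := by
    refine (app_lanUnitApp ψ _ hψ Y s).trans ?_
    simp
  have hsurj : Presheaf.IsLocallySurjective X.smallEtaleTopology ψ := ⟨fun {U} x ↦ by
    rw [mem_smallEtaleTopology_iff]
    intro a
    obtain ⟨V, f, ha, Y, h, s, e⟩ := h2 x a
    refine ⟨V, f, ⟨((FEt.toEtale X).op.lan.obj G).map h.op (lanUnitApp G Y s), ?_⟩, ha⟩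
    rw [NatTrans.naturality_apply]
    exact (congrArg _ (hs Y s)).trans e⟩
  have hinj : Presheaf.IsLocallyInjective X.smallEtaleTopology ψ := ⟨fun {U} x y e ↦ by
    obtain ⟨U⟩ := U
    obtain ⟨Y₁, h₁, s, rfl⟩ := lan_exists_rep G x
    obtain ⟨Y₂, h₂, t, rfl⟩ := lan_exists_rep G y
    obtain ⟨Y, p₁, p₂, h, rfl, rfl⟩ := exists_common_finiteEtale h₁ h₂
    simp only [op_comp, Functor.map_comp_apply] at e ⊢
    rw [lan_map_lanUnitApp, lan_map_lanUnitApp] at e ⊢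
    generalize G.map p₁.op s = s', G.map p₂.op t = t' at e ⊢
    rw [NatTrans.naturality_apply, NatTrans.naturality_apply, hs, hs] at e
    have e' := (map_eq_iff (P := F.obj ⋙ forget A) (isSeparated_forget F) h s' t').1 e
    obtain ⟨Y', p, hp, hl⟩ := exists_finiteEtale_of_isClosed _ (h1 (U := (FEt.toEtale X).obj Y) s' t')
    obtain ⟨h', rfl⟩ := hl U h e'
    have e'' : G.map p.op s' = G.map p.op t' :=
      (map_eq_iff (P := F.obj ⋙ forget A) (isSeparated_forget F) ((FEt.toEtale X).map p) s' t').2 hp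
    simp only [op_comp, Functor.map_comp_apply]
    rw [lan_map_lanUnitApp, lan_map_lanUnitApp, e'']
    convert! X.smallEtaleTopology.top_mem U
    ext V f
    simp [Presheaf.equalizerSieve]⟩
  exact X.smallEtaleTopology.W_of_isLocallyBijective ψ

omit [X.smallEtaleTopology.HasSheafCompose (forget A)] in
/-- An inverse image of a sheaf on the finite étale site has clopen equality, and its sections
are étale locally induced by sections over finite étale schemes. -/
theorem clopen_and_finiteEtale_of_iso [Finite (_root_.ConnectedComponents X)]
    {F : Sheaf X.smallEtaleTopology A} (G : Sheaf (FEt.topology X) A)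
    (e : F ≅ (rhoPullback X A).obj G) :
    HasClopenEquality (F.obj ⋙ forget A) ∧ IsLocallyFiniteEtale (F.obj ⋙ forget A) := by
  let adj := (FEt.toEtale X).sheafAdjunctionContinuous A (FEt.topology X) X.smallEtaleTopology
  let φ : G ⟶ (rhoPushforward X A).obj F := adj.homEquiv G F e.inv
  let ψ := (((FEt.toEtale X).op.lanAdjunction A).homEquiv G.obj F.obj).symm φ.hom
  refine clopen_and_finiteEtale_of_W ψ φ.hom (Equiv.apply_symm_apply _ _) ?_
  refine (isIso_homEquiv_symm_iff (FEt.toEtale X) (FEt.topology X) X.smallEtaleTopology φ ψ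
    (Equiv.apply_symm_apply _ _)).1 ?_
  change IsIso ((adj.homEquiv G F).symm (adj.homEquiv G F e.inv))
  rw [Equiv.symm_apply_apply]
  infer_instance

theorem nonempty_iso_rhoPullback_rhoPushforward {F : Sheaf X.smallEtaleTopology A}
    (h1 : HasClopenEquality (F.obj ⋙ forget A)) (h2 : IsLocallyFiniteEtale (F.obj ⋙ forget A)) :
    Nonempty (F ≅ (rhoPullback X A).obj ((rhoPushforward X A).obj F)) := by
  let adj := (FEt.toEtale X).sheafAdjunctionContinuous A (FEt.topology X) X.smallEtaleTopology
  let G := (rhoPushforward X A).obj F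
  let ψ := (((FEt.toEtale X).op.lanAdjunction A).homEquiv G.obj F.obj).symm (𝟙 _)
  have hψ : ((FEt.toEtale X).op.lanAdjunction A).homEquiv G.obj F.obj ψ = 𝟙 _ :=
    Equiv.apply_symm_apply _ _
  have : IsIso ((adj.homEquiv G F).symm (𝟙 G)) :=
    (isIso_homEquiv_symm_iff (FEt.toEtale X) (FEt.topology X) X.smallEtaleTopology (𝟙 G) ψ hψ).2
      (W_of_clopen_of_finiteEtale ψ hψ h1 h2)
  exact ⟨(asIso ((adj.homEquiv G F).symm (𝟙 G))).symm⟩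

end Characterization

/-! ### Representable sheaves, locally on the étale site -/

section Representability

instance : MorphismProperty.RespectsIso @Etale.{u} :=
  MorphismProperty.RespectsIso.mk _ (fun e f hf ↦ have : Etale f := hf; inferInstanceAs (Etale (e.hom ≫ f)))
    (fun e f hf ↦ have : Etale f := hf; inferInstanceAs (Etale (f ≫ e.hom)))
instance : MorphismProperty.IsStableUnderComposition @Etale.{u} := 
  (inferInstance : MorphismProperty.IsMultiplicative @Etale.{u}).toIsStableUnderComposition

variable {X : Scheme.{u}}

/-- The étale topology is coarser than the fpqc topology, which is subcanonical; the property
restricts along the fully faithful continuous functor to `X`-schemes. It allows morphisms to be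
glued like sections. -/
instance (X : Scheme.{u}) : X.smallEtaleTopology.Subcanonical := by
  have : (Scheme.grothendieckTopology @Etale).Subcanonical :=
    .of_le (Scheme.etaleTopology_le_proetaleTopology.trans Scheme.proetaleTopology_le_fpqcTopology)
  have : (Scheme.Etale.forget X).LocallyCoverDense (Scheme.overGrothendieckTopology @Etale X) :=
    Scheme.locallyCoverDense_of_le X le_rfl
  have : RepresentablyFlat (Scheme.Etale.forget X) := flat_of_preservesFiniteLimits _
  have : (Scheme.Etale.forget X).IsContinuous X.smallEtaleTopology (Scheme.overGrothendieckTopology @Etale X) := 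
    Functor.isContinuous_of_coverPreserving (compatiblePreservingOfFlat _ _) (Functor.coverPreserving_restrictedTopology (Scheme.Etale.forget X)  (Scheme.overGrothendieckTopology @Etale X))
  exact GrothendieckTopology.subcanonical_of_full_of_faithful (Scheme.Etale.forget X) _ (Scheme.overGrothendieckTopology @Etale X)

variable {P : X.Etaleᵒᵖ ⥤ Type u}

/-- The section `t` over `Y ⟶ V` represents the restriction of `P` to `V`. -/
def IsRep (P : X.Etaleᵒᵖ ⥤ Type u) {Y V : X.Etale} (p : Y ⟶ V) (t : P.obj (op Y)) : Prop :=
  ∀ ⦃W : X.Etale⦄ (w : W ⟶ V) (x : P.obj (op W)), ∃! h : W ⟶ Y, h ≫ p = w ∧ P.map h.op t = x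

theorem IsRep.of_isPullback {Y V Y' V' : X.Etale} {p : Y ⟶ V} {t : P.obj (op Y)} (ht : IsRep P p t)
    {f : V' ⟶ V} {f' : Y' ⟶ Y} {p' : Y' ⟶ V'} (h : IsPullback f' p' p f) :
    IsRep P p' (P.map f'.op t) := by
  intro W w x
  obtain ⟨k, ⟨hk, hk'⟩, hu⟩ := ht (w ≫ f) x
  refine ⟨h.lift k w hk, ⟨h.lift_snd _ _ _, ?_⟩, ?_⟩
  · rw [← Functor.map_comp_apply, ← op_comp, h.lift_fst, hk']
  · rintro l ⟨hl, hl'⟩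
    refine h.hom_ext ?_ (by rw [hl, h.lift_snd])
    rw [h.lift_fst]
    refine hu _ ⟨?_, ?_⟩
    · rw [Category.assoc, h.w, reassoc_of% hl]
    · rw [op_comp, Functor.map_comp_apply, hl']

/-- If sections of a separated presheaf agree étale locally, they are equal. -/
theorem eq_of_locally (hP : Presieve.IsSeparated X.smallEtaleTopology P) {U : X.Etale}
    {x y : P.obj (op U)}
    (h : ∀ a : U.left, ∃ (V : X.Etale) (f : V ⟶ U), a ∈ Set.range f.left ∧
      P.map f.op x = P.map f.op y) : x = y :=
  eq_of_eqLocus hP h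

theorem hom_eq_of_locally {U Y : X.Etale} {h k : U ⟶ Y}
    (H : ∀ a : U.left, ∃ (V : X.Etale) (f : V ⟶ U), a ∈ Set.range f.left ∧
      f ≫ h = f ≫ k) : h = k :=
  eq_of_locally (P := yoneda.obj Y)
    (GrothendieckTopology.Subcanonical.isSheaf_of_isRepresentable _).isSeparated H

/-- Étale local sections of a sheaf that are compatible glue. -/
theorem exists_glue (hP : Presieve.IsSheaf X.smallEtaleTopology P) {U : X.Etale} {ι : Type*}
    {V : ι → X.Etale} (f : ∀ i, V i ⟶ U) (hf : ∀ a : U.left, ∃ i, a ∈ Set.range (f i).left)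
    (x : ∀ i, P.obj (op (V i)))
    (hx : ∀ i j (W : X.Etale) (g : W ⟶ V i) (g' : W ⟶ V j), g ≫ f i = g' ≫ f j →
      P.map g.op (x i) = P.map g'.op (x j)) :
    ∃ y : P.obj (op U), ∀ i, P.map (f i).op y = x i := by
  have h := (hP (Sieve.ofArrows V f) ((mem_smallEtaleTopology_iff _).2 fun a ↦ by
    obtain ⟨i, hi⟩ := hf a
    exact ⟨V i, f i, Sieve.ofArrows_mk _ _ i, hi⟩))
  rw [Sieve.ofArrows, ← Presieve.isSheafFor_iff_generate] at h
  obtain ⟨y, hy, -⟩ := (Presieve.isSheafFor_arrows_iff _ _).1 h x (fun i j W g g' e ↦ hx i j W g g' e)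
  exact ⟨y, hy⟩

/-- Both `P` and morphisms into `Y` are sheaves, so a locally bijective comparison between them is
bijective. -/
theorem IsRep.of_locally (hP : Presieve.IsSheaf X.smallEtaleTopology P) {Y V : X.Etale} {p : Y ⟶ V}
    {t : P.obj (op Y)}
    (hinj : ∀ ⦃W : X.Etale⦄ (h k : W ⟶ Y), h ≫ p = k ≫ p → P.map h.op t = P.map k.op t →
      ∀ a : W.left, ∃ (W' : X.Etale) (f : W' ⟶ W), a ∈ Set.range f.left ∧ f ≫ h = f ≫ k)
    (hsurj : ∀ ⦃W : X.Etale⦄ (w : W ⟶ V) (x : P.obj (op W)) (a : W.left),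
      ∃ (W' : X.Etale) (f : W' ⟶ W), a ∈ Set.range f.left ∧
        ∃ h : W' ⟶ Y, h ≫ p = f ≫ w ∧ P.map h.op t = P.map f.op x) : IsRep P p t := by
  have hinj' {W : X.Etale} {h k : W ⟶ Y} (e : h ≫ p = k ≫ p) (e' : P.map h.op t = P.map k.op t) :
      h = k := hom_eq_of_locally (hinj h k e e')
  intro W w x
  choose W' f hf h hh hx using hsurj w x
  obtain ⟨k, hk⟩ := exists_glue (P := yoneda.obj Y)
    (GrothendieckTopology.Subcanonical.isSheaf_of_isRepresentable _) f (fun a ↦ ⟨a, hf a⟩) h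
    (fun i j Z g g' e ↦ by
      refine hinj' ?_ ?_
      · change (g ≫ h i) ≫ p = (g' ≫ h j) ≫ p
        rw [Category.assoc, Category.assoc, hh, hh, reassoc_of% e]
      · change P.map (g ≫ h i).op t = P.map (g' ≫ h j).op t
        rw [op_comp, op_comp, Functor.map_comp_apply, Functor.map_comp_apply, hx, hx,
          ← Functor.map_comp_apply, ← Functor.map_comp_apply, ← op_comp, ← op_comp, e])
  replace hk (i) : f i ≫ k = h i := hk i
  refine ⟨k, ⟨hom_eq_of_locally fun a ↦ ⟨_, f a, hf a, by rw [reassoc_of% hk, hh]⟩,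
    eq_of_locally hP.isSeparated fun a ↦ ⟨_, f a, hf a, ?_⟩⟩, ?_⟩
  · rw [← Functor.map_comp_apply, ← op_comp, hk, hx]
  · rintro l ⟨hl, hl'⟩
    refine hom_eq_of_locally fun a ↦ ⟨_, f a, hf a, hinj' ?_ ?_⟩
    · rw [hk, hh, Category.assoc, hl]
    · rw [hk, hx, op_comp, Functor.map_comp_apply, hl']

theorem IsRep.hom_ext {Y V : X.Etale} {p : Y ⟶ V} {t : P.obj (op Y)} (ht : IsRep P p t)
    {W : X.Etale} {h k : W ⟶ Y} (e : h ≫ p = k ≫ p) (e' : P.map h.op t = P.map k.op t) : h = k :=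
  (ht (h ≫ p) (P.map h.op t)).unique ⟨rfl, rfl⟩ ⟨e.symm, e'.symm⟩

end Representability

/-! ### Descent of algebras -/

section AlgebraDescent

open TensorProduct

variable {R S B : Type u} [CommRing R] [CommRing S] [CommRing B] [Algebra R S] [Algebra R B]
  [Algebra S B] [IsScalarTower R S B]

/-- A descent datum on a faithfully flat algebra is effective: the algebra of invariants of a
coaction `ρ` is a descent of `B`. -/
theorem isPushout_equalizer [Module.Flat R S] (ρ : B →ₐ[R] S ⊗[R] B)
    (hρ : ∀ s : S, ρ (algebraMap S B s) = s ⊗ₜ 1)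
    (hμ : ∀ b, Algebra.TensorProduct.lift (Algebra.ofId S B) (AlgHom.id R B)
      (fun _ _ ↦ Commute.all _ _) (ρ b) = b)
    (hco : ∀ b, Algebra.TensorProduct.map (AlgHom.id S S) ρ (ρ b) =
      Algebra.TensorProduct.map (AlgHom.id S S) Algebra.TensorProduct.includeRight (ρ b)) :
    Algebra.IsPushout R S (AlgHom.equalizer ρ Algebra.TensorProduct.includeRight) B := by
  let A := AlgHom.equalizer ρ Algebra.TensorProduct.includeRight
  let f : S ⊗[R] A →ₐ[S] B := Algebra.TensorProduct.lift (Algebra.ofId S B) A.val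
    (fun _ _ ↦ Commute.all _ _)
  have hf (x : S ⊗[R] A) : ρ (f x) = Algebra.TensorProduct.map (AlgHom.id S S) A.val x := by
    induction x with
    | zero => simp
    | add x y hx hy => simp [hx, hy]
    | tmul s a =>
      have ha : ρ a = 1 ⊗ₜ[R] (a : B) := a.2
      simp [f, Algebra.ofId_apply, hρ, ha]
  have hf' (x : S ⊗[R] A) : f x = Algebra.TensorProduct.lift (Algebra.ofId S B) (AlgHom.id R B)
      (fun _ _ ↦ Commute.all _ _) (Algebra.TensorProduct.map (AlgHom.id S S) A.val x) := by
    induction x with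
    | zero => simp
    | add x y hx hy => simp only [map_add, hx, hy]
    | tmul s a => simp [f]
  -- By flatness, `S ⊗ A` is the equalizer of `S ⊗ ρ` and `S ⊗ includeRight` inside `S ⊗ B`. By
  -- `hf`, composing `f` with `ρ` gives the inclusion of that equalizer, so `f` is injective. By
  -- `hco` each `ρ b` lies in it, and multiplication, which retracts `ρ`, shows that `f` hits `b`.
  have bij : Function.Bijective f := by
    constructor
    · intro x y hxy
      apply (AlgHom.tensorEqualizerEquiv S S ρ Algebra.TensorProduct.includeRight).injective
      apply Subtype.ext
      rw [AlgHom.tensorEqualizerEquiv_apply, AlgHom.tensorEqualizerEquiv_apply,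
        AlgHom.coe_tensorEqualizer, AlgHom.coe_tensorEqualizer]
      exact (hf x).symm.trans ((congrArg ρ hxy).trans (hf y))
    · intro b
      obtain ⟨x, hx⟩ := (AlgHom.tensorEqualizerEquiv S S ρ
        Algebra.TensorProduct.includeRight).surjective ⟨ρ b, hco b⟩
      rw [AlgHom.tensorEqualizerEquiv_apply] at hx
      have hx' := congrArg Subtype.val hx
      rw [AlgHom.coe_tensorEqualizer] at hx'
      refine ⟨x, ?_⟩
      rw [hf', hx', hμ]
  refine ⟨IsBaseChange.of_equiv (AlgEquiv.ofBijective f bij).toLinearEquiv fun a ↦ ?_⟩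
  simp [f]

end AlgebraDescent

/-! ### Affine objects of the étale site -/

section AffineObjects

variable {X : Scheme.{u}} {R : Type u} [CommRing R] (v : Spec (.of R) ⟶ X) [Etale v]

instance (D : Type u) [CommRing D] [Algebra R D] [Algebra.Etale R D] :
    Etale (Spec.map (CommRingCat.ofHom (algebraMap R D))) :=
  (HasRingHomProperty.Spec_iff (P := @Etale.{u})).2 (by
    simpa [RingHom.etale_algebraMap] using ‹Algebra.Etale R D›)

/-- The étale `X`-scheme given by an étale algebra over the ring of an affine étale `X`-scheme. -/
def specObj (D : Type u) [CommRing D] [Algebra R D] [Algebra.Etale R D] : X.Etale :=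
  .mk (Spec.map (CommRingCat.ofHom (algebraMap R D)) ≫ v)

/-- The morphism induced by a morphism of algebras. -/
def specMap {D E : Type u} [CommRing D] [Algebra R D] [Algebra.Etale R D] [CommRing E]
    [Algebra R E] [Algebra.Etale R E] (φ : D →ₐ[R] E) : specObj v E ⟶ specObj v D :=
  MorphismProperty.Over.homMk (Spec.map (CommRingCat.ofHom (φ : D →+* E))) (by
    change Spec.map _ ≫ Spec.map _ ≫ v = Spec.map _ ≫ v
    rw [← Category.assoc, ← Spec.map_comp, ← CommRingCat.ofHom_comp, φ.comp_algebraMap]) trivial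

/-- The structure morphism. -/
def specHom (D : Type u) [CommRing D] [Algebra R D] [Algebra.Etale R D] : specObj v D ⟶ .mk v :=
  MorphismProperty.Over.homMk (Spec.map (CommRingCat.ofHom (algebraMap R D))) rfl trivial

variable {D E G : Type u} [CommRing D] [Algebra R D] [Algebra.Etale R D] [CommRing E]
    [Algebra R E] [Algebra.Etale R E] [CommRing G]
    [Algebra R G] [Algebra.Etale R G]

@[simp]
theorem specMap_specHom (φ : D →ₐ[R] E) : specMap v φ ≫ specHom v D = specHom v E := by
  apply MorphismProperty.Over.Hom.ext
  change Spec.map _ ≫ Spec.map _ = Spec.map _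
  rw [← Spec.map_comp, ← CommRingCat.ofHom_comp, φ.comp_algebraMap]

@[simp]
theorem specMap_specHom_assoc (φ : D →ₐ[R] E) {Z : X.Etale} (h : .mk v ⟶ Z) :
    specMap v φ ≫ specHom v D ≫ h = specHom v E ≫ h := by
  rw [← Category.assoc, specMap_specHom]

theorem specMap_comp (φ : D →ₐ[R] E) (ψ : E →ₐ[R] G) :
    specMap v (ψ.comp φ) = specMap v ψ ≫ specMap v φ := by
  apply MorphismProperty.Over.Hom.ext
  change Spec.map _ = Spec.map _ ≫ Spec.map _
  rw [← Spec.map_comp, ← CommRingCat.ofHom_comp]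
  rfl

theorem specMap_id : specMap v (AlgHom.id R D) = 𝟙 _ := by
  apply MorphismProperty.Over.Hom.ext
  exact Spec.map_id _

theorem specMap_injective {φ ψ : D →ₐ[R] E} (h : specMap v φ = specMap v ψ) : φ = ψ := by
  have h' : Spec.map (CommRingCat.ofHom (φ : D →+* E)) = Spec.map (CommRingCat.ofHom (ψ : D →+* E)) :=
    congr($(h).left)
  have := congr($(Spec.map_injective h').hom)
  ext d
  exact congr($this d)

theorem exists_specMap_eq (h : specObj v E ⟶ specObj v D) (hh : h ≫ specHom v D = specHom v E) :
    ∃ φ : D →ₐ[R] E, specMap v φ = h := by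
  let k : Spec (.of E) ⟶ Spec (.of D) := h.left
  obtain ⟨φ, hφ⟩ := Spec.map_surjective k
  have hk : k ≫ Spec.map (CommRingCat.ofHom (algebraMap R D)) =
    Spec.map (CommRingCat.ofHom (algebraMap R E)) := congr($(hh).left)
  rw [← hφ, ← Spec.map_comp] at hk
  have hk' := congr($(Spec.map_injective hk).hom)
  refine ⟨{ toRingHom := φ.hom, commutes' := fun r ↦ congr($hk' r) }, ?_⟩
  apply MorphismProperty.Over.Hom.ext
  exact hφ

theorem isPullback_of_isPullback_left {U V W Z : X.Etale} {a : U ⟶ V} {b : U ⟶ W} {c : V ⟶ Z}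
    {d : W ⟶ Z} (h : IsPullback a.left b.left c.left d.left) : IsPullback a b c d := by
  have w : a ≫ c = b ≫ d := MorphismProperty.Over.Hom.ext h.w
  have h' : IsPullback ((Scheme.Etale.forget X ⋙ Over.forget X).map a)
    ((Scheme.Etale.forget X ⋙ Over.forget X).map b) ((Scheme.Etale.forget X ⋙ Over.forget X).map c)
    ((Scheme.Etale.forget X ⋙ Over.forget X).map d) := h
  exact h'.of_map (Scheme.Etale.forget X ⋙ Over.forget X) w

theorem isPullback_specMap [Algebra D E] [IsScalarTower R D E] [Algebra G E] [IsScalarTower R G E]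
    [Algebra.IsPushout R D G E] :
    IsPullback (specMap v (IsScalarTower.toAlgHom R D E)) (specMap v (IsScalarTower.toAlgHom R G E))
      (specHom v D) (specHom v G) :=
  isPullback_of_isPullback_left
    (isPullback_SpecMap_of_isPushout _ _ _ _ (CommRingCat.isPushout_of_isPushout R D G E))

open TensorProduct in
theorem isPullback_specMap_tensorProduct (D G : Type u) [CommRing D] [Algebra R D]
    [Algebra.Etale R D] [CommRing G] [Algebra R G] [Algebra.Etale R G]
    [Algebra.Etale R (D ⊗[R] G)] :
    IsPullback (specMap v (Algebra.TensorProduct.includeLeft : D →ₐ[R] D ⊗[R] G))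
      (specMap v (Algebra.TensorProduct.includeRight : G →ₐ[R] D ⊗[R] G))
      (specHom v D) (specHom v G) :=
  isPullback_of_isPullback_left
    (isPullback_SpecMap_of_isPushout _ _ _ _ (CommRingCat.isPushout_tensorProduct R D G))

end AffineObjects

/-! ### Étale descent of representing algebras -/

section Descent

variable {X : Scheme.{u}} {P : X.Etaleᵒᵖ ⥤ Type u}

theorem exists_preimage_of_isPullback {U V W Z : X.Etale} {a : U ⟶ V} {b : U ⟶ W} {c : V ⟶ Z}
    {d : W ⟶ Z} (h : IsPullback a b c d) (v : V.left) (w : W.left) (e : c.left v = d.left w) :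
    ∃ z, a.left z = v ∧ b.left z = w :=
  Scheme.exists_preimage_of_isPullback (h.map (Scheme.Etale.forget X ⋙ Over.forget X)) v w e

/-- Being represented is étale local on the base. -/
theorem IsRep.of_isPullback_locally (hP : Presieve.IsSheaf X.smallEtaleTopology P)
    {Y V : X.Etale} {p : Y ⟶ V} {t : P.obj (op Y)}
    (H : ∀ b : V.left, ∃ (V' Y' : X.Etale) (f : V' ⟶ V) (f' : Y' ⟶ Y) (p' : Y' ⟶ V'),
      b ∈ Set.range f.left ∧ IsPullback f' p' p f ∧ IsRep P p' (P.map f'.op t)) : IsRep P p t := by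
  refine IsRep.of_locally hP (fun W h₁ h₂ e e' a ↦ ?_) fun W w x a ↦ ?_
  · obtain ⟨V', Y', f, f', p', ⟨b, hb⟩, h, ht⟩ := H ((h₁ ≫ p).left a)
    obtain ⟨z, hz, -⟩ := exists_pullback_point (h₁ ≫ p) f a b hb.symm
    let q := pullback.fst (h₁ ≫ p) f
    refine ⟨_, q, ⟨z, hz⟩, ?_⟩
    have c₁ : (q ≫ h₁) ≫ p = pullback.snd (h₁ ≫ p) f ≫ f := by
      rw [Category.assoc, pullback.condition]
    have c₂ : (q ≫ h₂) ≫ p = pullback.snd (h₁ ≫ p) f ≫ f := by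
      rw [Category.assoc, ← e, pullback.condition]
    have : h.lift _ _ c₁ = h.lift _ _ c₂ := by
      refine ht.hom_ext (by rw [h.lift_snd, h.lift_snd]) ?_
      rw [← Functor.map_comp_apply, ← Functor.map_comp_apply, ← op_comp, ← op_comp, h.lift_fst,
        h.lift_fst, op_comp, op_comp, Functor.map_comp_apply, Functor.map_comp_apply, e']
    rw [← h.lift_fst _ _ c₁, this, h.lift_fst]
  · obtain ⟨V', Y', f, f', p', ⟨b, hb⟩, h, ht⟩ := H (w.left a)
    obtain ⟨z, hz, -⟩ := exists_pullback_point w f a b hb.symm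
    obtain ⟨k, ⟨hk, hk'⟩, -⟩ := ht (pullback.snd w f) (P.map (pullback.fst w f).op x)
    refine ⟨_, pullback.fst w f, ⟨z, hz⟩, k ≫ f', ?_, ?_⟩
    · rw [Category.assoc, h.w, reassoc_of% hk, pullback.condition]
    · rw [op_comp, Functor.map_comp_apply, hk']

section

open TensorProduct

variable {R : Type u} [CommRing R] (v : Spec (.of R) ⟶ X) [Etale v]
  {S B : Type u} [CommRing S] [CommRing B] [Algebra R S] [Algebra R B]
  [Algebra S B] [IsScalarTower R S B] [Algebra.Etale R S] [Algebra.Etale R B]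
  [Algebra.Etale R (S ⊗[R] B)]

/-- An algebra representing a presheaf carries a canonical descent datum. -/
theorem IsRep.exists_coaction 
    {t : P.obj (op (specObj v B))} (ht : IsRep P (specMap v (IsScalarTower.toAlgHom R S B)) t) :
    ∃ ρ : B →ₐ[R] S ⊗[R] B, (∀ s : S, ρ (algebraMap S B s) = s ⊗ₜ 1) ∧
      (∀ b, Algebra.TensorProduct.lift (Algebra.ofId S B) (AlgHom.id R B)
        (fun _ _ ↦ Commute.all _ _) (ρ b) = b) ∧
      (∀ b, Algebra.TensorProduct.map (AlgHom.id S S) ρ (ρ b) =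
        Algebra.TensorProduct.map (AlgHom.id S S) Algebra.TensorProduct.includeRight (ρ b)) ∧
      P.map (specMap v ρ).op t =
        P.map (specMap v (Algebra.TensorProduct.includeRight : B →ₐ[R] S ⊗[R] B)).op t := by
  have : Algebra.Etale R (S ⊗[R] (S ⊗[R] B)) := Algebra.Etale.comp R S _
  let ir : B →ₐ[R] S ⊗[R] B := Algebra.TensorProduct.includeRight
  let il : S →ₐ[R] S ⊗[R] B := Algebra.TensorProduct.includeLeft
  let ir' : S ⊗[R] B →ₐ[R] S ⊗[R] (S ⊗[R] B) := Algebra.TensorProduct.includeRight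
  let sB := IsScalarTower.toAlgHom R S B
  -- The coaction is the classifying map of the section `ir^* t`, viewed over the left factor `S`.
  -- The identities `hμ` and `hco` then follow from uniqueness of classifying maps: two algebra maps
  -- out of `B` agree once they agree on `S` and on `t`.
  obtain ⟨k, ⟨hk, hk'⟩, -⟩ := ht (specMap v il) (P.map (specMap v ir).op t)
  obtain ⟨ρ, rfl⟩ := exists_specMap_eq v k (by
    rw [← specMap_specHom v sB, reassoc_of% hk, specMap_specHom])
  have hρ : ρ.comp sB = il := specMap_injective v (by rw [specMap_comp, hk])
  have ext {D : Type u} [CommRing D] [Algebra R D] [Algebra.Etale R D] {φ ψ : B →ₐ[R] D}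
      (h₁ : φ.comp sB = ψ.comp sB)
      (h₂ : P.map (specMap v φ).op t = P.map (specMap v ψ).op t) : φ = ψ := by
    apply specMap_injective v
    refine ht.hom_ext ?_ h₂
    rw [← specMap_comp, ← specMap_comp, h₁]
  have htmap {D : Type u} [CommRing D] [Algebra R D] [Algebra.Etale R D] (φ : S ⊗[R] B →ₐ[R] D) :
      P.map (specMap v (φ.comp ρ)).op t = P.map (specMap v (φ.comp ir)).op t := by
    rw [specMap_comp, specMap_comp, op_comp, op_comp, Functor.map_comp_apply,
      Functor.map_comp_apply, hk']
  let μ : S ⊗[R] B →ₐ[S] B := Algebra.TensorProduct.lift (Algebra.ofId S B) (AlgHom.id R B)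
      (fun _ _ ↦ Commute.all _ _)
  have hμ : (μ.restrictScalars R).comp ρ = AlgHom.id R B := by
    refine ext ?_ ?_
    · rw [AlgHom.comp_assoc, hρ]
      ext s
      simp [μ, il, sB, Algebra.ofId_apply]
    · have e : (μ.restrictScalars R).comp ir = AlgHom.id R B := by
        ext b; simp [μ, ir]
      rw [htmap, e]
  let m₁ : S ⊗[R] B →ₐ[S] S ⊗[R] (S ⊗[R] B) := Algebra.TensorProduct.map (AlgHom.id S S) ρ
  let m₂ : S ⊗[R] B →ₐ[S] S ⊗[R] (S ⊗[R] B) := Algebra.TensorProduct.map (AlgHom.id S S) ir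
  have hco : (m₁.restrictScalars R).comp ρ = (m₂.restrictScalars R).comp ρ := by
    refine ext ?_ ?_
    · rw [AlgHom.comp_assoc, AlgHom.comp_assoc, hρ]
      ext s
      simp [m₁, m₂, il]
    · rw [htmap, htmap]
      have e₁ : (m₁.restrictScalars R).comp ir = ir'.comp ρ := by
        ext b; simp [m₁, ir, ir']
      have e₂ : (m₂.restrictScalars R).comp ir = ir'.comp ir := by
        ext b; simp [m₂, ir, ir']
      rw [e₁, e₂, specMap_comp, specMap_comp, op_comp, op_comp, Functor.map_comp_apply,
        Functor.map_comp_apply, hk']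
  exact ⟨ρ, fun s ↦ congr($hρ s), fun b ↦ congr($hμ b), fun b ↦ congr($hco b), hk'⟩

theorem specHom_surjective [Module.FaithfullyFlat R S] :
    Function.Surjective (specHom v S).left :=
  PrimeSpectrum.comap_surjective_of_faithfullyFlat

/-- As `B = S ⊗ A`, the scheme `Spec (S ⊗ B)` is the self-product of `Spec B` over `Spec A`, with
projections induced by `ρ` and `includeRight`. So `hρt` is exactly the gluing condition for `t`
along the cover `Spec B ⟶ Spec A`. -/
theorem exists_section_of_coaction (hP : Presieve.IsSheaf X.smallEtaleTopology P)
    [Module.FaithfullyFlat R S] {t : P.obj (op (specObj v B))} (ρ : B →ₐ[R] S ⊗[R] B)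
    (hρ : ∀ s : S, ρ (algebraMap S B s) = s ⊗ₜ 1)
    (hρt : P.map (specMap v ρ).op t =
        P.map (specMap v (Algebra.TensorProduct.includeRight : B →ₐ[R] S ⊗[R] B)).op t)
    {A : Type u} [CommRing A] [Algebra R A] [Algebra A B] [IsScalarTower R A B]
    [Algebra.Etale R A] [Algebra.IsPushout R S A B]
    (hA : ∀ a : A, ρ (algebraMap A B a) = 1 ⊗ₜ algebraMap A B a) :
    ∃ t' : P.obj (op (specObj v A)), P.map (specMap v (IsScalarTower.toAlgHom R A B)).op t' = t := by
  let ir : B →ₐ[R] S ⊗[R] B := Algebra.TensorProduct.includeRight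
  let il : S →ₐ[R] S ⊗[R] B := Algebra.TensorProduct.includeLeft
  let sB := IsScalarTower.toAlgHom R S B
  let aB := IsScalarTower.toAlgHom R A B
  have hk : specMap v ρ ≫ specMap v sB = specMap v il := by
    rw [← specMap_comp]
    exact congrArg (specMap v) (AlgHom.ext hρ)
  have hk₂ : specMap v ρ ≫ specMap v aB = specMap v ir ≫ specMap v aB := by
    rw [← specMap_comp, ← specMap_comp]
    exact congrArg (specMap v) (AlgHom.ext hA)
  have hpb : IsPullback (specMap v sB) (specMap v aB) (specHom v S) (specHom v A) :=
    isPullback_specMap (R := R) v (D := S) (E := B) (G := A)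
  have hpb' : IsPullback (specMap v il) (specMap v ir) (specHom v S) (specHom v B) :=
    isPullback_specMap_tensorProduct v S B
  have hq : Function.Surjective (specMap v aB).left := fun a ↦ by
    obtain ⟨s, hs⟩ := specHom_surjective (S := S) v ((specHom v A).left a)
    obtain ⟨z, -, hz⟩ := exists_preimage_of_isPullback hpb s a hs
    exact ⟨z, hz⟩
  obtain ⟨tA, htA⟩ := exists_glue hP (ι := Unit) (fun _ ↦ specMap v aB) (fun a ↦ ⟨(), hq a⟩)
    (fun _ ↦ t) (fun _ _ W g g' e ↦ by
      have h₁ : (g ≫ specMap v sB) ≫ specHom v S = g' ≫ specHom v B := by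
        rw [Category.assoc, specMap_specHom, ← specMap_specHom v aB, reassoc_of% e]
      obtain ⟨l, hl₁, hl₂⟩ : ∃ l, l ≫ specMap v il = g ≫ specMap v sB ∧ l ≫ specMap v ir = g' :=
        ⟨hpb'.lift _ _ h₁, hpb'.lift_fst _ _ _, hpb'.lift_snd _ _ _⟩
      have hl : l ≫ specMap v ρ = g := by
        refine hpb.hom_ext ?_ ?_
        · rw [Category.assoc, hk, hl₁]
        · rw [Category.assoc, hk₂, reassoc_of% hl₂, e]
      rw [← hl, ← hl₂, op_comp, op_comp, Functor.map_comp_apply, Functor.map_comp_apply, hρt])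
  exact ⟨tA, htA ()⟩

end

open TensorProduct in
/-- Étale descent of representability by finite étale algebras. -/
theorem IsRep.exists_descent (hP : Presieve.IsSheaf X.smallEtaleTopology P)
    {R : Type u} [CommRing R] (v : Spec (.of R) ⟶ X) [Etale v]
    {S B : Type u} [CommRing S] [CommRing B] [Algebra R S] [Algebra R B]
    [Algebra S B] [IsScalarTower R S B] [Algebra.Etale R S] [Algebra.Etale R B]
    [Module.FaithfullyFlat R S] [Algebra.Etale S B] [Module.Finite S B]
    {t : P.obj (op (specObj v B))} (ht : IsRep P (specMap v (IsScalarTower.toAlgHom R S B)) t) :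
    ∃ (A : Type u) (_ : CommRing A) (_ : Algebra R A) (_ : Algebra.Etale R A)
      (t : P.obj (op (specObj v A))), Module.Finite R A ∧ IsRep P (specHom v A) t := by
  have : Algebra.Etale R (S ⊗[R] B) := Algebra.Etale.comp R S _
  obtain ⟨ρ, h₁, h₂, h₃, h₄⟩ := ht.exists_coaction
  let A := AlgHom.equalizer ρ Algebra.TensorProduct.includeRight
  have hpush : Algebra.IsPushout R S A B := isPushout_equalizer ρ h₁ h₂ h₃
  let eA : S ⊗[R] A ≃ₐ[S] B := Algebra.IsPushout.equiv R S A B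
  have : Module.Finite S (S ⊗[R] A) := Module.Finite.equiv eA.symm.toLinearEquiv
  -- Finiteness and étaleness hold for `S ⊗ A ≃ B` over `S` and descend along the faithfully flat `R
  -- → S`.
  have : Module.Finite R A := Module.Finite.of_finite_tensorProduct_of_faithfullyFlat S
  have : Algebra.Etale S (S ⊗[R] A) := Algebra.Etale.of_equiv eA.symm
  have : Algebra.Etale R A := Algebra.Etale.of_etale_tensorProduct_of_faithfullyFlat S
  obtain ⟨t', rfl⟩ := exists_section_of_coaction v hP ρ h₁ h₄ (A := A) (fun a ↦ a.2)
  exact ⟨A, inferInstance, inferInstance, inferInstance, t', inferInstance,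
    IsRep.of_isPullback_locally hP fun b ↦ ⟨_, _, _, _, _, specHom_surjective (S := S) v b,
      (isPullback_specMap (R := R) v (D := S) (E := B) (G := A)).flip, ht⟩⟩

end Descent

/-! ### Trivializations by finite families of sections -/

section Trivialization

variable {X : Scheme.{u}} {P : X.Etaleᵒᵖ ⥤ Type u}

/-- A family of sections of `P` over `V` is a trivialization if each section of `P` is étale locally
equal to a member of the family, and distinct members agree nowhere. -/
structure IsTrivialization {V : X.Etale} {E : Type u} (y : E → P.obj (op V)) : Prop where
  exists_eq : ∀ ⦃W : X.Etale⦄ (w : W ⟶ V) (x : P.obj (op W)) (a : W.left),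
    ∃ (W' : X.Etale) (f : W' ⟶ W), a ∈ Set.range f.left ∧
      ∃ e, P.map (f ≫ w).op (y e) = P.map f.op x
  eq_of_eq : ∀ ⦃W : X.Etale⦄ (w : W ⟶ V), Nonempty W.left → ∀ e e',
    P.map w.op (y e) = P.map w.op (y e') → e = e'

theorem IsTrivialization.map {V V' : X.Etale} {E : Type u} {y : E → P.obj (op V)}
    (hy : IsTrivialization y) (f : V' ⟶ V) : IsTrivialization fun e ↦ P.map f.op (y e) where
  exists_eq W w x a := by
    obtain ⟨W', g, hg, e, he⟩ := hy.exists_eq (w ≫ f) x a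
    refine ⟨W', g, hg, e, ?_⟩
    rw [← Functor.map_comp_apply, ← op_comp, Category.assoc, he]
  eq_of_eq W w hW e e' h := by
    rw [← Functor.map_comp_apply, ← Functor.map_comp_apply, ← op_comp] at h
    exact hy.eq_of_eq _ hW e e' h

/-- `P` is étale locally on `X` a constant sheaf with finite values. -/
def IsLocallyTrivial (P : X.Etaleᵒᵖ ⥤ Type u) : Prop :=
  ∀ a : X, ∃ (V : X.Etale) (_ : a ∈ Set.range V.hom) (E : Type u) (_ : Finite E)
    (y : E → P.obj (op V)), IsTrivialization y

/-- `Spec (E → S)` is a disjoint union of copies of `Spec S` indexed by `E`; the universal section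
`t` is `y e` on the copy `e`. -/
theorem IsTrivialization.exists_isRep (hP : Presieve.IsSheaf X.smallEtaleTopology P)
    {R : Type u} [CommRing R] (v : Spec (.of R) ⟶ X) [Etale v]
    {S : Type u} [CommRing S] [Algebra R S] [Algebra.Etale R S]
    {E : Type u} [Finite E] {y : E → P.obj (op (specObj v S))} (hy : IsTrivialization y) :
    ∃ t : P.obj (op (specObj v (E → S))),
      IsRep P (specMap v (IsScalarTower.toAlgHom R S (E → S))) t := by
  classical
  let p := specMap v (IsScalarTower.toAlgHom R S (E → S))
  let i (e : E) := specMap v (Pi.evalAlgHom R (fun _ : E ↦ S) e)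
  have hip (e : E) : i e ≫ p = 𝟙 _ := by
    rw [← specMap_comp, ← specMap_id]
    rfl
  have hcov (z : (specObj v (E → S)).left) : ∃ e, z ∈ Set.range (i e).left := by
    obtain ⟨e, q, hq⟩ := PrimeSpectrum.exists_comap_evalRingHom_eq z
    exact ⟨e, q, hq⟩
  have hdisj {e e' : E} (a b : (specObj v S).left) (h : (i e).left a = (i e').left b) : e = e' := by
    by_contra hne
    have h' : PrimeSpectrum.comap (Pi.evalRingHom (fun _ : E ↦ S) e) a =
      PrimeSpectrum.comap (Pi.evalRingHom (fun _ : E ↦ S) e') b := h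
    -- The idempotent of the copy `e` vanishes on the copy `e'` and is `1` on its own, so distinct
    -- copies are disjoint.
    have h₁ : (Pi.single e 1 : E → S) ∈ (PrimeSpectrum.comap
        (Pi.evalRingHom (fun _ : E ↦ S) e') b).asIdeal := by
      change (Pi.single e 1 : E → S) e' ∈ b.asIdeal
      rw [Pi.single_eq_of_ne (Ne.symm hne)]
      exact zero_mem _
    rw [← h'] at h₁
    have h₂ : (Pi.single e 1 : E → S) e ∈ a.asIdeal := h₁
    rw [Pi.single_eq_same] at h₂
    exact (Ideal.ne_top_iff_one _).1 a.2.ne_top h₂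
  have hloc {W : X.Etale} (h : W ⟶ specObj v (E → S)) (a : W.left) : ∃ (W' : X.Etale) (q : W' ⟶ W),
      a ∈ Set.range q.left ∧ ∃ e, q ≫ h = (q ≫ h ≫ p) ≫ i e := by
    obtain ⟨e, b, hb⟩ := hcov (h.left a)
    obtain ⟨z, hz, -⟩ := exists_pullback_point h (i e) a b hb.symm
    refine ⟨_, pullback.fst h (i e), ⟨z, hz⟩, e, ?_⟩
    rw [pullback.condition_assoc, hip, Category.comp_id, pullback.condition]
  obtain ⟨t, ht⟩ := exists_glue hP i hcov y (fun e e' W g g' h ↦ by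
    refine eq_of_locally hP.isSeparated fun a ↦ ?_
    obtain rfl : e = e' := hdisj (g.left a) (g'.left a) congr($(h).left a)
    have : g = g' := by
      rw [← Category.comp_id g, ← hip e, reassoc_of% h, hip, Category.comp_id]
    exact ⟨W, 𝟙 _, ⟨a, rfl⟩, by rw [this]⟩)
  refine ⟨t, IsRep.of_locally hP (fun W h k hp ht' a ↦ ?_) (fun W w x a ↦ ?_)⟩
  · obtain ⟨Z, q, ⟨z, hz⟩, e, hq⟩ := hloc h a
    obtain ⟨Z', q', ⟨z', hz'⟩, e', hq'⟩ := hloc (q ≫ k) z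
    have h₁ : (q' ≫ q) ≫ h = ((q' ≫ q) ≫ h ≫ p) ≫ i e := by
      simpa using congr(q' ≫ $hq)
    have h₂ : (q' ≫ q) ≫ k = ((q' ≫ q) ≫ h ≫ p) ≫ i e' := by
      have hp' : h ≫ p = k ≫ p := hp
      rw [hp']
      simpa using hq'
    have : e = e' := by
      refine hy.eq_of_eq ((q' ≫ q) ≫ h ≫ p) ⟨z'⟩ e e' ?_
      rw [← ht e, ← ht e', ← Functor.map_comp_apply, ← Functor.map_comp_apply, ← op_comp, ← op_comp,
        ← h₁, ← h₂, op_comp, op_comp (f := q' ≫ q), Functor.map_comp_apply,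
        Functor.map_comp_apply, ht']
    subst this
    exact ⟨_, q' ≫ q, ⟨z', by rw [comp_left_apply]; exact (congrArg q.left hz').trans hz⟩,
      h₁.trans h₂.symm⟩
  · obtain ⟨W', f, hf, e, he⟩ := hy.exists_eq w x a
    refine ⟨W', f, hf, (f ≫ w) ≫ i e, ?_, ?_⟩
    · rw [Category.assoc, hip, Category.comp_id]
    · rw [op_comp, Functor.map_comp_apply, ht, he]

end Trivialization

/-! ### Representability over small opens -/

section LocalRepresentability

variable {X : Scheme.{u}}

/-- An open subscheme of `X` as an object of the étale site. -/
abbrev openObj (O : X.Opens) : X.Etale := .mk O.ι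

/-- `P` is represented by a finite étale scheme over `V`. -/
def IsFiniteRep (P : X.Etaleᵒᵖ ⥤ Type u) (V : X.Etale) : Prop :=
  ∃ (Y : X.Etale) (p : Y ⟶ V) (t : P.obj (op Y)), IsFinite p.left ∧ IsRep P p t

variable {P : X.Etaleᵒᵖ ⥤ Type u}

theorem IsFiniteRep.of_hom {V V' : X.Etale} (h : IsFiniteRep P V) (f : V' ⟶ V) :
    IsFiniteRep P V' := by
  obtain ⟨Y, p, t, hp, ht⟩ := h
  have hpb := IsPullback.of_hasPullback p f
  exact ⟨_, pullback.snd p f, _, MorphismProperty.of_isPullback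
    (P := @IsFinite.{u}) (hpb.map (Scheme.Etale.forget X ⋙ Over.forget X)) hp, ht.of_isPullback hpb⟩

/-- A locally trivial sheaf is represented by finite étale schemes over sufficiently small open
subsets. -/
theorem IsLocallyTrivial.exists_isFiniteRep (hP : Presieve.IsSheaf X.smallEtaleTopology P)
    (hl : IsLocallyTrivial P) (a : X) : ∃ O : X.Opens, a ∈ O ∧ IsFiniteRep P (openObj O) := by
  obtain ⟨V, ⟨b, hb⟩, E, _, y, hy⟩ := hl a
  let g : V.left ⟶ X := V.hom
  have : Etale g := V.prop
  replace hb : g b = a := hb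
  obtain ⟨O₀, hO₀, haO₀, -⟩ := TopologicalSpace.Opens.isBasis_iff_nbhd.1 X.isBasis_affineOpens
    (TopologicalSpace.Opens.mem_top a)
  obtain ⟨U₁, hU₁, hbU₁, hU₁O₀⟩ := TopologicalSpace.Opens.isBasis_iff_nbhd.1
    V.left.isBasis_affineOpens (show b ∈ g ⁻¹ᵁ O₀ by rwa [Scheme.Hom.mem_preimage, hb])
  let I : X.Opens := ⟨g '' U₁, g.isOpenMap _ U₁.2⟩
  -- The basic open `D` lies inside the image of `U₁`, so `U = U₁ ∩ g⁻¹ D` is affine and maps onto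
  -- `D`. This gives an étale, faithfully flat ring map `R → S` along which to descend.
  obtain ⟨f, hfI, haf⟩ := hO₀.exists_basicOpen_le (V := I) ⟨a, ⟨b, hbU₁, hb⟩⟩ haO₀
  let D := X.basicOpen f
  have hD : IsAffineOpen D := hO₀.basicOpen f
  let U := V.left.basicOpen (g.appLE O₀ U₁ hU₁O₀ f)
  have hU : IsAffineOpen U := IsAffineOpen.basicOpen hU₁ _
  have hU' : U = U₁ ⊓ g ⁻¹ᵁ D := Scheme.basicOpen_appLE _ _ _ _ _
  have hUD : U ≤ g ⁻¹ᵁ D := hU'.le.trans inf_le_right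
  let R : Type u := Γ(X, D)
  let S : Type u := Γ(V.left, U)
  let φ : Γ(X, D) ⟶ Γ(V.left, U) := g.appLE D U hUD
  let : Algebra R S := φ.hom.toAlgebra
  have hφ : Spec.map φ ≫ hD.fromSpec = hU.fromSpec ≫ g := hD.SpecMap_appLE_fromSpec g hU hUD
  have : Algebra.Etale R S := RingHom.etale_algebraMap.1 (g.etale_appLE hD hU hUD)
  have hsurj : Function.Surjective (PrimeSpectrum.comap (algebraMap R S)) := by
    intro r
    have hr : hD.fromSpec r ∈ D := by
      have : hD.fromSpec r ∈ Set.range hD.fromSpec := ⟨r, rfl⟩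
      rwa [hD.range_fromSpec] at this
    obtain ⟨c, hc, hcr⟩ := hfI hr
    have hcU : c ∈ Set.range hU.fromSpec := by
      rw [hU.range_fromSpec, hU']
      refine ⟨hc, ?_⟩
      change g c ∈ D
      rw [hcr]
      exact hr
    obtain ⟨s, rfl⟩ := hcU
    refine ⟨s, hD.fromSpec.injective ?_⟩
    rw [← hcr]
    exact congr($hφ s)
  have : Module.FaithfullyFlat R S := Module.FaithfullyFlat.of_comap_surjective hsurj
  let v : Spec (.of R) ⟶ X := hD.fromSpec
  have : IsOpenImmersion v := inferInstanceAs (IsOpenImmersion hD.fromSpec)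
  have : Etale v := inferInstance
  let m : specObj v S ⟶ V := MorphismProperty.Over.homMk hU.fromSpec hφ.symm trivial
  obtain ⟨t, ht⟩ := (hy.map m).exists_isRep hP v
  obtain ⟨A, _, _, _, t', hA, ht'⟩ := ht.exists_descent hP v
  refine ⟨D, haf, IsFiniteRep.of_hom (V := .mk v) ⟨_, _, t', ?_, ht'⟩ ?_⟩
  · exact (IsFinite.SpecMap_iff (CommRingCat.ofHom (algebraMap R A))).2
      (RingHom.finite_algebraMap.2 hA)
  · exact MorphismProperty.Over.homMk hD.isoSpec.hom hD.isoSpec_hom_fromSpec trivial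

end LocalRepresentability

/-! ### Zariski gluing of the local representing schemes -/

section Gluing

instance : IsZariskiLocalAtTarget @Etale.{u} :=
  HasRingHomProperty.instIsZariskiLocalAtTarget (P := @Etale.{u}) (Q := RingHom.Etale)

instance : IsZariskiLocalAtTarget @IsFinite.{u} :=
  have : HasAffineProperty @IsFinite.{u} (affineAnd RingHom.Finite) :=
    (HasAffineProperty.affineAnd_iff @IsFinite.{u} RingHom.finite_respectsIso
      RingHom.finite_localizationPreserves.away RingHom.finite_ofLocalizationSpan).2
      fun f ↦ isFinite_iff f
  HasAffineProperty.instIsZariskiLocalAtTarget (P := @IsFinite.{u}) (Q := affineAnd RingHom.Finite)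

variable {X : Scheme.{u}}

/-- The inclusion between open subschemes, in the étale site. -/
def openMap {O O' : X.Opens} (h : O ≤ O') : openObj O ⟶ openObj O' :=
  MorphismProperty.Over.homMk (X.homOfLE h) (X.homOfLE_ι h) trivial

instance (V : X.Etale) (O : X.Opens) : Subsingleton (V ⟶ openObj O) where
  allEq f g := by
    let j : (O : Scheme.{u}) ⟶ X := O.ι
    have : Mono j := inferInstanceAs (Mono (Scheme.Opens.ι O))
    have h : f.left ≫ j = g.left ≫ j :=
      (MorphismProperty.Over.w f).trans (MorphismProperty.Over.w g).symm
    exact MorphismProperty.Over.Hom.ext ((cancel_mono j).1 h)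

theorem hom_apply_mem_of_hom_openObj {V : X.Etale} {O : X.Opens} (f : V ⟶ openObj O) (a : V.left) :
    V.hom a ∈ O := by
  have h : f.left ≫ O.ι = V.hom := MorphismProperty.Over.w f
  have h' : V.hom a = O.ι (f.left a) := congr($(h) a).symm
  rw [h']
  exact (f.left a).2

theorem exists_hom_openObj (V : X.Etale) (O : X.Opens) (h : ∀ a : V.left, V.hom a ∈ O) :
    Nonempty (V ⟶ openObj O) := by
  let f : V.left ⟶ X := V.hom
  have h' : Set.range f ⊆ Set.range O.ι := by
    rw [Scheme.Opens.range_ι]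
    rintro _ ⟨a, rfl⟩
    exact h a
  let j : (O : Scheme.{u}) ⟶ X := O.ι
  have : IsOpenImmersion j := inferInstanceAs (IsOpenImmersion (Scheme.Opens.ι O))
  let k : V.left ⟶ O := IsOpenImmersion.lift j f h'
  have hk : k ≫ j = f := IsOpenImmersion.lift_fac _ _ _
  exact ⟨MorphismProperty.Over.homMk k hk trivial⟩

theorem exists_glued_of_relativeGluingData {𝒰 : X.OpenCover} [Category 𝒰.I₀]
    [𝒰.LocallyDirected] [Small.{u} 𝒰.I₀] [Quiver.IsThin 𝒰.I₀] (d : 𝒰.RelativeGluingData) :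
    ∃ (Y : Scheme.{u}) (q : Y ⟶ X) (j : ∀ i, d.functor.obj i ⟶ Y),
      (∀ {i i' : 𝒰.I₀} (h : i ⟶ i'), d.functor.map h ≫ j i' = j i) ∧
      ∀ i, IsPullback (d.natTrans.app i) (j i) (𝒰.f i) q :=
  ⟨d.glued, d.toBase, colimit.ι d.functor, colimit.w d.functor, d.isPullback_natTrans_ι_toBase⟩

/-- A compatible family of schemes over the members of a basis of open subsets glues. -/
theorem exists_relative_glued (Q : X.Opens → Prop) (hQ : ∀ O O', O ≤ O' → Q O' → Q O)
    (hcov : ∀ a : X, ∃ O : X.Opens, a ∈ O ∧ Q O) (F : {O // Q O} ⥤ X.Etale)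
    (p : ∀ O, F.obj O ⟶ openObj O.1)
    (hp : ∀ {O O' : {O // Q O}} (h : O ⟶ O'),
      IsPullback (F.map h) (p O) (p O') (openMap (leOfHom h))) :
    ∃ (Y : Scheme.{u}) (q : Y ⟶ X) (j : ∀ O, (F.obj O).left ⟶ Y),
      (∀ {O O' : {O // Q O}} (h : O ⟶ O'), (F.map h).left ≫ j O' = j O) ∧
      ∀ O, IsPullback (p O).left (j O) O.1.ι q := by
  let 𝒰 : X.OpenCover :=
    { I₀ := {O // Q O}
      X O := O.1
      f O := O.1.ι
      mem₀ := by
        rw [Scheme.presieve₀_mem_precoverage_iff]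
        refine ⟨fun a ↦ ?_, inferInstance⟩
        obtain ⟨O, ha, hO⟩ := hcov a
        exact ⟨⟨O, hO⟩, by simpa using ha⟩ }
  let : Preorder 𝒰.I₀ := inferInstanceAs (Preorder {O // Q O})
  have hle {i j : 𝒰.I₀} : i ≤ j ↔ (𝒰.f i).opensRange ≤ (𝒰.f j).opensRange := by
    change i.1 ≤ j.1 ↔ i.1.ι.opensRange ≤ j.1.ι.opensRange
    rw [Scheme.Opens.opensRange_ι, Scheme.Opens.opensRange_ι]
  have hB : TopologicalSpace.Opens.IsBasis (Set.range fun i ↦ (𝒰.f i).opensRange) := by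
    rw [TopologicalSpace.Opens.isBasis_iff_nbhd]
    intro U a ha
    obtain ⟨O, haO, hO⟩ := hcov a
    -- Since `Q` is inherited by smaller opens, its members form a basis.
    exact ⟨U ⊓ O, ⟨⟨U ⊓ O, hQ _ _ inf_le_right hO⟩, Scheme.Opens.opensRange_ι _⟩, ⟨ha, haO⟩,
      inf_le_left⟩
  let : 𝒰.LocallyDirected := .ofIsBasisOpensRange hle hB
  have : Quiver.IsThin 𝒰.I₀ := fun _ _ ↦ inferInstance
  have : Small.{u} 𝒰.I₀ := inferInstance
  have hmap {i j : 𝒰.I₀} (h : i ⟶ j) : 𝒰.trans h = X.homOfLE (leOfHom h : i.1 ≤ j.1) :=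
    (cancel_mono (𝒰.f j)).1 ((𝒰.trans_map h).trans (X.homOfLE_ι (leOfHom h)).symm)
  let d : 𝒰.RelativeGluingData :=
    { functor := F ⋙ Scheme.Etale.forget X ⋙ Over.forget X
      natTrans :=
        { app O := (p O).left
          naturality O O' h := by
            refine congr($((hp h).w).left).trans ?_
            change _ = _ ≫ 𝒰.trans h
            rw [hmap]
            rfl }
      equifibered := fun O O' h ↦ by
        have := (hp h).map (Scheme.Etale.forget X ⋙ Over.forget X)
        change IsPullback (F.map h).left (p O).left (p O').left (𝒰.trans h)
        rw [hmap]
        exact this }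
  exact exists_glued_of_relativeGluingData d

variable {P : X.Etaleᵒᵖ ⥤ Type u}

/-- The canonical morphism between objects representing the same presheaf is cartesian. -/
theorem IsRep.isPullback {Y V Y' V' : X.Etale} {p : Y ⟶ V} {t : P.obj (op Y)} (ht : IsRep P p t)
    {p' : Y' ⟶ V'} {t' : P.obj (op Y')} (ht' : IsRep P p' t') {f : V' ⟶ V} {f' : Y' ⟶ Y}
    (h : f' ≫ p = p' ≫ f) (hf : P.map f'.op t = t') : IsPullback f' p' p f := by
  have H (s : PullbackCone p f) := ht' s.snd (P.map s.fst.op t)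
  refine ⟨⟨h⟩, ⟨PullbackCone.IsLimit.mk _ (fun s ↦ (H s).choose) (fun s ↦ ?_)
    (fun s ↦ (H s).choose_spec.1.1) fun s m hm hm' ↦ (H s).choose_spec.2 m ⟨hm', ?_⟩⟩⟩
  · refine ht.hom_ext ?_ ?_
    · rw [Category.assoc, h, ← Category.assoc, (H s).choose_spec.1.1, s.condition]
    · rw [op_comp, Functor.map_comp_apply, hf, (H s).choose_spec.1.2]
  · rw [← hf, ← Functor.map_comp_apply, ← op_comp, hm]

/-- A locally trivial sheaf is represented by a finite étale `X`-scheme. -/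
theorem IsLocallyTrivial.exists_finiteEtale (hP : Presieve.IsSheaf X.smallEtaleTopology P)
    (hl : IsLocallyTrivial P) : ∃ (Y : FEt X) (t : P.obj (op ((FEt.toEtale X).obj Y))),
      ∀ (U : X.Etale) (x : P.obj (op U)), ∃ h : U ⟶ (FEt.toEtale X).obj Y, P.map h.op t = x := by
  let I := {O : X.Opens // IsFiniteRep P (openObj O)}
  choose Y p t hfin ht using fun O : I ↦ O.2
  -- The transition maps are classifying maps of the universal sections; their uniqueness `hu` gives
  -- the functor laws, so no cocycle condition has to be checked.
  have hmap {O O' : I} (h : O ⟶ O') := ht O' (p O ≫ openMap (leOfHom h)) (t O)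
  choose m hm hu using @hmap
  let F : I ⥤ X.Etale :=
    { obj := Y
      map h := m h
      map_id O := (hu _ _ ⟨by rw [Category.id_comp, Subsingleton.elim (openMap _) (𝟙 _),
        Category.comp_id], by simp⟩).symm
      map_comp {O O' O''} h h' := (hu _ _ ⟨by
          rw [Category.assoc, (hm h').1, reassoc_of% (hm h).1]
          congr 1
          exact Subsingleton.elim _ _, by
          rw [op_comp, Functor.map_comp_apply, (hm h').2, (hm h).2]⟩).symm }
  have hpb {O O' : I} (h : O ⟶ O') : IsPullback (F.map h) (p O) (p O') (openMap (leOfHom h)) :=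
    (ht O').isPullback (ht O) (hm h).1 (hm h).2
  obtain ⟨Z, q, j, hj, hpbj⟩ := exists_relative_glued _
    (fun O O' h hO' ↦ IsFiniteRep.of_hom hO' (openMap h)) (hl.exists_isFiniteRep hP) F p hpb
  have hloc (R : MorphismProperty Scheme.{u}) [IsZariskiLocalAtTarget R]
      (h : ∀ O, R (p O).left) : R q := by
    have hsup : iSup (fun O : I ↦ O.1) = ⊤ := by
      refine top_unique fun a _ ↦ ?_
      obtain ⟨O, ha, hO⟩ := hl.exists_isFiniteRep hP a
      exact TopologicalSpace.Opens.mem_iSup.2 ⟨⟨O, hO⟩, ha⟩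
    rw [IsZariskiLocalAtTarget.iff_of_iSup_eq_top (P := R) _ hsup]
    intro O
    let e := IsPullback.isoIsPullback _ _ (isPullback_morphismRestrict q O.1) (hpbj O)
    have he : e.hom ≫ (p O).left = q ∣_ O.1 := IsPullback.isoIsPullback_hom_fst _ _ _ _
    rw [← he]
    exact (R.cancel_left_of_respectsIso _ _).2 (h O)
  have hq : finiteEtale.{u} q := ⟨hloc @IsFinite.{u} hfin, hloc @Etale.{u} fun O ↦ etale_left (p O)⟩
  let Yf : FEt X := MorphismProperty.Over.mk ⊤ q hq
  let Yc : X.Etale := (FEt.toEtale X).obj Yf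
  let T : X.Etale := .mk (𝟙 X)
  let pc : Yc ⟶ T := MorphismProperty.Over.homMk q (Category.comp_id q) trivial
  let i (O : I) : openObj O.1 ⟶ T := MorphismProperty.Over.homMk O.1.ι (Category.comp_id _) trivial
  let jc (O : I) : Y O ⟶ Yc := MorphismProperty.Over.homMk (j O)
    ((hpbj O).w.symm.trans (MorphismProperty.Over.w (p O))) trivial
  have hjc {O O' : I} (h : O ⟶ O') : m h ≫ jc O' = jc O := MorphismProperty.Over.Hom.ext (hj h)
  have hpc (O : I) : IsPullback (jc O) (p O) pc (i O) := isPullback_of_isPullback_left (hpbj O).flip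
  have hcov (z : Yc.left) : ∃ O, z ∈ Set.range (jc O).left := by
    obtain ⟨O, ha, hO⟩ := hl.exists_isFiniteRep hP (q z)
    have ha' : q z ∈ Set.range O.ι := by rwa [Scheme.Opens.range_ι]
    obtain ⟨a, ha⟩ := ha'
    obtain ⟨b, hb, -⟩ := exists_preimage_of_isPullback (hpc ⟨O, hO⟩) z a ha.symm
    exact ⟨_, b, hb⟩
  obtain ⟨tc, htc⟩ := exists_glue hP jc hcov t (fun O O' W g g' e ↦ by
    -- Both `g` and `g'` factor through the piece over `O ⊓ O'`, by the same map, and there both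
    -- universal sections restrict to the one of `O''`.
    let O'' : I := ⟨O.1 ⊓ O'.1, IsFiniteRep.of_hom O.2 (openMap inf_le_left)⟩
    obtain ⟨w⟩ := exists_hom_openObj W O''.1 fun a ↦
      ⟨hom_apply_mem_of_hom_openObj (g ≫ p O) a, hom_apply_mem_of_hom_openObj (g' ≫ p O') a⟩
    let k : O'' ⟶ O := homOfLE (inf_le_left : O.1 ⊓ O'.1 ≤ O.1)
    let k' : O'' ⟶ O' := homOfLE (inf_le_right : O.1 ⊓ O'.1 ≤ O'.1)
    obtain ⟨l, hl⟩ : ∃ l : W ⟶ Y O'', l ≫ m k = g :=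
      ⟨_, (hpb k).lift_fst g w (Subsingleton.elim _ _)⟩
    obtain ⟨l', hl'⟩ : ∃ l : W ⟶ Y O'', l ≫ m k' = g' :=
      ⟨_, (hpb k').lift_fst g' w (Subsingleton.elim _ _)⟩
    have : l = l' := (hpc O'').hom_ext
      (by rw [← hjc k, reassoc_of% hl, hjc, ← hjc k', reassoc_of% hl', e]) (Subsingleton.elim _ _)
    rw [← hl, ← hl', this, op_comp, op_comp, Functor.map_comp_apply, Functor.map_comp_apply,
      (hm k).2, (hm k').2])
  have hrep : IsRep P pc tc := IsRep.of_isPullback_locally hP fun b ↦ by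
    obtain ⟨O, ha, hO⟩ := hl.exists_isFiniteRep hP b
    have ha' : b ∈ Set.range O.ι := by rwa [Scheme.Opens.range_ι]
    refine ⟨_, _, i ⟨O, hO⟩, jc ⟨O, hO⟩, p ⟨O, hO⟩, ha', hpc ⟨O, hO⟩, ?_⟩
    rw [htc]
    exact ht _
  refine ⟨Yf, tc, fun U x ↦ ?_⟩
  let w : U ⟶ T := MorphismProperty.Over.homMk U.hom (Category.comp_id _) trivial
  exact ⟨_, (hrep w x).choose_spec.1.2⟩

theorem IsLocallyTrivial.isLocallyFiniteEtale (hP : Presieve.IsSheaf X.smallEtaleTopology P)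
    (hl : IsLocallyTrivial P) : IsLocallyFiniteEtale P := by
  intro U x a
  obtain ⟨Y, t, hY⟩ := hl.exists_finiteEtale hP
  obtain ⟨h, hh⟩ := hY U x
  exact ⟨U, 𝟙 U, ⟨a, rfl⟩, Y, h, t, by simpa using hh⟩

end Gluing

/-! ### Étale local splitting of finite étale schemes -/

section Splitting

variable {X : Scheme.{u}}

/-- The first half of being a trivialization: étale locally, each section is a member of the
family. -/
def IsLocallyExhaustive {P : X.Etaleᵒᵖ ⥤ Type u} {V : X.Etale} {E : Type u}
    (y : E → P.obj (op V)) : Prop :=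
  ∀ ⦃W : X.Etale⦄ (w : W ⟶ V) (x : P.obj (op W)) (a : W.left),
    ∃ (W' : X.Etale) (f : W' ⟶ W), a ∈ Set.range f.left ∧ ∃ e, P.map (f ≫ w).op (y e) = P.map f.op x

open TensorProduct in
-- A finite étale algebra of constant rank becomes a power `S^m` over some étale faithfully flat
-- `S`. The `m` coordinate projections give the sections `σ`, and they are exhaustive because every
-- prime of `S^m` comes from one factor.
theorem exists_splitting_of_isPullback {R : Type u} [CommRing R] (v : Spec (.of R) ⟶ X) [Etale v]
    {B : Type u} [CommRing B] [Algebra R B] [Algebra.Etale R B] [Module.Finite R B] {n : ℕ}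
    (hn : Module.rankAtStalk (R := R) B = n) {Y T : X.Etale} {b : specObj v B ⟶ Y} {p : Y ⟶ T}
    {q : .mk v ⟶ T} (hb : IsPullback b (specHom v B) p q) :
    ∃ (U : X.Etale) (g : U ⟶ .mk v) (_ : Function.Surjective g.left) (E : Type u) (_ : Finite E)
      (σ : E → (U ⟶ Y)), (∀ e, σ e ≫ p = g ≫ q) ∧
      ∀ ⦃W : X.Etale⦄ (w : W ⟶ U) (x : W ⟶ Y), x ≫ p = w ≫ g ≫ q → ∀ a : W.left,
        ∃ (W' : X.Etale) (f : W' ⟶ W), a ∈ Set.range f.left ∧ ∃ e, f ≫ w ≫ σ e = f ≫ x := by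
  obtain ⟨S, _, _, _, _, _, hS⟩ := Algebra.IsFiniteSplit.exists_tensorProduct_of_etale hn
  obtain ⟨m, ⟨e⟩⟩ := hS.nonempty_algEquiv_fun
  have : Algebra.Etale R (S ⊗[R] B) := Algebra.Etale.comp R S _
  let ev (i : Fin m) : S ⊗[R] B →ₐ[R] S :=
    ((Pi.evalAlgHom S (fun _ ↦ S) i).comp e.toAlgHom).restrictScalars R
  let ir : B →ₐ[R] S ⊗[R] B := Algebra.TensorProduct.includeRight
  let il : S →ₐ[R] S ⊗[R] B := Algebra.TensorProduct.includeLeft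
  have hev (i : Fin m) : (ev i).comp il = AlgHom.id R S := by
    ext s
    change e (algebraMap S (S ⊗[R] B) s) i = s
    rw [AlgEquiv.commutes]
    rfl
  have hpb : IsPullback (specMap v il) (specMap v ir) (specHom v S) (specHom v B) :=
    isPullback_specMap_tensorProduct v S B
  refine ⟨specObj v S, specHom v S, specHom_surjective v, ULift (Fin m), inferInstance,
    fun i ↦ specMap v (ev i.down) ≫ specMap v ir ≫ b, fun i ↦ ?_, fun W w x hx a ↦ ?_⟩
  · rw [Category.assoc, Category.assoc, hb.w, specMap_specHom_assoc, specMap_specHom_assoc]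
  · obtain ⟨x', hx₁, hx₂⟩ : ∃ x' : W ⟶ specObj v B, x' ≫ b = x ∧ x' ≫ specHom v B = w ≫ specHom v S :=
      ⟨hb.lift x (w ≫ specHom v S) (by rw [hx, Category.assoc]), hb.lift_fst _ _ _, hb.lift_snd _ _ _⟩
    obtain ⟨z, hz₁, hz₂⟩ : ∃ z : W ⟶ specObj v (S ⊗[R] B), z ≫ specMap v il = w ∧
        z ≫ specMap v ir = x' :=
      ⟨hpb.lift w x' hx₂.symm, hpb.lift_fst _ _ _, hpb.lift_snd _ _ _⟩
    obtain ⟨i, s, hs⟩ : ∃ (i : Fin m) (s : (specObj v S).left),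
        (specMap v (ev i)).left s = z.left a := by
      let za : PrimeSpectrum (S ⊗[R] B) := z.left a
      let za' : PrimeSpectrum (Fin m → S) := PrimeSpectrum.comap e.symm.toAlgHom.toRingHom za
      obtain ⟨i, s, hs⟩ := PrimeSpectrum.exists_comap_evalRingHom_eq za'
      refine ⟨i, s, ?_⟩
      change PrimeSpectrum.comap (ev i).toRingHom s = za
      have h : za = PrimeSpectrum.comap e.toAlgHom.toRingHom za' := by
        ext t
        change t ∈ za.asIdeal ↔ e.symm (e t) ∈ za.asIdeal
        rw [e.symm_apply_apply]
      rw [h, ← hs]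
      rfl
    obtain ⟨c, hc, -⟩ := exists_pullback_point z (specMap v (ev i)) a s hs.symm
    let f := pullback.fst z (specMap v (ev i))
    -- `f` restricts to the part of `W` that `z` sends into the sheet `i`; there `z` is determined
    -- by its projection `w`, as `ev i` is a retraction of `il`.
    have hf : f ≫ z = f ≫ w ≫ specMap v (ev i) := by
      have h : f ≫ z = pullback.snd z (specMap v (ev i)) ≫ specMap v (ev i) := pullback.condition
      have h' : f ≫ w = pullback.snd z (specMap v (ev i)) := by
        rw [← hz₁, reassoc_of% h, ← specMap_comp, hev, specMap_id, Category.comp_id]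
      rw [reassoc_of% h', h]
    refine ⟨_, f, ⟨c, hc⟩, ⟨i⟩, ?_⟩
    rw [← hx₁, ← hz₂, Category.assoc, reassoc_of% hf]

/-- The rank of `Y` over `X` is locally constant, so `Y` has constant rank over an affine
neighbourhood of `a`, where the ring-theoretic splitting applies. -/
theorem exists_splitting (Y : FEt X) (a : X) :
    ∃ (U : X.Etale) (_ : a ∈ Set.range U.hom) (E : Type u) (_ : Finite E)
      (σ : E → (yoneda.obj ((FEt.toEtale X).obj Y)).obj (op U)), IsLocallyExhaustive σ := by
  let f : Y.left ⟶ X := Y.hom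
  have hf : IsFinite f := Y.prop.1
  have hf' : Etale f := Y.prop.2
  have hflat : Flat f := inferInstance
  obtain ⟨N, hN, haN, hcN⟩ := (IsLocallyConstant.iff_exists_open _).1 f.isLocallyConstant_finrank a
  obtain ⟨O, (hO : IsAffineOpen O), haO, hON⟩ := TopologicalSpace.Opens.isBasis_iff_nbhd.1 X.isBasis_affineOpens
    (show a ∈ (⟨N, hN⟩ : X.Opens) from haN)
  let R : Type u := Γ(X, O)
  let v : Spec (.of R) ⟶ X := hO.fromSpec
  have : IsOpenImmersion v := inferInstanceAs (IsOpenImmersion hO.fromSpec)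
  have : Etale v := inferInstance
  let Z := pullback f v
  let s : Z ⟶ Spec (.of R) := pullback.snd f v
  have hs : IsFinite s := inferInstanceAs (IsFinite (pullback.snd f v))
  have hs' : Etale s := inferInstanceAs (Etale (pullback.snd f v))
  have : IsAffine Z := isAffine_of_isAffineHom s
  obtain ⟨φ, hφ⟩ := Spec.map_surjective (Z.isoSpec.inv ≫ s)
  let B : Type u := Γ(Z, ⊤)
  let : Algebra R B := φ.hom.toAlgebra
  have h₁ : IsFinite (Spec.map φ) := by rw [hφ]; infer_instance
  have h₂ : Etale (Spec.map φ) := by rw [hφ]; infer_instance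
  have : Module.Finite R B := RingHom.finite_algebraMap.1 ((IsFinite.SpecMap_iff φ).1 h₁)
  have : Algebra.Etale R B := RingHom.etale_algebraMap.1
    ((HasRingHomProperty.Spec_iff (P := @Etale.{u})).1 h₂)
  have hpb : IsPullback (Z.isoSpec.inv ≫ pullback.fst f v) (Spec.map φ) f v :=
    IsPullback.of_iso (IsPullback.of_hasPullback f v) Z.isoSpec (Iso.refl _) (Iso.refl _)
      (Iso.refl _) (by simp) (by rw [hφ]; simp [s]) (by simp) (by simp)
  have hn : Module.rankAtStalk (R := R) B = (f.finrank a : ℕ) := by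
    ext r
    rw [← Scheme.Hom.finrank_SpecMap_algebraMap]
    refine (Scheme.Hom.finrank_of_isPullback _ _ _ _ hpb r).trans (hcN _ (hON ?_))
    have : v r ∈ Set.range hO.fromSpec := ⟨r, rfl⟩
    rwa [hO.range_fromSpec] at this
  let T : X.Etale := .mk (𝟙 X)
  let b : specObj v B ⟶ (FEt.toEtale X).obj Y :=
    MorphismProperty.Over.homMk (Z.isoSpec.inv ≫ pullback.fst f v) hpb.w trivial
  let p : (FEt.toEtale X).obj Y ⟶ T := MorphismProperty.Over.homMk f (Category.comp_id _) trivial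
  let q : .mk v ⟶ T := MorphismProperty.Over.homMk v (Category.comp_id _) trivial
  have hb : IsPullback b (specHom v B) p q := isPullback_of_isPullback_left hpb
  obtain ⟨U, g, hg, E, hE, σ, -, hσ⟩ := exists_splitting_of_isPullback v hn hb
  have hT {W : X.Etale} (g g' : W ⟶ T) : g = g' := MorphismProperty.Over.Hom.ext <| by
    exact (Category.comp_id _).symm.trans ((MorphismProperty.Over.w g).trans
      ((MorphismProperty.Over.w g').symm.trans (Category.comp_id _)))
  refine ⟨U, ?_, E, hE, σ, fun W w x c ↦ ?_⟩
  · have ha : a ∈ Set.range hO.fromSpec := by rwa [hO.range_fromSpec]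
    obtain ⟨r, hr⟩ := ha
    obtain ⟨c, hc⟩ := hg r
    have h : g.left ≫ v = U.hom := MorphismProperty.Over.w g
    refine ⟨c, ?_⟩
    rw [← h, ← hr, ← hc]
    rfl
  · obtain ⟨W', k, hk, e, he⟩ := hσ w x (hT _ _) c
    exact ⟨W', k, hk, e, (Category.assoc _ _ _).trans he⟩

end Splitting

/-! ### Trivializations and constant sheaves -/

section ConstantSheaves

variable {X : Scheme.{u}}

theorem exists_common_etale {U V : X.Etale} (a : U.left) (b : V.left) (h : U.hom a = V.hom b) :
    ∃ (W : X.Etale) (f : W ⟶ U) (_ : W ⟶ V), a ∈ Set.range f.left := by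
  let T : X.Etale := .mk (𝟙 X)
  let p : U ⟶ T := MorphismProperty.Over.homMk U.hom (Category.comp_id _) trivial
  let q : V ⟶ T := MorphismProperty.Over.homMk V.hom (Category.comp_id _) trivial
  obtain ⟨z, hz, -⟩ := exists_pullback_point p q a b h
  exact ⟨_, pullback.fst p q, pullback.snd p q, z, hz⟩

theorem IsTrivialization.isClosed_eqLocus {P : X.Etaleᵒᵖ ⥤ Type u} {V : X.Etale} {E : Type u}
    {y : E → P.obj (op V)} (hy : IsTrivialization y) {U : X.Etale} (f : U ⟶ V) (e e' : E) :
    IsClosed (eqLocus (P.map f.op (y e)) (P.map f.op (y e')) : Set U.left) := by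
  by_cases h : e = e'
  · have : (eqLocus (P.map f.op (y e)) (P.map f.op (y e')) : Set U.left) = Set.univ :=
      Set.eq_univ_of_forall fun a ↦ ⟨U, 𝟙 U, ⟨a, rfl⟩, by rw [h]⟩
    rw [this]
    exact isClosed_univ
  · have : (eqLocus (P.map f.op (y e)) (P.map f.op (y e')) : Set U.left) = ∅ := by
      refine Set.eq_empty_of_forall_notMem ?_
      rintro a ⟨W, g, ⟨w, -⟩, hg⟩
      rw [← Functor.map_comp_apply, ← Functor.map_comp_apply] at hg
      exact h (hy.eq_of_eq (g ≫ f) ⟨w⟩ e e' hg)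
    rw [this]
    exact isClosed_empty

/-- Étale locally both sections are members of one trivialization, and two members agree everywhere
or nowhere. -/
theorem IsLocallyTrivial.hasClopenEquality {P : X.Etaleᵒᵖ ⥤ Type u} (h : IsLocallyTrivial P) :
    HasClopenEquality P := by
  intro U x y
  refine isClosed_eqLocus_of_locally _ _ fun a ↦ ?_
  obtain ⟨V, ⟨b, hb⟩, E, -, s, hs⟩ := h (U.hom a)
  obtain ⟨W, f, g, ⟨w, rfl⟩⟩ := exists_common_etale a b hb.symm
  obtain ⟨W₁, f₁, ⟨w₁, rfl⟩, e₁, h₁⟩ := hs.exists_eq g (P.map f.op x) w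
  obtain ⟨W₂, f₂, ⟨w₂, rfl⟩, e₂, h₂⟩ := hs.exists_eq (f₁ ≫ g) (P.map (f₁ ≫ f).op y) w₁
  refine ⟨W₂, f₂ ≫ f₁ ≫ f, ⟨w₂, rfl⟩, ?_⟩
  have hx : P.map (f₂ ≫ f₁ ≫ f).op x = P.map (f₂ ≫ f₁ ≫ g).op (s e₁) := by
    rw [op_comp, Functor.map_comp_apply, op_comp (f := f₂), Functor.map_comp_apply, h₁, op_comp,
      Functor.map_comp_apply]
  have hy : P.map (f₂ ≫ f₁ ≫ f).op y = P.map (f₂ ≫ f₁ ≫ g).op (s e₂) := by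
    rw [op_comp, Functor.map_comp_apply, ← h₂]
  rw [hx, hy]
  exact hs.isClosed_eqLocus _ _ _

/-- Étale schemes over an étale `X`-scheme `U` are étale over `U`. -/
theorem exists_etaleMap_iso {U : Scheme.{u}} (f : U ⟶ X) [Etale f] {W : U.Etale} {Z : X.Etale}
    (g : Z ⟶ (etaleMap f).obj W) : ∃ (Z' : U.Etale) (g' : Z' ⟶ W) (k : (etaleMap f).obj Z' ⟶ Z),
      k ≫ g = (etaleMap f).map g' ∧ Function.Surjective k.left := by
  let g₀ : Z.left ⟶ W.left := g.left
  let h : W.left ⟶ U := W.hom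
  have : Etale h := W.prop
  have hg : g₀ ≫ h ≫ f = Z.hom := MorphismProperty.Over.w g
  have : Etale (g₀ ≫ h ≫ f) := by rw [hg]; exact Z.prop
  have : Etale (h ≫ f) := inferInstance
  have : Etale g₀ := Etale.of_comp g₀ (h ≫ f)
  let Z' : U.Etale := .mk (g₀ ≫ h)
  let g' : Z' ⟶ W := MorphismProperty.Over.homMk g₀ rfl trivial
  let k : (etaleMap f).obj Z' ⟶ Z := MorphismProperty.Over.homMk (𝟙 Z.left)
    ((Category.id_comp _).trans (hg.symm.trans (Category.assoc _ _ _).symm)) trivial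
  exact ⟨Z', g', k, MorphismProperty.Over.Hom.ext (Category.id_comp _), fun z ↦ ⟨z, rfl⟩⟩

variable {A : Type (u + 1)} [Category.{u} A] {FA : A → A → Type*}
  {CA : A → Type u} [∀ V W, FunLike (FA V W) (CA V) (CA W)] [ConcreteCategory.{u} A FA]
  [PreservesLimits (forget A)] [HasColimits A] [HasLimits A]
  [(forget A).ReflectsIsomorphisms] [PreservesFilteredColimitsOfSize.{u, u} (forget A)]

/-- Restricting the sections `y e` gives a map from the constant presheaf `E` to `F|U`, and the two
clauses of a trivialization are its local surjectivity and injectivity. So it becomes an isomorphism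
on sheafifying. -/
theorem nonempty_iso_constantSheaf {F : Sheaf X.smallEtaleTopology A} {U : Scheme.{u}} (f : U ⟶ X)
    [Etale f] {E : A} (y : E ⟶ F.obj.obj (op (.mk f)))
    (hy : IsTrivialization (P := F.obj ⋙ forget A) (V := .mk f) (E := ToType E) fun e ↦ y e) :
    Nonempty ((etaleRestrict f A).obj F ≅ (constantSheaf U.smallEtaleTopology A).obj E) := by
  let F' := (etaleRestrict f A).obj F
  let π (W : U.Etale) : (etaleMap f).obj W ⟶ .mk f := MorphismProperty.Over.homMk W.hom rfl trivial
  let α : (Functor.const U.Etaleᵒᵖ).obj E ⟶ F'.obj :=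
    { app W := y ≫ F.obj.map (π W.unop).op
      naturality W W' g := by
        change 𝟙 _ ≫ y ≫ _ = (y ≫ _) ≫ F.obj.map ((etaleMap f).map g.unop).op
        rw [Category.id_comp, Category.assoc, ← F.obj.map_comp, ← op_comp]
        congr 3
        exact MorphismProperty.Over.Hom.ext (MorphismProperty.Over.w g.unop).symm }
  have hα (W : U.Etale) (e : ToType E) : α.app (op W) e = F.obj.map (π W).op (y e) :=
    ConcreteCategory.comp_apply _ _ _
  have h₁ : Presheaf.IsLocallyInjective U.smallEtaleTopology α := ⟨fun {W} e e' h ↦ by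
    refine (mem_smallEtaleTopology_iff _).2 fun a ↦ ⟨W.unop, 𝟙 _, ?_, ⟨a, rfl⟩⟩
    refine congrArg _ (hy.eq_of_eq (π W.unop) ⟨a⟩ e e' ?_)
    exact (hα _ _).symm.trans (h.trans (hα _ _))⟩
  have h₂ : Presheaf.IsLocallySurjective U.smallEtaleTopology α := ⟨fun {W} x ↦ by
    refine (mem_smallEtaleTopology_iff _).2 fun a ↦ ?_
    obtain ⟨Z, g, ⟨z, hz⟩, e, he⟩ := hy.exists_eq (π W) x a
    obtain ⟨Z', g', k, hk, hk'⟩ := exists_etaleMap_iso f g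
    obtain ⟨z', rfl⟩ := hk' z
    refine ⟨Z', g', ⟨e, ?_⟩, z', ?_⟩
    · refine (hα _ _).trans ?_
      have h₃ : π Z' = k ≫ g ≫ π W := by
        rw [reassoc_of% hk]
        exact MorphismProperty.Over.Hom.ext (MorphismProperty.Over.w g').symm
      have he' : F.obj.map (g ≫ π W).op (y e) = F.obj.map g.op x := he
      have h₄ : F'.obj.map g'.op x = F.obj.map (k ≫ g).op x := by rw [hk]; rfl
      rw [h₃, op_comp, Functor.map_comp_apply, he']
      exact ((h₄.trans (Functor.map_comp_apply F.obj g.op k.op x))).symm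
    · rw [← hz]
      exact congr($(hk).left z').symm⟩
  have hW : U.smallEtaleTopology.W α := U.smallEtaleTopology.W_of_isLocallyBijective α
  have : IsIso ((presheafToSheaf U.smallEtaleTopology A).map α) :=
    (U.smallEtaleTopology.W_iff α).1 hW
  have : IsIso ((sheafificationAdjunction U.smallEtaleTopology A).counit.app F') := inferInstance
  exact ⟨(asIso ((sheafificationAdjunction U.smallEtaleTopology A).counit.app F')).symm ≪≫
    (asIso ((presheafToSheaf U.smallEtaleTopology A).map α)).symm⟩

/-- A sheaf which is constant over an étale `X`-scheme is trivialized by its constant sections. -/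
theorem exists_isTrivialization_of_iso {F : Sheaf X.smallEtaleTopology A} {U : Scheme.{u}}
    (f : U ⟶ X) [Etale f] {E : A}
    (φ : (etaleRestrict f A).obj F ≅ (constantSheaf U.smallEtaleTopology A).obj E) :
    ∃ y : E ⟶ F.obj.obj (op ((etaleMap f).obj (.mk (𝟙 U)))),
      IsTrivialization (P := F.obj ⋙ forget A) (V := (etaleMap f).obj (.mk (𝟙 U)))
        (E := ToType E) fun e ↦ y e := by
  let F' := (etaleRestrict f A).obj F
  let T : U.Etale := .mk (𝟙 U)
  let c := (Functor.const U.Etaleᵒᵖ).obj E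
  let β : c ⟶ F'.obj := toSheafify U.smallEtaleTopology c ≫ φ.inv.hom
  have hβ : U.smallEtaleTopology.W β := by
    exact MorphismProperty.comp_mem _ _ _ (U.smallEtaleTopology.W_toSheafify c)
      (MorphismProperty.of_isIso _ _)
  have hinj := hβ.isLocallyInjective
  have hsurj := hβ.isLocallySurjective
  let π (W : U.Etale) : W ⟶ T := MorphismProperty.Over.homMk W.hom (Category.comp_id _) trivial
  have hπ (W : U.Etale) (e : ToType E) : β.app (op W) e = F'.obj.map (π W).op (β.app (op T) e) :=
    (congrArg (β.app (op W)) (ConcreteCategory.id_apply (X := E) e)).symm.trans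
      (NatTrans.naturality_apply β (π W).op e)
  have hT {W : U.Etale} (g g' : W ⟶ T) : g = g' := MorphismProperty.Over.Hom.ext <|
    (Category.comp_id _).symm.trans ((MorphismProperty.Over.w g).trans
      ((MorphismProperty.Over.w g').symm.trans (Category.comp_id _)))
  refine ⟨β.app (op T), fun W w x a ↦ ?_, fun W w hW e e' h ↦ ?_⟩
  · obtain ⟨W', w', k, hk, hk'⟩ := exists_etaleMap_iso f w
    obtain ⟨a', rfl⟩ := hk' a
    obtain ⟨Z, g, ⟨e, he⟩, ⟨z, hz⟩⟩ := (mem_smallEtaleTopology_iff _).1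
      (hsurj.imageSieve_mem (U := W') (F.obj.map k.op x)) a'
    refine ⟨_, (etaleMap f).map g ≫ k, ⟨z, ?_⟩, e, ?_⟩
    · exact congrArg k.left hz
    · have h₁ : ((etaleMap f).map g ≫ k) ≫ w = (etaleMap f).map (π Z) := by
        rw [Category.assoc, hk, ← Functor.map_comp]
        exact congrArg _ (hT _ _)
      rw [h₁]
      refine (hπ Z e).symm.trans (he.trans ?_)
      exact (Functor.map_comp_apply F.obj k.op ((etaleMap f).map g).op x).symm
  · obtain ⟨W', w', k, hk, hk'⟩ := exists_etaleMap_iso f w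
    obtain ⟨a⟩ := hW
    obtain ⟨a', -⟩ := hk' a
    have h₁ : k ≫ w = (etaleMap f).map (π W') := hk.trans (congrArg _ (hT _ _))
    have h₂ (e : ToType E) : β.app (op W') e = F.obj.map k.op (F.obj.map w.op (β.app (op T) e)) := by
      refine (hπ W' e).trans ?_
      change F.obj.map ((etaleMap f).map (π W')).op _ = _
      rw [← h₁]
      exact Functor.map_comp_apply F.obj w.op k.op (β.app (op T) e)
    have h₃ : β.app (op W') e = β.app (op W') e' := by
      rw [h₂, h₂]
      exact congrArg (F.obj.map k.op) h
    obtain ⟨Z, g, hg, -⟩ := (mem_smallEtaleTopology_iff _).1 (hinj.equalizerSieve_mem _ _ h₃) a'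
    exact (ConcreteCategory.id_apply (X := E) e).symm.trans
      (Eq.trans hg (ConcreteCategory.id_apply (X := E) e'))

end ConstantSheaves

/-! ### Locally constant constructible sheaves are locally trivial -/

section LocallyConstant

variable {X : Scheme.{u}}

theorem IsLCC.isLocallyTrivial {F : Sheaf X.smallEtaleTopology (Type u)} (hF : IsLCC X F) :
    IsLocallyTrivial (F.obj ⋙ forget (Type u)) := by
  intro a
  obtain ⟨ι, U, f, _, hU, h⟩ := hF
  obtain ⟨i, b, rfl⟩ := Set.mem_iUnion.1 (hU.ge (Set.mem_univ a))
  obtain ⟨E, hE, ⟨φ⟩⟩ := h i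
  obtain ⟨y, hy⟩ := exists_isTrivialization_of_iso (f i) φ
  refine ⟨(etaleMap (f i)).obj (.mk (𝟙 (U i))), ⟨b, ?_⟩, _, hE, _, hy⟩
  change (𝟙 (U i) ≫ f i) b = _
  rw [Category.id_comp]

theorem IsTorsionSheaf.exists_nsmul_eq_zero {F : Sheaf X.smallEtaleTopology Ab.{u}}
    (hF : IsTorsionSheaf X.smallEtaleTopology F) {U : X.Etale} (s : F.obj.obj (op U)) (a : U.left) :
    ∃ (V : X.Etale) (f : V ⟶ U) (_ : a ∈ Set.range f.left) (n : ℕ), 0 < n ∧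
      n • F.obj.map f.op s = 0 := by
  obtain ⟨S, hS, h⟩ := hF U s
  obtain ⟨V, f, hf, ha⟩ := (mem_smallEtaleTopology_iff _).1 hS a
  exact ⟨V, f, ha, h f hf⟩

theorem IsLCCAb.isLocallyTrivial {F : Sheaf X.smallEtaleTopology Ab.{u}} (hF : IsLCCAb X F)
    (hF' : IsTorsionSheaf X.smallEtaleTopology F) :
    IsLocallyTrivial (F.obj ⋙ forget Ab.{u}) := by
  intro a
  obtain ⟨ι, U, f, _, hU, h⟩ := hF
  obtain ⟨i, b, rfl⟩ := Set.mem_iUnion.1 (hU.ge (Set.mem_univ a))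
  obtain ⟨E, hE, ⟨φ⟩⟩ := h i
  obtain ⟨y, hy⟩ := exists_isTrivialization_of_iso (f i) φ
  refine ⟨(etaleMap (f i)).obj (.mk (𝟙 (U i))), ⟨b, ?_⟩, _, ?_, _, hy⟩
  · change (𝟙 (U i) ≫ f i) b = _
    rw [Category.id_comp]
  -- The section `y e` is killed by some `n` over a nonempty étale scheme, and distinct members of a
  -- trivialization agree nowhere, so `n • e = 0`. Being also finitely generated, `E` is finite.
  · have hE' : IsAddTorsion E := fun e ↦ by
      obtain ⟨V, g, ⟨c, -⟩, n, hn, h⟩ := hF'.exists_nsmul_eq_zero (y e) b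
      refine isOfFinAddOrder_iff_nsmul_eq_zero.2 ⟨n, hn, hy.eq_of_eq g ⟨c⟩ _ _ ?_⟩
      change F.obj.map g.op (y (n • e)) = F.obj.map g.op (y 0)
      rw [map_zero, map_zero, map_nsmul, map_nsmul]
      exact h
    exact AddCommGroup.finite_of_fg_isAddTorsion E hE'

end LocallyConstant

/-! ### Filtered colimits of sheaves on sections -/

section FilteredColimits

variable {X : Scheme.{u}} {A : Type (u + 1)} [Category.{u} A] {FA : A → A → Type*}
  {CA : A → Type u} [∀ V W, FunLike (FA V W) (CA V) (CA W)] [ConcreteCategory.{u} A FA]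
  [HasColimits A] [PreservesFilteredColimitsOfSize.{u, u} (forget A)]
  {K : Type u} [SmallCategory K] {D : K ⥤ Sheaf X.smallEtaleTopology A}

/-- The comparison map from the colimit of presheaves. -/
def presheafColimitDesc (c : Cocone D) :
    colimit (D ⋙ sheafToPresheaf X.smallEtaleTopology A) ⟶ c.pt.obj :=
  colimit.desc _ ((sheafToPresheaf X.smallEtaleTopology A).mapCocone c)

theorem ι_presheafColimitDesc (c : Cocone D) (k : K) :
    colimit.ι (D ⋙ sheafToPresheaf X.smallEtaleTopology A) k ≫ presheafColimitDesc c =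
      (c.ι.app k).hom := colimit.ι_desc _ _

theorem nonempty_isColimit_of_W {c : Cocone D}
    (hc : X.smallEtaleTopology.W (presheafColimitDesc c)) : Nonempty (IsColimit c) := by
  have h (s : Cocone D) := hc _ s.pt.property
  choose l hl using fun s : Cocone D ↦ (h s).2 (presheafColimitDesc s)
  refine ⟨{ desc s := ⟨l s⟩, fac s k := ?_, uniq s m hm := ?_ }⟩
  · apply Sheaf.hom_ext
    change (c.ι.app k).hom ≫ l s = _
    rw [← ι_presheafColimitDesc c, ← ι_presheafColimitDesc s, Category.assoc]
    exact congrArg _ (hl s)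
  · apply Sheaf.hom_ext
    refine (h s).1 ((Eq.trans ?_ (hl s).symm))
    refine colimit.hom_ext fun k ↦ ?_
    change colimit.ι _ k ≫ presheafColimitDesc c ≫ m.hom = colimit.ι _ k ≫ presheafColimitDesc s
    rw [← Category.assoc, ι_presheafColimitDesc, ι_presheafColimitDesc, ← hm]
    rfl

/-- Maps from either side to a sheaf `Z` are cocones from `D` to `Z`. Together with
`nonempty_isColimit_of_W` this describes sheaf colimits as presheaf colimits up to local
isomorphism. -/
theorem W_presheafColimitDesc {c : Cocone D} (hc : IsColimit c) :
    X.smallEtaleTopology.W (presheafColimitDesc c) := by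
  intro Z hZ
  let Z' : Sheaf X.smallEtaleTopology A := ⟨Z, hZ⟩
  constructor
  · intro g g' h
    have : (⟨g⟩ : c.pt ⟶ Z') = ⟨g'⟩ := hc.hom_ext fun k ↦ by
      apply Sheaf.hom_ext
      change (c.ι.app k).hom ≫ g = (c.ι.app k).hom ≫ g'
      rw [← ι_presheafColimitDesc, Category.assoc, Category.assoc]
      exact congrArg _ h
    exact congr($(this).hom)
  · intro g
    let s : Cocone D :=
      { pt := Z'
        ι := { app k := ⟨colimit.ι (D ⋙ sheafToPresheaf X.smallEtaleTopology A) k ≫ g⟩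
               naturality k k' f := by
                apply Sheaf.hom_ext
                change (D.map f).hom ≫ _ ≫ _ = (_ ≫ g) ≫ 𝟙 _
                rw [Category.comp_id, ← Category.assoc]
                exact congrArg (· ≫ g) (colimit.w (D ⋙ sheafToPresheaf X.smallEtaleTopology A) f) } }
    refine ⟨(hc.desc s).hom, colimit.hom_ext fun k ↦ ?_⟩
    change colimit.ι _ k ≫ presheafColimitDesc c ≫ (hc.desc s).hom = _
    rw [← Category.assoc, ι_presheafColimitDesc]
    exact congr($(hc.fac s k).hom)

theorem presheafColimit_exists_rep [IsFiltered K] {U : X.Etale}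
    (x : ToType ((colimit (D ⋙ sheafToPresheaf X.smallEtaleTopology A)).obj (op U))) :
    ∃ (k : K) (y : ToType ((D.obj k).obj.obj (op U))),
      (colimit.ι (D ⋙ sheafToPresheaf X.smallEtaleTopology A) k).app (op U) y = x :=
  Concrete.isColimit_exists_rep _ (isColimitOfPreserves ((evaluation _ A).obj (op U))
    (colimit.isColimit (D ⋙ sheafToPresheaf X.smallEtaleTopology A))) x

theorem presheafColimit_exists_of_eq [IsFiltered K] {U : X.Etale} (k : K)
    (x y : ToType ((D.obj k).obj.obj (op U)))
    (h : (colimit.ι (D ⋙ sheafToPresheaf X.smallEtaleTopology A) k).app (op U) x =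
      (colimit.ι (D ⋙ sheafToPresheaf X.smallEtaleTopology A) k).app (op U) y) :
    ∃ (k' : K) (f : k ⟶ k'), (D.map f).hom.app (op U) x = (D.map f).hom.app (op U) y := by
  obtain ⟨k', f, g, hfg⟩ := (Concrete.isColimit_rep_eq_iff_exists (i := k) (j := k) _
    (isColimitOfPreserves ((evaluation _ A).obj (op U))
      (colimit.isColimit (D ⋙ sheafToPresheaf X.smallEtaleTopology A))) x y).1 h
  have hfg' : (D.map f).hom.app (op U) x = (D.map g).hom.app (op U) y := hfg
  refine ⟨_, f ≫ IsFiltered.coeqHom f g, ?_⟩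
  have h₁ (z : ToType ((D.obj k).obj.obj (op U))) (l : k ⟶ k') :
      (D.map (l ≫ IsFiltered.coeqHom f g)).hom.app (op U) z =
        (D.map (IsFiltered.coeqHom f g)).hom.app (op U) ((D.map l).hom.app (op U) z) := by
    rw [D.map_comp]
    exact ConcreteCategory.comp_apply _ _ _
  rw [h₁, hfg', ← h₁, ← IsFiltered.coeq_condition f g]

variable [PreservesLimits (forget A)] [HasLimits A] [(forget A).ReflectsIsomorphisms]

theorem exists_rep_of_isColimit [IsFiltered K] {c : Cocone D} (hc : IsColimit c) {U : X.Etale}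
    (x : ToType (c.pt.obj.obj (op U))) (a : U.left) :
    ∃ (V : X.Etale) (f : V ⟶ U) (_ : a ∈ Set.range f.left) (k : K)
      (y : ToType ((D.obj k).obj.obj (op V))), (c.ι.app k).hom.app (op V) y = c.pt.obj.map f.op x := by
  obtain ⟨V, f, ⟨z, hz⟩, ha⟩ := (mem_smallEtaleTopology_iff _).1
    ((W_presheafColimitDesc hc).isLocallySurjective.imageSieve_mem x) a
  obtain ⟨k, y, rfl⟩ := presheafColimit_exists_rep z
  refine ⟨V, f, ha, k, y, Eq.trans ?_ hz⟩
  rw [← ι_presheafColimitDesc c]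
  exact ConcreteCategory.comp_apply _ _ _

theorem exists_eq_of_isColimit [IsFiltered K] {c : Cocone D} (hc : IsColimit c) {U : X.Etale} (k : K)
    (x y : ToType ((D.obj k).obj.obj (op U)))
    (h : (c.ι.app k).hom.app (op U) x = (c.ι.app k).hom.app (op U) y) (a : U.left) :
    ∃ (V : X.Etale) (f : V ⟶ U) (_ : a ∈ Set.range f.left) (k' : K) (l : k ⟶ k'),
      (D.map l).hom.app (op V) ((D.obj k).obj.map f.op x) =
        (D.map l).hom.app (op V) ((D.obj k).obj.map f.op y) := by
  let i := colimit.ι (D ⋙ sheafToPresheaf X.smallEtaleTopology A) k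
  have h' : (presheafColimitDesc c).app (op U) (i.app (op U) x) =
      (presheafColimitDesc c).app (op U) (i.app (op U) y) := by
    rw [← ι_presheafColimitDesc c] at h
    exact (ConcreteCategory.comp_apply _ _ _).symm.trans
      (h.trans (ConcreteCategory.comp_apply _ _ _))
  obtain ⟨V, f, hf, ha⟩ := (mem_smallEtaleTopology_iff _).1
    ((W_presheafColimitDesc hc).isLocallyInjective.equalizerSieve_mem _ _ h') a
  refine ⟨V, f, ha, presheafColimit_exists_of_eq k _ _ ?_⟩
  exact (NatTrans.naturality_apply i f.op x).trans
    (Eq.trans hf (NatTrans.naturality_apply i f.op y).symm)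

/-- A filtered union of subsheaves: any two elements of the presheaf colimit live at a common stage,
which injects into `c.pt`. -/
theorem nonempty_isColimit_of_injective [IsFiltered K] {c : Cocone D}
    (hinj : ∀ (k : K) (U : X.Etale), Function.Injective ((c.ι.app k).hom.app (op U)))
    (hsurj : ∀ (U : X.Etale) (x : ToType (c.pt.obj.obj (op U))) (a : U.left),
      ∃ (V : X.Etale) (f : V ⟶ U) (_ : a ∈ Set.range f.left) (k : K)
        (y : ToType ((D.obj k).obj.obj (op V))),
          (c.ι.app k).hom.app (op V) y = c.pt.obj.map f.op x) : Nonempty (IsColimit c) := by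
  let i := colimit.ι (D ⋙ sheafToPresheaf X.smallEtaleTopology A)
  have hi {U : X.Etale} (k : K) (x : ToType ((D.obj k).obj.obj (op U))) :
      (presheafColimitDesc c).app (op U) ((i k).app (op U) x) = (c.ι.app k).hom.app (op U) x := by
    rw [← ι_presheafColimitDesc c]
    exact (ConcreteCategory.comp_apply _ _ _).symm
  have h₁ : Presheaf.IsLocallyInjective X.smallEtaleTopology (presheafColimitDesc c) := ⟨by
    intro U x y h
    convert! X.smallEtaleTopology.top_mem U.unop
    refine (Sieve.id_mem_iff_eq_top (S := Presheaf.equalizerSieve x y)).1 ?_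
    refine congrArg _ ?_
    obtain ⟨k₁, x, rfl⟩ := presheafColimit_exists_rep x
    obtain ⟨k₂, y, rfl⟩ := presheafColimit_exists_rep y
    let k := IsFiltered.max k₁ k₂
    have hw {k' : K} (l : k' ⟶ k) (z : ToType ((D.obj k').obj.obj (op U.unop))) :
        (i k').app U z = (i k).app U ((D.map l).hom.app U z) := by
      have := colimit.w (D ⋙ sheafToPresheaf X.smallEtaleTopology A) l
      exact (congr(($(this).app U) z)).symm.trans (ConcreteCategory.comp_apply _ _ _)
    refine (hw (IsFiltered.leftToMax k₁ k₂) x).trans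
      (Eq.trans ?_ (hw (IsFiltered.rightToMax k₁ k₂) y).symm)
    refine congrArg _ (hinj k U.unop ?_)
    refine (hi _ _).symm.trans (Eq.trans ?_ (hi _ _))
    exact (congrArg _ (hw _ _).symm).trans (h.trans (congrArg _ (hw _ _)))⟩
  have h₂ : Presheaf.IsLocallySurjective X.smallEtaleTopology (presheafColimitDesc c) := ⟨by
    intro U x
    refine (mem_smallEtaleTopology_iff _).2 fun a ↦ ?_
    obtain ⟨V, f, ha, k, y, hy⟩ := hsurj U x a
    exact ⟨V, f, ⟨(i k).app (op V) y, (hi k y).trans hy⟩, ha⟩⟩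
  exact nonempty_isColimit_of_W (X.smallEtaleTopology.W_of_isLocallyBijective _)

end FilteredColimits

section

variable {X : Scheme.{u}} {A : Type (u + 1)} [Category.{u} A] {FA : A → A → Type*}
  {CA : A → Type u} [∀ V W, FunLike (FA V W) (CA V) (CA W)] [ConcreteCategory.{u} A FA]
  {K : Type u} [SmallCategory K] {D : K ⥤ Sheaf X.smallEtaleTopology A}

theorem ι_app_map {c : Cocone D} {k k' : K} (l : k ⟶ k') {U : X.Etale}
    (s : ToType ((D.obj k).obj.obj (op U))) :
    (c.ι.app k').hom.app (op U) ((D.map l).hom.app (op U) s) = (c.ι.app k).hom.app (op U) s := by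
  rw [← c.w l]
  exact (ConcreteCategory.comp_apply _ _ _).symm

end

/-! ### Stability of the two properties under filtered colimits -/

section FilteredColimitsOfClopen

variable {X : Scheme.{u}} {A : Type (u + 1)} [Category.{u} A] {FA : A → A → Type*}
  {CA : A → Type u} [∀ V W, FunLike (FA V W) (CA V) (CA W)] [ConcreteCategory.{u} A FA]
  [PreservesLimits (forget A)] [HasColimits A] [HasLimits A]
  [(forget A).ReflectsIsomorphisms] [PreservesFilteredColimitsOfSize.{u, u} (forget A)]
  {K : Type u} [SmallCategory K] {D : K ⥤ Sheaf X.smallEtaleTopology A} [IsFiltered K]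

theorem isLocallyFiniteEtale_rep_of_isColimit {c : Cocone D} (hc : IsColimit c)
    (h : ∀ k, IsLocallyFiniteEtale ((D.obj k).obj ⋙ forget A)) {U : X.Etale}
    (x : ToType (c.pt.obj.obj (op U))) (a : U.left) :
    ∃ (V : X.Etale) (f : V ⟶ U) (_ : a ∈ Set.range f.left) (Y : FEt X)
      (g : V ⟶ (FEt.toEtale X).obj Y) (k : K)
      (s : ToType ((D.obj k).obj.obj (op ((FEt.toEtale X).obj Y)))),
      c.pt.obj.map g.op ((c.ι.app k).hom.app _ s) = c.pt.obj.map f.op x := by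
  obtain ⟨V, f, ⟨v, rfl⟩, k, y, hy⟩ := exists_rep_of_isColimit hc x a
  obtain ⟨W, g, ⟨w, rfl⟩, Y, h', s, hs⟩ := h k (U := V) y v
  refine ⟨W, g ≫ f, ⟨w, rfl⟩, Y, h', k, s, ?_⟩
  have hs' : (D.obj k).obj.map h'.op s = (D.obj k).obj.map g.op y := hs
  refine (NatTrans.naturality_apply (c.ι.app k).hom h'.op s).symm.trans ?_
  refine Eq.trans (congrArg _ hs') ?_
  refine (NatTrans.naturality_apply (c.ι.app k).hom g.op y).trans ?_
  refine (congrArg (c.pt.obj.map g.op) hy).trans ?_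
  exact (Functor.map_comp_apply c.pt.obj f.op g.op x).symm

theorem isLocallyFiniteEtale_of_isColimit {c : Cocone D} (hc : IsColimit c)
    (h : ∀ k, IsLocallyFiniteEtale ((D.obj k).obj ⋙ forget A)) :
    IsLocallyFiniteEtale (c.pt.obj ⋙ forget A) := by
  intro U x a
  obtain ⟨V, f, hf, Y, g, k, s, hs⟩ := isLocallyFiniteEtale_rep_of_isColimit hc h x a
  exact ⟨V, f, hf, Y, g, _, hs⟩

/-- Over a finite étale `Y`, the equality locus in the colimit is the union of the equality loci at
the later stages `k ⟶ k'`. Each is clopen, so the union is closed; finite étale generation reduces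
arbitrary sections to this case. -/
theorem hasClopenEquality_of_isColimit [Finite (_root_.ConnectedComponents X)] {c : Cocone D}
    (hc : IsColimit c) (h₁ : ∀ k, HasClopenEquality ((D.obj k).obj ⋙ forget A))
    (h₂ : ∀ k, IsLocallyFiniteEtale ((D.obj k).obj ⋙ forget A)) :
    HasClopenEquality (c.pt.obj ⋙ forget A) := by
  have hY (Y : FEt X) (k : K) (s t : ToType ((D.obj k).obj.obj (op ((FEt.toEtale X).obj Y)))) :
      IsClosed (eqLocus (P := c.pt.obj ⋙ forget A) (U := (FEt.toEtale X).obj Y)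
        ((c.ι.app k).hom.app _ s) ((c.ι.app k).hom.app _ t) : Set ((FEt.toEtale X).obj Y).left) := by
    let Z (l : Σ k', k ⟶ k') := eqLocus (P := (D.obj l.1).obj ⋙ forget A)
      (U := (FEt.toEtale X).obj Y) ((D.map l.2).hom.app _ s) ((D.map l.2).hom.app _ t)
    have hZ : IsClosed (⋃ l, (Z l : Set ((FEt.toEtale X).obj Y).left)) :=
      isClosed_iUnion_of_isClopen Y _ fun l ↦ ⟨h₁ l.1 _ _, (Z l).isOpen⟩
    convert hZ using 1
    ext a
    rw [Set.mem_iUnion]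
    constructor
    · rintro ⟨V, f, ⟨v, rfl⟩, h⟩
      have h' : (c.ι.app k).hom.app (op V) ((D.obj k).obj.map f.op s) =
          (c.ι.app k).hom.app (op V) ((D.obj k).obj.map f.op t) :=
        (NatTrans.naturality_apply (c.ι.app k).hom f.op s).trans
          (Eq.trans h (NatTrans.naturality_apply (c.ι.app k).hom f.op t).symm)
      obtain ⟨W, g, ⟨w, rfl⟩, k', l, hl⟩ := exists_eq_of_isColimit hc k _ _ h' v
      refine ⟨⟨k', l⟩, W, g ≫ f, ⟨w, rfl⟩, ?_⟩
      have h₃ (z : ToType ((D.obj k).obj.obj (op ((FEt.toEtale X).obj Y)))) :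
          (D.obj k').obj.map (g ≫ f).op ((D.map l).hom.app _ z) =
            (D.map l).hom.app (op W) ((D.obj k).obj.map g.op ((D.obj k).obj.map f.op z)) := by
        refine (NatTrans.naturality_apply (D.map l).hom (g ≫ f).op z).symm.trans (congrArg _ ?_)
        exact Functor.map_comp_apply (D.obj k).obj f.op g.op z
      exact (h₃ s).trans (hl.trans (h₃ t).symm)
    · rintro ⟨⟨k', l⟩, V, f, hf, h⟩
      refine ⟨V, f, hf, ?_⟩
      have h₃ (z : ToType ((D.obj k).obj.obj (op ((FEt.toEtale X).obj Y)))) :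
          c.pt.obj.map f.op ((c.ι.app k).hom.app _ z) =
            (c.ι.app k').hom.app (op V) ((D.obj k').obj.map f.op ((D.map l).hom.app _ z)) := by
        refine Eq.trans ?_ (NatTrans.naturality_apply (c.ι.app k').hom f.op _).symm
        exact congrArg _ (ι_app_map l z).symm
      exact (h₃ s).trans (Eq.trans (congrArg _ h) (h₃ t).symm)
  intro U x y
  refine isClosed_eqLocus_of_locally _ _ fun a ↦ ?_
  obtain ⟨V, f, ⟨v, rfl⟩, Y₁, g₁, k₁, s₁, hs₁⟩ := isLocallyFiniteEtale_rep_of_isColimit hc h₂ x a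
  obtain ⟨W, g, ⟨w, rfl⟩, Y₂, g₂, k₂, s₂, hs₂⟩ :=
    isLocallyFiniteEtale_rep_of_isColimit hc h₂ (c.pt.obj.map f.op y) v
  obtain ⟨Y, p₁, p₂, q, hq₁, hq₂⟩ := exists_common_finiteEtale (g ≫ g₁) g₂
  let k := IsFiltered.max k₁ k₂
  let t₁ := (D.map (IsFiltered.leftToMax k₁ k₂)).hom.app _
    ((D.obj k₁).obj.map ((FEt.toEtale X).map p₁).op s₁)
  let t₂ := (D.map (IsFiltered.rightToMax k₁ k₂)).hom.app _
    ((D.obj k₂).obj.map ((FEt.toEtale X).map p₂).op s₂)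
  have hx : c.pt.obj.map (g ≫ f).op x = c.pt.obj.map q.op ((c.ι.app k).hom.app _ t₁) := by
    have e₁ : (c.ι.app k).hom.app _ t₁ =
        c.pt.obj.map ((FEt.toEtale X).map p₁).op ((c.ι.app k₁).hom.app _ s₁) :=
      (ι_app_map (U := (FEt.toEtale X).obj Y) (IsFiltered.leftToMax k₁ k₂) _).trans
        (NatTrans.naturality_apply (c.ι.app k₁).hom ((FEt.toEtale X).map p₁).op s₁)
    rw [e₁, ← Functor.map_comp_apply, ← op_comp, hq₁, op_comp, Functor.map_comp_apply, op_comp,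
      Functor.map_comp_apply, hs₁]
  have hy : c.pt.obj.map (g ≫ f).op y = c.pt.obj.map q.op ((c.ι.app k).hom.app _ t₂) := by
    have e₁ : (c.ι.app k).hom.app _ t₂ =
        c.pt.obj.map ((FEt.toEtale X).map p₂).op ((c.ι.app k₂).hom.app _ s₂) :=
      (ι_app_map (U := (FEt.toEtale X).obj Y) (IsFiltered.rightToMax k₁ k₂) _).trans
        (NatTrans.naturality_apply (c.ι.app k₂).hom ((FEt.toEtale X).map p₂).op s₂)
    rw [e₁, ← Functor.map_comp_apply, ← op_comp, hq₂, hs₂, op_comp, Functor.map_comp_apply]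
  refine ⟨W, g ≫ f, ⟨w, rfl⟩, ?_⟩
  have h₃ : eqLocus (P := c.pt.obj ⋙ forget A) ((c.pt.obj ⋙ forget A).map (g ≫ f).op x)
      ((c.pt.obj ⋙ forget A).map (g ≫ f).op y) =
      q.left ⁻¹ᵁ eqLocus (P := c.pt.obj ⋙ forget A) (U := (FEt.toEtale X).obj Y)
        ((c.ι.app k).hom.app _ t₁) ((c.ι.app k).hom.app _ t₂) := by
    rw [← eqLocus_map]
    exact congrArg₂ _ hx hy
  rw [h₃]
  exact (hY Y k t₁ t₂).preimage q.left.continuous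

end FilteredColimitsOfClopen

/-! ### From finitely many exhaustive sections to trivializations -/

section GeneratedSections

variable {X : Scheme.{u}}

theorem HasClopenEquality.of_injective {P Q : X.Etaleᵒᵖ ⥤ Type u} (h : HasClopenEquality Q)
    (i : P ⟶ Q) (hi : ∀ U : X.Etale, Function.Injective (i.app (op U))) : HasClopenEquality P := by
  intro U x y
  convert h (i.app (op U) x) (i.app (op U) y) using 1
  ext a
  refine exists_congr fun V ↦ exists_congr fun f ↦ and_congr_right fun _ ↦ ?_
  rw [← NatTrans.naturality_apply, ← NatTrans.naturality_apply, (hi V).eq_iff]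

/-- The points with the same coincidences among the `y e` as `a` form an open set, being a finite
intersection of clopens. There two members agree everywhere or nowhere, and indexing by the range
removes repetitions. -/
theorem IsLocallyExhaustive.exists_isTrivialization {P : X.Etaleᵒᵖ ⥤ Type u}
    (hP : Presieve.IsSeparated X.smallEtaleTopology P) (h : HasClopenEquality P) {U : X.Etale}
    {E : Type u} [Finite E] {y : E → P.obj (op U)} (hy : IsLocallyExhaustive y) (a : U.left) :
    ∃ (V : X.Etale) (f : V ⟶ U) (_ : a ∈ Set.range f.left),
      IsTrivialization (Subtype.val : Set.range (fun e ↦ P.map f.op (y e)) → P.obj (op V)) := by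
  let O : U.left.Opens :=
    { carrier := ⋂ p : E × E, {b | b ∈ eqLocus (y p.1) (y p.2) ↔ a ∈ eqLocus (y p.1) (y p.2)}
      is_open' := isOpen_iInter_of_finite fun p ↦ by
        by_cases hp : a ∈ eqLocus (y p.1) (y p.2)
        · simpa only [hp, iff_true] using! (eqLocus (y p.1) (y p.2)).isOpen
        · simpa only [hp, iff_false] using! (h (y p.1) (y p.2)).isOpen_compl }
  have hO {b : U.left} (hb : b ∈ O) (e e' : E) :
      b ∈ eqLocus (y e) (y e') ↔ a ∈ eqLocus (y e) (y e') := Set.mem_iInter.1 hb (e, e')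
  have hmem (b : (openSub U O).left) : (openSubι U O).left b ∈ O :=
    (range_openSubι U O).le ⟨b, rfl⟩
  refine ⟨openSub U O, openSubι U O, (range_openSubι U O).ge (Set.mem_iInter.2 fun _ ↦ Iff.rfl),
    fun W w x b ↦ ?_, ?_⟩
  · obtain ⟨W', f, hf, e, he⟩ := hy (w ≫ openSubι U O) x b
    refine ⟨W', f, hf, ⟨_, e, rfl⟩, Eq.trans ?_ he⟩
    rw [← Category.assoc, op_comp (f := f ≫ w), Functor.map_comp_apply]
  · rintro W w ⟨b⟩ ⟨_, e, rfl⟩ ⟨_, e', rfl⟩ hee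
    refine Subtype.ext ((map_eq_iff hP _ _ _).2 fun c ↦ (hO (hmem c) e e').2 ?_)
    refine (hO (hmem (w.left b)) e e').1 ⟨W, w ≫ openSubι U O, ⟨b, rfl⟩, ?_⟩
    rw [op_comp, Functor.map_comp_apply, Functor.map_comp_apply]
    exact hee

/-- Étale locally, there are only finitely many pullbacks of a finite family of sections over finite
étale `X`-schemes. -/
theorem exists_finite_generators (P : X.Etaleᵒᵖ ⥤ Type u) {ι : Type u} (Y : ι → FEt X)
    (s : ∀ i, P.obj (op ((FEt.toEtale X).obj (Y i)))) (T : Finset ι) (a : X) :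
    ∃ (U : X.Etale) (_ : a ∈ Set.range U.hom) (E : Type u) (_ : Finite E) (y : E → P.obj (op U)),
      (∀ e, ∃ i ∈ T, ∃ h : U ⟶ (FEt.toEtale X).obj (Y i), P.map h.op (s i) = y e) ∧
      ∀ ⦃W : X.Etale⦄ (w : W ⟶ U), ∀ i ∈ T, ∀ (h : W ⟶ (FEt.toEtale X).obj (Y i)) (b : W.left),
        ∃ (W' : X.Etale) (f : W' ⟶ W), b ∈ Set.range f.left ∧
          ∃ e, P.map (f ≫ w).op (y e) = P.map f.op (P.map h.op (s i)) := by
  classical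
  induction T using Finset.induction_on with
  | empty => exact ⟨.mk (𝟙 X), ⟨a, rfl⟩, PEmpty, inferInstance, nofun, nofun, by simp⟩
  | insert i T _ ih =>
    obtain ⟨U₁, ⟨b₁, h₁⟩, E₁, _, y, hy, hy'⟩ := ih
    -- Over a common étale refinement of `U₁` and `U₂`, the pullbacks of `s i` along the sheets of
    -- `Y i` are added to the family already found for `T`.
    obtain ⟨U₂, ⟨b₂, h₂⟩, E₂, _, σ, hσ⟩ := exists_splitting (Y i) a
    obtain ⟨U, p, q, ⟨b, rfl⟩⟩ := exists_common_etale b₁ b₂ (h₁.trans h₂.symm)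
    refine ⟨U, ⟨b, ?_⟩, E₁ ⊕ E₂, inferInstance, Sum.elim (fun e ↦ P.map p.op (y e))
      (fun e ↦ P.map (q ≫ σ e).op (s i)), ?_, ?_⟩
    · rw [← h₁, ← MorphismProperty.Over.w p]
      rfl
    · rintro (e | e)
      · obtain ⟨j, hj, h, he⟩ := hy e
        refine ⟨j, Finset.mem_insert_of_mem hj, p ≫ h, ?_⟩
        rw [op_comp, Functor.map_comp_apply, he]
        rfl
      · exact ⟨i, Finset.mem_insert_self _ _, _, rfl⟩
    · intro W w j hj h c
      rcases Finset.mem_insert.1 hj with rfl | hj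
      · obtain ⟨W', f, hf, e, he⟩ := hσ (w ≫ q) h c
        refine ⟨W', f, hf, Sum.inr e, ?_⟩
        have he' : (f ≫ w ≫ q) ≫ σ e = f ≫ h := he
        change P.map (f ≫ w).op (P.map (q ≫ σ e).op (s j)) = _
        rw [← Functor.map_comp_apply, ← Functor.map_comp_apply, ← op_comp, ← op_comp, ← he']
        simp only [Category.assoc]
      · obtain ⟨W', f, hf, e, he⟩ := hy' (w ≫ p) j hj h c
        refine ⟨W', f, hf, Sum.inl e, Eq.trans ?_ he⟩
        change P.map (f ≫ w).op (P.map p.op (y e)) = _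
        rw [← Functor.map_comp_apply, ← op_comp, Category.assoc]

end GeneratedSections

/-! ### Directed unions of subsheaves -/

section DirectedUnions

variable {X : Scheme.{u}} {A : Type (u + 1)} [Category.{u} A] {FA : A → A → Type*}
  {CA : A → Type u} [∀ V W, FunLike (FA V W) (CA V) (CA W)] [ConcreteCategory.{u} A FA]
  [PreservesLimits (forget A)] [HasColimits A] [HasLimits A]
  [(forget A).ReflectsIsomorphisms] [PreservesFilteredColimitsOfSize.{u, u} (forget A)]

theorem isLocallyConstantWithValues_of_isTrivialization {F : Sheaf X.smallEtaleTopology A}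
    (Q : ObjectProperty A)
    (h : ∀ a : X, ∃ (V : X.Etale) (_ : a ∈ Set.range V.hom) (E : A) (_ : Q E)
      (y : E ⟶ F.obj.obj (op V)),
        IsTrivialization (P := F.obj ⋙ forget A) (V := V) (E := ToType E) fun e ↦ y e) :
    IsLocallyConstantWithValues Q F := by
  choose V hV E hE y hy using h
  refine ⟨X, fun a ↦ (V a).left, fun a ↦ (V a).hom, fun a ↦ (V a).prop,
    Set.eq_univ_of_forall fun a ↦ Set.mem_iUnion.2 ⟨a, hV a⟩, fun a ↦ ⟨E a, hE a, ?_⟩⟩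
  have : Etale (V a).hom := (V a).prop
  exact nonempty_iso_constantSheaf (V a).hom (y a) (hy a)

theorem ind_of_directed {K : Type u} [Preorder K] [IsDirected K (· ≤ ·)] [Nonempty K]
    {Q : ObjectProperty (Sheaf X.smallEtaleTopology A)} {F : Sheaf X.smallEtaleTopology A}
    (G : K → Sheaf X.smallEtaleTopology A) (hG : ∀ k, Q (G k)) (i : ∀ k, G k ⟶ F)
    (hi : ∀ (k : K) (U : X.Etale), Function.Injective ((i k).hom.app (op U)))
    (hle : ∀ k k', k ≤ k' → ∃ g : G k ⟶ G k', g ≫ i k' = i k)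
    (hsurj : ∀ (U : X.Etale) (x : ToType (F.obj.obj (op U))) (a : U.left),
      ∃ (V : X.Etale) (f : V ⟶ U) (_ : a ∈ Set.range f.left) (k : K)
        (y : ToType ((G k).obj.obj (op V))), (i k).hom.app (op V) y = F.obj.map f.op x) :
    ObjectProperty.ind.{u} Q F := by
  have hi' (k : K) {Z : Sheaf X.smallEtaleTopology A} {g g' : Z ⟶ G k} (h : g ≫ i k = g' ≫ i k) :
      g = g' := by
    refine Sheaf.hom_ext (NatTrans.ext (funext fun U ↦ ConcreteCategory.hom_ext _ _ fun z ↦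
      hi k U.unop ?_))
    have e := congr(($h).hom.app U)
    exact (ConcreteCategory.comp_apply _ _ _).symm.trans
      ((ConcreteCategory.congr_hom e z).trans (ConcreteCategory.comp_apply _ _ _))
  choose g hg using hle
  let D : K ⥤ Sheaf X.smallEtaleTopology A :=
    { obj := G
      map l := g _ _ (leOfHom l)
      map_id k := hi' k (by rw [hg, Category.id_comp])
      map_comp l l' := hi' _ (by rw [hg, Category.assoc, hg, hg]) }
  let c : Cocone D := ⟨F, { app := i, naturality k k' l := (hg _ _ _).trans (Category.comp_id _).symm }⟩
  obtain ⟨hc⟩ := nonempty_isColimit_of_injective (c := c) hi hsurj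
  exact ⟨K, inferInstance, inferInstance, ⟨D, c.ι, hc⟩, hG⟩

end DirectedUnions

/-! ### Reduction to a small family of finite étale schemes -/

section SmallModel

variable {X : Scheme.{u}}

/-- Restricting to a small model makes the set of all generating sections `u`-small, as is needed to
index a small filtered system. -/
theorem IsLocallyFiniteEtale.exists_smallModel {P : X.Etaleᵒᵖ ⥤ Type u}
    (h : IsLocallyFiniteEtale P) {U : X.Etale} (x : P.obj (op U)) (a : U.left) :
    ∃ (V : X.Etale) (f : V ⟶ U) (_ : a ∈ Set.range f.left) (Y : SmallModel.{u} (FEt X))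
      (h : V ⟶ (FEt.toEtale X).obj ((equivSmallModel.{u} (FEt X)).inverse.obj Y))
      (s : P.obj (op ((FEt.toEtale X).obj ((equivSmallModel.{u} (FEt X)).inverse.obj Y)))),
      P.map h.op s = P.map f.op x := by
  obtain ⟨V, f, hf, Y, h, s, hs⟩ := h x a
  let e := equivSmallModel.{u} (FEt X)
  let p : Y ⟶ e.inverse.obj (e.functor.obj Y) := e.unitIso.hom.app Y
  let q : e.inverse.obj (e.functor.obj Y) ⟶ Y := e.unitIso.inv.app Y
  have hpq : p ≫ q = 𝟙 Y := e.unitIso.hom_inv_id_app Y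
  refine ⟨V, f, hf, e.functor.obj Y, h ≫ (FEt.toEtale X).map p, P.map ((FEt.toEtale X).map q).op s,
    Eq.trans ?_ hs⟩
  rw [← Functor.map_comp_apply, ← op_comp, Category.assoc, ← Functor.map_comp, hpq,
    CategoryTheory.Functor.map_id, Category.comp_id]

end SmallModel

/-! ### Subsheaves of sets generated by finitely many sections -/

section SetSubsheaf

variable {X : Scheme.{u}} (F : Sheaf X.smallEtaleTopology (Type u)) {ι : Type u} (Y : ι → FEt X)
  (s : ∀ i, F.obj.obj (op ((FEt.toEtale X).obj (Y i)))) (T : Finset ι)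

/-- The sections which are pullbacks of one of the given sections. -/
def pullbackSections : Subfunctor F.obj where
  obj U := {x | ∃ i ∈ T, ∃ h : U.unop ⟶ (FEt.toEtale X).obj (Y i), F.obj.map h.op (s i) = x}
  map {U V} f := by
    rintro _ ⟨i, hi, h, rfl⟩
    exact ⟨i, hi, f.unop ≫ h, Functor.map_comp_apply F.obj h.op f (s i)⟩

theorem isSheaf_obj : Presieve.IsSheaf X.smallEtaleTopology F.obj :=
  (isSheaf_iff_isSheaf_of_type _ _).1 F.property

/-- The subsheaf generated by finitely many sections over finite étale schemes. -/
def generatedSubsheaf : Sheaf X.smallEtaleTopology (Type u) :=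
  ⟨((pullbackSections F Y s T).sheafify X.smallEtaleTopology).toFunctor,
    (isSheaf_iff_isSheaf_of_type _ _).2 (Subfunctor.sheafify_isSheaf _ (isSheaf_obj F))⟩

def generatedSubsheafι : generatedSubsheaf F Y s T ⟶ F :=
  ⟨((pullbackSections F Y s T).sheafify X.smallEtaleTopology).ι⟩

theorem generatedSubsheafι_injective (U : X.Etale) :
    Function.Injective ((generatedSubsheafι F Y s T).hom.app (op U)) :=
  Subtype.val_injective

theorem exists_generatedSubsheaf_hom {T T' : Finset ι} (h : T ≤ T') :
    ∃ g : generatedSubsheaf F Y s T ⟶ generatedSubsheaf F Y s T',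
      g ≫ generatedSubsheafι F Y s T' = generatedSubsheafι F Y s T := by
  have hle : pullbackSections F Y s T ≤ pullbackSections F Y s T' := by
    rintro U _ ⟨i, hi, l⟩
    exact ⟨i, h hi, l⟩
  have hle' : (pullbackSections F Y s T).sheafify X.smallEtaleTopology ≤
      (pullbackSections F Y s T').sheafify X.smallEtaleTopology := fun U x hx ↦
    X.smallEtaleTopology.superset_covering (fun V f hf ↦ hle _ hf) hx
  exact ⟨⟨Subfunctor.homOfLe hle'⟩, rfl⟩

/-- Étale locally the generators have only finitely many pullbacks, which exhaust the subsheaf;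
clopen equality, inherited from `F`, turns them into a trivialization. -/
theorem isLCC_generatedSubsheaf (h : HasClopenEquality (F.obj ⋙ forget (Type u))) :
    IsLCC X (generatedSubsheaf F Y s T) := by
  refine isLocallyConstantWithValues_of_isTrivialization _ fun a ↦ ?_
  obtain ⟨U, ⟨b, rfl⟩, E, _, y, hy, hy'⟩ := exists_finite_generators F.obj Y s T a
  let P := (generatedSubsheaf F Y s T).obj ⋙ forget (Type u)
  let i : P ⟶ F.obj ⋙ forget (Type u) := Functor.whiskerRight (generatedSubsheafι F Y s T).hom _
  have hP : HasClopenEquality P := h.of_injective i (generatedSubsheafι_injective F Y s T)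
  let z (e : E) : P.obj (op U) := ⟨y e, Subfunctor.le_sheafify _ _ _ (hy e)⟩
  have hz : IsLocallyExhaustive z := by
    intro W w x c
    obtain ⟨W₁, f, ⟨j, hj, l, hl⟩, c, rfl⟩ := (mem_smallEtaleTopology_iff _).1 x.2 c
    obtain ⟨W₂, g, ⟨c, rfl⟩, e, he⟩ := hy' (f ≫ w) j hj l c
    refine ⟨W₂, g ≫ f, ⟨c, rfl⟩, e, Subtype.ext ?_⟩
    have hl' : F.obj.map l.op (s j) = F.obj.map f.op x.1 := hl
    change F.obj.map ((g ≫ f) ≫ w).op (y e) = F.obj.map (g ≫ f).op x.1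
    rw [Category.assoc, he, hl', op_comp, Functor.map_comp_apply]
  obtain ⟨V, f, ⟨v, rfl⟩, ht⟩ := hz.exists_isTrivialization
    (isSeparated_forget (generatedSubsheaf F Y s T)) hP b
  refine ⟨V, ⟨v, ?_⟩, Set.range (fun e ↦ P.map f.op (z e)), ?_, ↾Subtype.val, ht⟩
  · rw [← MorphismProperty.Over.w f]
    rfl
  · exact Set.finite_range _

theorem ind_isLCC (h₁ : HasClopenEquality (F.obj ⋙ forget (Type u)))
    (h₂ : IsLocallyFiniteEtale (F.obj ⋙ forget (Type u))) : ObjectProperty.ind.{u} (IsLCC X) F := by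
  let e := equivSmallModel.{u} (FEt X)
  let ι := Σ Y : SmallModel.{u} (FEt X), F.obj.obj (op ((FEt.toEtale X).obj (e.inverse.obj Y)))
  refine ind_of_directed (K := Finset ι)
    (fun T ↦ generatedSubsheaf F (fun i : ι ↦ e.inverse.obj i.1) (fun i ↦ i.2) T)
    (fun T ↦ isLCC_generatedSubsheaf _ _ _ _ h₁) (fun T ↦ generatedSubsheafι _ _ _ _)
    (fun T ↦ generatedSubsheafι_injective _ _ _ _)
    (fun T T' ↦ exists_generatedSubsheaf_hom _ _ _) fun U x a ↦ ?_
  obtain ⟨V, f, hf, Y, h, s, hs⟩ := h₂.exists_smallModel x a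
  let i : ι := ⟨Y, s⟩
  exact ⟨V, f, hf, {i}, ⟨F.obj.map f.op x, Subfunctor.le_sheafify _ _ _
    ⟨i, Finset.mem_singleton_self i, h, hs⟩⟩, rfl⟩

end SetSubsheaf

/-! ### Sheaf condition on underlying sets -/

section

variable {X : Scheme.{u}} {A : Type (u + 1)} [Category.{u} A] {FA : A → A → Type*}
  {CA : A → Type u} [∀ V W, FunLike (FA V W) (CA V) (CA W)] [ConcreteCategory.{u} A FA]
  [PreservesLimits (forget A)] [HasColimits A] [HasLimits A]
  [(forget A).ReflectsIsomorphisms] [PreservesFilteredColimitsOfSize.{u, u} (forget A)]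

/-- On underlying sets, `P ⟶ P^#` is a locally bijective map between sheaves, hence an isomorphism;
`forget A` reflects this. -/
theorem isSheaf_of_isSheaf_forget [X.smallEtaleTopology.HasSheafCompose (forget A)]
    {P : X.Etaleᵒᵖ ⥤ A}
    (hP : Presheaf.IsSheaf X.smallEtaleTopology (P ⋙ forget A)) :
    Presheaf.IsSheaf X.smallEtaleTopology P := by
  have hW : X.smallEtaleTopology.W (toSheafify X.smallEtaleTopology P) :=
    X.smallEtaleTopology.W_toSheafify P
  have := hW.isLocallyInjective
  have := hW.isLocallySurjective
  let F : Sheaf X.smallEtaleTopology (Type u) := ⟨P ⋙ forget A, hP⟩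
  let G := (sheafCompose X.smallEtaleTopology (forget A)).obj ((presheafToSheaf X.smallEtaleTopology A).obj P)
  let φ : F ⟶ G := ⟨Functor.whiskerRight (toSheafify X.smallEtaleTopology P) (forget A)⟩
  have h₁ : Sheaf.IsLocallyInjective φ :=
    inferInstanceAs (Presheaf.IsLocallyInjective X.smallEtaleTopology
      (Functor.whiskerRight (toSheafify X.smallEtaleTopology P) (forget A)))
  have h₂ : Sheaf.IsLocallySurjective φ := inferInstanceAs
    (Presheaf.IsLocallySurjective X.smallEtaleTopology
      (Functor.whiskerRight (toSheafify X.smallEtaleTopology P) (forget A)))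
  have : IsIso φ := (Sheaf.isLocallyBijective_iff_isIso φ).1 ⟨h₁, h₂⟩
  have : IsIso ((sheafToPresheaf X.smallEtaleTopology (Type u)).map φ) := inferInstance
  have (U : X.Etaleᵒᵖ) : IsIso ((toSheafify X.smallEtaleTopology P).app U) := by
    have : IsIso ((forget A).map ((toSheafify X.smallEtaleTopology P).app U)) :=
      inferInstanceAs (IsIso (((sheafToPresheaf X.smallEtaleTopology (Type u)).map φ).app U))
    exact isIso_of_reflects_iso _ (forget A)
  have : IsIso (toSheafify X.smallEtaleTopology P) := NatIso.isIso_of_isIso_app _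
  exact Presheaf.isSheaf_of_iso_iff (asIso (toSheafify X.smallEtaleTopology P)) |>.2 ((presheafToSheaf X.smallEtaleTopology A).obj P).property


end

/-! ### Torsion sections over quasi-compact schemes -/

section Torsion

variable {X : Scheme.{u}}

/-- A torsion section over a quasi-compact étale scheme is killed by a positive integer. -/
theorem IsTorsionSheaf.exists_nsmul_eq_zero_of_compactSpace {F : Sheaf X.smallEtaleTopology Ab.{u}}
    (hF : IsTorsionSheaf X.smallEtaleTopology F) {U : X.Etale} [CompactSpace U.left]
    (s : F.obj.obj (op U)) : ∃ n : ℕ, 0 < n ∧ n • s = 0 := by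
  choose V f hf n hn hs using hF.exists_nsmul_eq_zero s
  have hopen (a : U.left) : IsOpen (Set.range (f a).left) := by
    have h : Etale (V a).hom := (V a).prop
    have : Etale (f a).left := inferInstance
    exact (f a).left.isOpenMap.isOpen_range
  obtain ⟨t, ht⟩ := isCompact_univ.elim_finite_subcover (fun a ↦ Set.range (f a).left) hopen
    fun a _ ↦ Set.mem_iUnion.2 ⟨a, hf a⟩
  -- The product of the local annihilators over a finite subcover.
  refine ⟨∏ a ∈ t, n a, Finset.prod_pos fun a _ ↦ hn a, ?_⟩
  refine eq_of_eqLocus (P := F.obj ⋙ forget Ab.{u}) (isSeparated_forget F) (U := U) fun v ↦ ?_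
  obtain ⟨a, ha, hv⟩ := Set.mem_iUnion₂.1 (ht (Set.mem_univ v))
  refine ⟨V a, f a, hv, ?_⟩
  change F.obj.map (f a).op _ = F.obj.map (f a).op 0
  obtain ⟨m, hm⟩ := Finset.dvd_prod_of_mem n ha
  rw [map_nsmul, hm, mul_comm, mul_smul, hs, smul_zero, map_zero]

instance [CompactSpace X] (Y : FEt X) : CompactSpace ((FEt.toEtale X).obj Y).left := by
  let f : Y.left ⟶ X := Y.hom
  have : IsFinite f := Y.prop.1
  have : IsAffineHom f := inferInstance
  have : QuasiCompact f := inferInstance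
  have : CompactSpace Y.left := QuasiCompact.compactSpace_of_compactSpace f
  exact this

end Torsion

/-! ### Presheaves of subgroups -/

section SubgroupPresheaf

variable {C : Type*} [Category* C] (F : Cᵒᵖ ⥤ Ab.{u}) (S : ∀ U, AddSubgroup (F.obj U))
  (hS : ∀ ⦃U V : Cᵒᵖ⦄ (f : U ⟶ V) (x : F.obj U), x ∈ S U → F.map f x ∈ S V)

/-- A family of subgroups, stable under restriction, as a presheaf of abelian groups. -/
def subgroupPresheaf : Cᵒᵖ ⥤ Ab.{u} where
  obj U := .of (S U)
  map f := AddCommGrpCat.ofHom (((F.map f).hom.comp (AddSubgroup.subtype _)).codRestrict _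
    fun x ↦ hS f _ x.2)
  map_id U := AddCommGrpCat.hom_ext (AddMonoidHom.ext fun x ↦
    Subtype.ext (Functor.map_id_apply F U x.1))
  map_comp f g := AddCommGrpCat.hom_ext (AddMonoidHom.ext fun x ↦
    Subtype.ext (Functor.map_comp_apply F f g x.1))

def subgroupPresheafι : subgroupPresheaf F S hS ⟶ F where
  app U := AddCommGrpCat.ofHom (AddSubgroup.subtype (S U))
  naturality _ _ _ := AddCommGrpCat.hom_ext (AddMonoidHom.ext fun _ ↦ rfl)

theorem exists_subgroupPresheaf_hom {S S' : ∀ U, AddSubgroup (F.obj U)}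
    (hS : ∀ ⦃U V : Cᵒᵖ⦄ (f : U ⟶ V) (x : F.obj U), x ∈ S U → F.map f x ∈ S V)
    (hS' : ∀ ⦃U V : Cᵒᵖ⦄ (f : U ⟶ V) (x : F.obj U), x ∈ S' U → F.map f x ∈ S' V)
    (h : ∀ U, S U ≤ S' U) : ∃ g : subgroupPresheaf F S hS ⟶ subgroupPresheaf F S' hS',
      g ≫ subgroupPresheafι F S' hS' = subgroupPresheafι F S hS :=
  ⟨{ app U := AddCommGrpCat.ofHom (AddSubgroup.inclusion (h U))
     naturality _ _ _ := AddCommGrpCat.hom_ext (AddMonoidHom.ext fun _ ↦ rfl) },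
    NatTrans.ext (funext fun _ ↦ AddCommGrpCat.hom_ext (AddMonoidHom.ext fun _ ↦ rfl))⟩

end SubgroupPresheaf

/-! ### Abelian subsheaves generated by finitely many sections -/

section AbelianSubsheaf

variable {X : Scheme.{u}} (F : Sheaf X.smallEtaleTopology Ab.{u}) {ι : Type u} (Y : ι → FEt X)
  (s : ∀ i, F.obj.obj (op ((FEt.toEtale X).obj (Y i)))) (T : Finset ι)

/-- The subgroup generated by the pullbacks of the given sections. -/
def pullbackSubgroup (U : X.Etale) : AddSubgroup (F.obj.obj (op U)) :=
  AddSubgroup.closure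
    {x | ∃ i ∈ T, ∃ h : U ⟶ (FEt.toEtale X).obj (Y i), F.obj.map h.op (s i) = x}

theorem map_mem_pullbackSubgroup {U V : X.Etale} (f : V ⟶ U) {x : F.obj.obj (op U)}
    (hx : x ∈ pullbackSubgroup F Y s T U) : F.obj.map f.op x ∈ pullbackSubgroup F Y s T V := by
  have : pullbackSubgroup F Y s T U ≤
      (pullbackSubgroup F Y s T V).comap (F.obj.map f.op).hom := by
    refine (AddSubgroup.closure_le _).2 ?_
    rintro _ ⟨i, hi, h, rfl⟩
    refine AddSubgroup.subset_closure ⟨i, hi, f ≫ h, ?_⟩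
    exact Functor.map_comp_apply F.obj h.op f.op (s i)
  exact this hx

/-- The sections which are sums of pullbacks of the given sections. -/
def pullbackSums : Subfunctor (F.obj ⋙ forget Ab.{u}) where
  obj U := {x | x ∈ pullbackSubgroup F Y s T U.unop}
  map f _ hx := map_mem_pullbackSubgroup F Y s T f.unop hx

/-- The subgroup of sections which locally are sums of pullbacks of the given sections. -/
def localSubgroup (U : X.Etaleᵒᵖ) : AddSubgroup (F.obj.obj U) where
  carrier := ((pullbackSums F Y s T).sheafify X.smallEtaleTopology).obj U
  zero_mem' := X.smallEtaleTopology.superset_covering (S := ⊤) (fun V f _ ↦ by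
    change F.obj.map f.op 0 ∈ _
    rw [map_zero]
    exact zero_mem (pullbackSubgroup F Y s T V)) (X.smallEtaleTopology.top_mem _)
  add_mem' {x y} hx hy := X.smallEtaleTopology.superset_covering (fun V f hf ↦ by
    change F.obj.map f.op (x + y) ∈ _
    rw [map_add]
    exact AddSubgroup.add_mem (pullbackSubgroup F Y s T V) hf.1 hf.2)
      (X.smallEtaleTopology.intersection_covering hx hy)
  neg_mem' {x} hx := X.smallEtaleTopology.superset_covering (fun V f hf ↦ by
    change F.obj.map f.op (-x) ∈ _
    rw [map_neg]
    exact AddSubgroup.neg_mem (pullbackSubgroup F Y s T V) hf) hx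

theorem map_mem_localSubgroup {U V : X.Etaleᵒᵖ} (f : U ⟶ V) {x : F.obj.obj U}
    (hx : x ∈ localSubgroup F Y s T U) : F.obj.map f x ∈ localSubgroup F Y s T V :=
  ((pullbackSums F Y s T).sheafify X.smallEtaleTopology).map f hx

theorem isSheaf_localSubgroup : Presheaf.IsSheaf X.smallEtaleTopology
    (subgroupPresheaf F.obj (localSubgroup F Y s T) fun _ _ f _ hx ↦
      map_mem_localSubgroup F Y s T f hx) := by
  let e : subgroupPresheaf F.obj (localSubgroup F Y s T) (fun _ _ f _ hx ↦
      map_mem_localSubgroup F Y s T f hx) ⋙ forget Ab.{u} ≅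
        ((pullbackSums F Y s T).sheafify X.smallEtaleTopology).toFunctor :=
    NatIso.ofComponents (fun U ↦ Equiv.toIso
      { toFun x := ⟨x.1, x.2⟩
        invFun x := ⟨x.1, x.2⟩ }) fun _ ↦ rfl
  exact isSheaf_of_isSheaf_forget <| (Presheaf.isSheaf_of_iso_iff e).2 <|
    (isSheaf_iff_isSheaf_of_type _ _).2
      (Subfunctor.sheafify_isSheaf (pullbackSums F Y s T) (isSheaf_forget F))

/-- The abelian subsheaf generated by finitely many sections over finite étale schemes. -/
def generatedAbSubsheaf : Sheaf X.smallEtaleTopology Ab.{u} :=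
  ⟨_, isSheaf_localSubgroup F Y s T⟩

def generatedAbSubsheafι : generatedAbSubsheaf F Y s T ⟶ F := 
  ⟨subgroupPresheafι F.obj (localSubgroup F Y s T) fun _ _ f _ hx ↦
    map_mem_localSubgroup F Y s T f hx⟩

theorem generatedAbSubsheafι_injective (U : X.Etale) :
    Function.Injective ((generatedAbSubsheafι F Y s T).hom.app (op U)) :=
  Subtype.val_injective

theorem localSubgroup_mono {T T' : Finset ι} (h : T ≤ T') (U : X.Etaleᵒᵖ) :
    localSubgroup F Y s T U ≤ localSubgroup F Y s T' U := by
  have hle : pullbackSums F Y s T ≤ pullbackSums F Y s T' := fun U ↦ by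
    refine AddSubgroup.closure_mono ?_
    rintro _ ⟨i, hi, l⟩
    exact ⟨i, h hi, l⟩
  intro x (hx : (pullbackSums F Y s T).sieveOfSection x ∈ X.smallEtaleTopology U.unop)
  exact X.smallEtaleTopology.superset_covering (fun V f hf ↦ hle _ hf) hx

theorem exists_generatedAbSubsheaf_hom {T T' : Finset ι} (h : T ≤ T') :
    ∃ g : generatedAbSubsheaf F Y s T ⟶ generatedAbSubsheaf F Y s T',
      g ≫ generatedAbSubsheafι F Y s T' = generatedAbSubsheafι F Y s T := by
  obtain ⟨g, hg⟩ := exists_subgroupPresheaf_hom F.obj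
    (fun _ _ f _ hx ↦ map_mem_localSubgroup F Y s T f hx)
    (fun _ _ f _ hx ↦ map_mem_localSubgroup F Y s T' f hx) (localSubgroup_mono F Y s h)
  exact ⟨⟨g⟩, Sheaf.hom_ext hg⟩

theorem isTorsionSheaf_generatedAbSubsheaf (hF : IsTorsionSheaf X.smallEtaleTopology F) :
    IsTorsionSheaf X.smallEtaleTopology (generatedAbSubsheaf F Y s T) := by
  intro U x
  obtain ⟨S, hS, h⟩ := hF U x.1
  refine ⟨S, hS, fun V f hf ↦ ?_⟩
  obtain ⟨n, hn, e⟩ := h f hf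
  exact ⟨n, hn, Subtype.ext e⟩

/-- Étale locally the subsheaf is exhausted by the subgroup `H` generated by finitely many sections.
Each generator is killed by one integer because the `Y i` are quasi-compact, so `H` is finite and
clopen equality applies as for sets. -/
theorem isLCCAb_generatedAbSubsheaf [CompactSpace X] (hF : IsTorsionSheaf X.smallEtaleTopology F)
    (h : HasClopenEquality (F.obj ⋙ forget Ab.{u})) :
    IsLCCAb X (generatedAbSubsheaf F Y s T) := by
  refine isLocallyConstantWithValues_of_isTrivialization _ fun a ↦ ?_
  obtain ⟨U, ⟨b, rfl⟩, E, _, y, hy, hy'⟩ :=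
    exists_finite_generators (F.obj ⋙ forget Ab.{u}) Y s T a
  let G := generatedAbSubsheaf F Y s T
  let i : G.obj ⋙ forget Ab.{u} ⟶ F.obj ⋙ forget Ab.{u} :=
    Functor.whiskerRight (generatedAbSubsheafι F Y s T).hom _
  have hG : HasClopenEquality (G.obj ⋙ forget Ab.{u}) :=
    h.of_injective i (generatedAbSubsheafι_injective F Y s T)
  let y' : E → F.obj.obj (op U) := y
  let H : AddSubgroup (F.obj.obj (op U)) := AddSubgroup.closure (Set.range y')
  have hH : H ≤ pullbackSubgroup F Y s T U := by
    refine AddSubgroup.closure_mono ?_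
    rintro _ ⟨e, rfl⟩
    exact hy e
  have hHG : H ≤ localSubgroup F Y s T (op U) := hH.trans
    fun x hx ↦ Subfunctor.le_sheafify X.smallEtaleTopology (pullbackSums F Y s T) _ hx
  have : Finite H := by
    have : AddGroup.FG H := (AddGroup.fg_iff_addSubgroup_fg H).2
      ((AddSubgroup.fg_iff _).2 ⟨_, rfl, Set.finite_range y'⟩)
    have ht : H ≤ AddCommGroup.torsion (F.obj.obj (op U)) := by
      refine (AddSubgroup.closure_le _).2 ?_
      rintro _ ⟨e, rfl⟩
      obtain ⟨i, hi, l, hl⟩ := hy e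
      obtain ⟨n, hn, hs⟩ := hF.exists_nsmul_eq_zero_of_compactSpace (s i)
      refine isOfFinAddOrder_iff_nsmul_eq_zero.2 ⟨n, hn, ?_⟩
      have hl' : F.obj.map l.op (s i) = y' e := hl
      rw [← hl', ← map_nsmul, hs, map_zero]
    refine AddCommGroup.finite_of_fg_isAddTorsion H fun x ↦ ?_
    exact (AddSubmonoid.isOfFinAddOrder_coe (H := H.toAddSubmonoid)).1 (ht x.2)
  let z : H →+ G.obj.obj (op U) := AddSubgroup.inclusion hHG
  have hz : IsLocallyExhaustive (P := G.obj ⋙ forget Ab.{u}) (E := H) fun e ↦ z e := by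
    intro W w x c
    -- Induction over the generated subgroup: a sum is matched over a fibre product of the
    -- refinements for its two terms.
    have key {W₁ : X.Etale} (f : W₁ ⟶ W) (t : F.obj.obj (op W₁))
        (ht : t ∈ pullbackSubgroup F Y s T W₁) : ∀ c : W₁.left, ∃ (W₂ : X.Etale) (g : W₂ ⟶ W₁),
          c ∈ Set.range g.left ∧ ∃ e : H, F.obj.map (g ≫ f ≫ w).op e.1 = F.obj.map g.op t := by
      induction ht using AddSubgroup.closure_induction with
      | mem t ht =>
        obtain ⟨j, hj, l, rfl⟩ := ht
        intro c
        obtain ⟨W₂, g, hg, e, he⟩ := hy' (f ≫ w) j hj l c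
        exact ⟨W₂, g, hg, ⟨_, AddSubgroup.subset_closure ⟨e, rfl⟩⟩, he⟩
      | zero =>
        exact fun c ↦ ⟨W₁, 𝟙 _, ⟨c, rfl⟩, 0, by
          rw [map_zero]; exact map_zero _⟩
      | add t₁ t₂ _ _ ih₁ ih₂ =>
        intro c
        obtain ⟨V, g, ⟨c, rfl⟩, e₁, h₁⟩ := ih₁ c
        obtain ⟨V', g', ⟨c', hc'⟩, e₂, h₂⟩ := ih₂ (g.left c)
        obtain ⟨d, hd, -⟩ := exists_pullback_point g g' c c' hc'.symm
        refine ⟨pullback g g', pullback.fst g g' ≫ g, ⟨d, ?_⟩, e₁ + e₂, ?_⟩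
        · exact congrArg g.left hd
        · have h₁' : F.obj.map ((pullback.fst g g' ≫ g) ≫ f ≫ w).op e₁.1 =
              F.obj.map (pullback.fst g g' ≫ g).op t₁ := by
            rw [Category.assoc, op_comp, Functor.map_comp_apply, h₁, ← Functor.map_comp_apply,
              ← op_comp]
          have h₂' : F.obj.map ((pullback.fst g g' ≫ g) ≫ f ≫ w).op e₂.1 =
              F.obj.map (pullback.fst g g' ≫ g).op t₂ := by
            rw [pullback.condition, Category.assoc, op_comp, Functor.map_comp_apply, h₂,
              ← Functor.map_comp_apply, ← op_comp]
          refine (map_add _ e₁.1 e₂.1).trans ?_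
          rw [h₁', h₂', map_add]
      | neg t _ ih =>
        intro c
        obtain ⟨V, g, hc, e, h⟩ := ih c
        refine ⟨V, g, hc, -e, ?_⟩
        refine (map_neg _ e.1).trans ?_
        rw [h, map_neg]
    obtain ⟨W₁, f, ht, c, rfl⟩ := (mem_smallEtaleTopology_iff _).1 x.2 c
    obtain ⟨W₂, g, ⟨c, rfl⟩, e, he⟩ := key f _ ht c
    refine ⟨W₂, g ≫ f, ⟨c, rfl⟩, e, Subtype.ext ?_⟩
    change F.obj.map ((g ≫ f) ≫ w).op e.1 = F.obj.map (g ≫ f).op x.1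
    rw [Category.assoc, he, op_comp (f := g), Functor.map_comp_apply]
    rfl
  obtain ⟨V, f, ⟨v, rfl⟩, ht⟩ := hz.exists_isTrivialization (isSeparated_forget G) hG b
  let φ : H →+ G.obj.obj (op V) := (G.obj.map f.op).hom.comp z
  -- The value group is the image of `H` over `V`, not `H` itself, since elements of `H` may
  -- coincide there.
  refine ⟨V, ⟨v, ?_⟩, .of φ.range, ?_, AddCommGrpCat.ofHom φ.range.subtype, ht⟩
  · rw [← MorphismProperty.Over.w f]
    rfl
  · have : Finite φ.range := Set.finite_range φ
    exact inferInstanceAs (AddGroup.FG φ.range)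

theorem ind_isLCCAb [CompactSpace X] (hF : IsTorsionSheaf X.smallEtaleTopology F)
    (h₁ : HasClopenEquality (F.obj ⋙ forget Ab.{u}))
    (h₂ : IsLocallyFiniteEtale (F.obj ⋙ forget Ab.{u})) :
    ObjectProperty.ind.{u} (IsLCCAb X ⊓ IsTorsionSheaf X.smallEtaleTopology) F := by
  let e := equivSmallModel.{u} (FEt X)
  let ι := Σ Y : SmallModel.{u} (FEt X), F.obj.obj (op ((FEt.toEtale X).obj (e.inverse.obj Y)))
  refine ind_of_directed (K := Finset ι)
    (fun T ↦ generatedAbSubsheaf F (fun i : ι ↦ e.inverse.obj i.1) (fun i ↦ i.2) T)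
    (fun T ↦ ⟨isLCCAb_generatedAbSubsheaf _ _ _ _ hF h₁,
      isTorsionSheaf_generatedAbSubsheaf _ _ _ _ hF⟩) (fun T ↦ generatedAbSubsheafι _ _ _ _)
    (fun T ↦ generatedAbSubsheafι_injective _ _ _ _)
    (fun T T' h ↦ exists_generatedAbSubsheaf_hom _ _ _ h) fun U x a ↦ ?_
  obtain ⟨V, f, hf, Y, h, s, hs⟩ := h₂.exists_smallModel x a
  let i : ι := ⟨Y, s⟩
  exact ⟨V, f, hf, {i}, ⟨F.obj.map f.op x, Subfunctor.le_sheafify _ _ _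
    (AddSubgroup.subset_closure ⟨i, Finset.mem_singleton_self i, h, hs⟩)⟩, rfl⟩

end AbelianSubsheaf

/-! ### Assembling the equivalences -/

section Conclusion

variable {X : Scheme.{u}}

/-- The étale covers that witness torsion of `F` need not be finite étale. By quasi-compactness one
integer kills the whole section, so the trivial sieve suffices. -/
theorem isTorsionSheaf_rhoPushforward [CompactSpace X] {F : Sheaf X.smallEtaleTopology Ab.{u}}
    (hF : IsTorsionSheaf X.smallEtaleTopology F) :
    IsTorsionSheaf (FEt.topology X) ((rhoPushforward X Ab.{u}).obj F) := by
  intro Y (s : F.obj.obj (op ((FEt.toEtale X).obj Y)))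
  obtain ⟨n, hn, h⟩ := hF.exists_nsmul_eq_zero_of_compactSpace (U := (FEt.toEtale X).obj Y) s
  refine ⟨⊤, (FEt.topology X).top_mem Y, fun V f _ ↦ ⟨n, hn, ?_⟩⟩
  let φ := F.obj.map ((FEt.toEtale X).map f).op
  exact (map_nsmul φ.hom n s).symm.trans ((congrArg φ.hom h).trans (map_zero φ.hom))

variable {A : Type (u + 1)} [Category.{u} A] {FA : A → A → Type*}
  {CA : A → Type u} [∀ V W, FunLike (FA V W) (CA V) (CA W)] [ConcreteCategory.{u} A FA]
  [PreservesLimits (forget A)] [HasColimits A] [HasLimits A]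
  [(forget A).ReflectsIsomorphisms] [PreservesFilteredColimitsOfSize.{u, u} (forget A)]
  [X.smallEtaleTopology.HasSheafCompose (forget A)]

/-- Filtered colimits of locally trivial sheaves have clopen equality, and their sections are étale
locally induced by sections over finite étale schemes. -/
theorem clopen_and_finiteEtale_of_ind [Finite (_root_.ConnectedComponents X)]
    {Q : ObjectProperty (Sheaf X.smallEtaleTopology A)}
    (hQ : ∀ F, Q F → IsLocallyTrivial (F.obj ⋙ forget A)) {F : Sheaf X.smallEtaleTopology A}
    (hF : ObjectProperty.ind.{u} Q F) :
    HasClopenEquality (F.obj ⋙ forget A) ∧ IsLocallyFiniteEtale (F.obj ⋙ forget A) := by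
  obtain ⟨K, _, _, pres, h⟩ := hF
  have h₁ (k : K) := (hQ _ (h k)).hasClopenEquality
  have h₂ (k : K) := (hQ _ (h k)).isLocallyFiniteEtale (isSheaf_forget _)
  exact ⟨hasClopenEquality_of_isColimit pres.isColimit h₁ h₂,
    isLocallyFiniteEtale_of_isColimit pres.isColimit h₂⟩

end Conclusion

end FiniteEtaleTopos

end

theorem mainTheorem9 (X : Scheme.{u}) [CompactSpace X] [QuasiSeparatedSpace X]
    [Finite (_root_.ConnectedComponents X)] :
    (∀ F : Sheaf X.smallEtaleTopology (Type u),
      (∃ G : Sheaf (FiniteEtaleTopos.FEt.topology X) (Type u),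
          Nonempty (F ≅ (FiniteEtaleTopos.rhoPullback X (Type u)).obj G)) ↔
        ObjectProperty.ind.{u} (FiniteEtaleTopos.IsLCC X) F) ∧
    (∀ F : Sheaf X.smallEtaleTopology Ab.{u},
      FiniteEtaleTopos.IsTorsionSheaf X.smallEtaleTopology F →
      ((∃ G : Sheaf (FiniteEtaleTopos.FEt.topology X) Ab.{u},
          FiniteEtaleTopos.IsTorsionSheaf (FiniteEtaleTopos.FEt.topology X) G ∧
          Nonempty (F ≅ (FiniteEtaleTopos.rhoPullback X Ab.{u}).obj G)) ↔
        ObjectProperty.ind.{u} (FiniteEtaleTopos.IsLCCAb X ⊓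
          FiniteEtaleTopos.IsTorsionSheaf X.smallEtaleTopology) F)) := by
  refine ⟨fun F ↦ ⟨?_, fun hF ↦ ?_⟩, fun F hF ↦ ⟨?_, fun hF' ↦ ?_⟩⟩
  · rintro ⟨G, ⟨e⟩⟩
    obtain ⟨h₁, h₂⟩ := FiniteEtaleTopos.clopen_and_finiteEtale_of_iso G e
    exact FiniteEtaleTopos.ind_isLCC F h₁ h₂
  · obtain ⟨h₁, h₂⟩ := FiniteEtaleTopos.clopen_and_finiteEtale_of_ind
      (fun _ h ↦ FiniteEtaleTopos.IsLCC.isLocallyTrivial h) hF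
    -- The sheaf `G` is `ρ_* F`, here and in the abelian case.
    exact ⟨_, FiniteEtaleTopos.nonempty_iso_rhoPullback_rhoPushforward h₁ h₂⟩
  · rintro ⟨G, -, ⟨e⟩⟩
    obtain ⟨h₁, h₂⟩ := FiniteEtaleTopos.clopen_and_finiteEtale_of_iso G e
    exact FiniteEtaleTopos.ind_isLCCAb F hF h₁ h₂
  · obtain ⟨h₁, h₂⟩ := FiniteEtaleTopos.clopen_and_finiteEtale_of_ind
      (fun _ h ↦ FiniteEtaleTopos.IsLCCAb.isLocallyTrivial h.1 h.2) hF'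
    exact ⟨_, FiniteEtaleTopos.isTorsionSheaf_rhoPushforward hF,
      FiniteEtaleTopos.nonempty_iso_rhoPullback_rhoPushforward h₁ h₂⟩
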